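/- For $r\ge 2$, $t_1\ge 2$ and $t_2,\dots,t_r\ge 1$, let $K_r^{+}(t_1,\dots,t_r)$ be the graph obtained from the complete $r$-partite graph with vertex classes of sizes $t_1,\dots,t_r$ by adding one edge inside the first class. An $\ell$-partite graph $G=(V_1\cup\dots\cup V_\ell,E)$, whose vertex set is the disjoint union of non-empty independent sets $V_1,\dots,V_\ell$, is balanced if $|V_1|=\dots=|V_\ell|$. Write $d(V_i,V_j)=\frac{e(V_i,V_j)}{|V_i||V_j|}$, where $e(V_i,V_j)$ is the number of edges between $V_i$ and $V_j$. For $k\ge 3$ and $\ell\ge (k-1)!$, Pfender's family $\mathcal G_\ell^k$ is defined as follows. Let $\pi_1,\dots,\pi_{(k-1)!}$ be an enumeration of all permutations of $\{1,\dots,k-1\}$. Choose non-negative integers $n_i^s$ ($1\le i\le \ell$, $1\le s\le k-1$) such that $n_i^{\pi_i(1)}\ge n_i^{\pi_i(2)}\ge\dots\ge n_i^{\pi_i(k-1)}$ for $1\le i\le (k-1)!$, $n_i^1=n_i^2=\dots=n_i^{k-1}>0$ for $(k-1)!<i\le \ell$, and $\sum_s n_i^s>0$ for all $1\le i\le \ell$.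 Take the graph with vertex set $\{(i,s,t):1\le i\le \ell,\ 1\le s\le k-1,\ 1\le t\le n_i^s\}$ in which $(i,s,t)$ and $(i',s',t')$ are adjacent if and only if $i\ne i'$ and $s\ne s'$. The family $\mathcal G_\ell^k$ consists of all graphs obtained from such graphs by removing some (possibly no) edges $(i,s,t)(i',s',t')$ with $1\le i<i'\le (k-1)!$. **Theorem.** Let $k$ and $\ell$ be integers and $c$ a real number with $k\ge 3$, $0<c\le \frac12 k^{-(k+6)k}$ and $\ell\ge e^{2/c}$. Let $G=(V_1\cup\dots\cup V_\ell,E)$ be a balanced $\ell$-partite graph on $n$ vertices such that $d(V_i,V_j)\ge \frac{k-2}{k-1}$ for all $i\ne j$. Then either $G$ contains a (not necessarily induced) copy of $K_{k-1}^{+}\bigl(\lfloor c\ln n\rfloor,\dots,\lfloor c\ln n\rfloor,\lfloor n^{1-2\sqrt c}\rfloor\bigr)$, in which the $k-2$ first classes have size $\lfloor c\ln n\rfloor$, or $G$ is isomorphic to a graph in $\mathcal G_\ell^k$. -/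

import Mathlib

open scoped Nat

/-- `V₁, …, V_ℓ` (indexed by `Fin ℓ`) are the vertex classes of the balanced `ℓ`-partite graph `G`:
they are non-empty independent sets of the same size which partition the vertex set. -/
structure IsBalancedMultipartite {V : Type*} (G : SimpleGraph V) {ℓ : ℕ}
    (P : Fin ℓ → Finset V) : Prop where
  nonempty : ∀ i, (P i).Nonempty
  disjoint : ∀ i j, i ≠ j → Disjoint (P i) (P j)
  cover : ∀ v, ∃ i, v ∈ P i
  independent : ∀ i, ∀ u ∈ P i, ∀ v ∈ P i, ¬ G.Adj u v
  card_eq : ∀ i j, (P i).card = (P j).card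

/-- The graph `K_r^+(t 0, …, t (r - 1))`: the complete `r`-partite graph with classes of sizes
`t 0, …, t (r - 1)`, plus one edge joining the vertices number `0` and `1` of the first class
(which is assumed to have at least two vertices). -/
def completePlus {r : ℕ} (t : Fin r → ℕ) : SimpleGraph (Σ i : Fin r, Fin (t i)) :=
  SimpleGraph.completeMultipartiteGraph (fun i : Fin r => Fin (t i)) ⊔
    SimpleGraph.fromRel (fun x y =>
      (x.1 : ℕ) = 0 ∧ (y.1 : ℕ) = 0 ∧ (x.2 : ℕ) = 0 ∧ (y.2 : ℕ) = 1)

/-- The sizes `(a, …, a, b)` of `r` vertex classes. -/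
def lastSize (r a b : ℕ) : Fin r → ℕ :=
  fun i => if (i : ℕ) + 1 = r then b else a

/-- The admissible weights `n i s` (for `i` in `Fin ℓ`, `s` in `Fin (k - 1)`) in the construction of
Pfender's graphs. All indices start at `0`; `π` enumerates all permutations of the colours. -/
structure IsPfenderWeight (k ℓ : ℕ) (n : Fin ℓ → Fin (k - 1) → ℕ) : Prop where
  three_le : 3 ≤ k
  factorial_le : (k - 1)! ≤ ℓ
  sorted : ∃ π : Fin ((k - 1)!) ≃ Equiv.Perm (Fin (k - 1)),
    ∀ (i : Fin ℓ) (hi : (i : ℕ) < (k - 1)!), ∀ s s' : Fin (k - 1), s ≤ s' →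
      n i (π ⟨i, hi⟩ s') ≤ n i (π ⟨i, hi⟩ s)
  constant : ∀ i : Fin ℓ, (k - 1)! ≤ (i : ℕ) → ∀ s s', n i s = n i s' ∧ 0 < n i s
  sum_pos : ∀ i, 0 < ∑ s, n i s

/-- The vertices `(i, s, t)` of a Pfender graph. -/
abbrev PfenderVertex (k ℓ : ℕ) (n : Fin ℓ → Fin (k - 1) → ℕ) : Type :=
  Σ i : Fin ℓ, Σ s : Fin (k - 1), Fin (n i s)

/-- The full graph: `(i, s, t)` and `(i', s', t')` are adjacent iff `i ≠ i'` and `s ≠ s'`. -/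
def pfenderGraph (k ℓ : ℕ) (n : Fin ℓ → Fin (k - 1) → ℕ) :
    SimpleGraph (PfenderVertex k ℓ n) where
  Adj x y := x.1 ≠ y.1 ∧ x.2.1 ≠ y.2.1
  symm := ⟨fun _ _ h => ⟨h.1.symm, h.2.symm⟩⟩
  loopless := ⟨fun _ h => h.1 rfl⟩

/-- The graphs obtained from `pfenderGraph k ℓ n` by removing some edges whose two ends both lie in
the first `(k - 1)!` parts. -/
def pfenderSubgraphs (k ℓ : ℕ) (n : Fin ℓ → Fin (k - 1) → ℕ) :
    Set (SimpleGraph (PfenderVertex k ℓ n)) :=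
  {H | H ≤ pfenderGraph k ℓ n ∧
    ∀ x y, (pfenderGraph k ℓ n).Adj x y → ¬ H.Adj x y →
      (x.1 : ℕ) < (k - 1)! ∧ (y.1 : ℕ) < (k - 1)!}

/-- `G` is isomorphic to a graph in Pfender's family `𝒢_ℓ^k`. -/
def IsoToPfenderFamily (k ℓ : ℕ) {V : Type*} (G : SimpleGraph V) : Prop :=
  ∃ n : Fin ℓ → Fin (k - 1) → ℕ, IsPfenderWeight k ℓ n ∧
    ∃ H ∈ pfenderSubgraphs k ℓ n, Nonempty (G ≃g H)

/-!
Write `r = k - 1`, `H = k ^ (k + 6)`, `m` for the common size of the parts and `n = ℓ * m`. Suppose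
that `G` contains no `K_r^+(a, …, a, b)`, where `a` is about `c ln n` and `b` about `n ^ (1 - 2√c)`.

*Joints.* If `u v` is an edge, the sets `X i` are large, all but the first consist of common
neighbours of `u` and `v`, and a proportion of about `1 / H` of the tuples in `∏ X i` are cliques,
then a repeated Kővári–Sós–Turán argument (`exists_common_of_dense`, `exists_block`) finds complete
`r`-partite blocks in `∏ X i`, to which `u v` is added
(`completePlus_isContained_of_cliqueTuples`). Hence `G` is `JointFree`: no such `u v` and `X`
exist. The rest of the argument uses the forbidden subgraph only through this property, mostly in
the form `JointFree.false_of_missing`: where `G` is nearly complete `r`-partite, an edge cannot have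
many common neighbours in all classes but one.

*A first colouring.* A set `S` maximising `2 e(S) - (1 - 1 / r - 1 / H) |S|²` has large minimum
degree. It contains no clique of size `r + 1`, since one of the edges of such a clique would have so
many common neighbours that it would be a joint (`JointFree.not_isNClique`); so `S` is `r`-partite
by a weak form of the Andrásfai–Erdős–Sós theorem (`exists_coloring_of_minDegree`). The density
condition forces `S` to omit few vertices and the colouring to be nearly complete, and giving each
remaining vertex a colour in which it has few neighbours extends it to all of `G`
(`JointFree.exists_coloring_univ`).

*Exactness.* Let `J` be the parts whose colours, ordered by frequency, come in the same order.
By Chebyshev's sum inequality at least `m² / r` of the pairs between two parts of `J` have equal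
colours, so the density condition allows at most as many missing pairs of distinct colours as there
are edges inside of colour classes. But an edge inside of a class has an end with many missing
pairs, because otherwise it would be a joint. So there are neither missing pairs nor edges inside of
classes (`JointFree.exact_of_chebyshev`), and by the case of equality in Chebyshev's inequality all
parts of `J` but one have all colours equally often (`JointFree.exists_balanced_family`).

*Propagation.* Between a part and the balanced parts the densities are attained only if every vertex
is joined to all but one of the colour classes of the balanced parts. Giving each vertex the colour
of the exceptional class makes `G` properly `r`-coloured (`JointFree.exists_proper`).

*Structure.* In a properly `r`-coloured `G`, Chebyshev's inequality for two parts with the same order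
of colours shows that one of them is balanced (`IsDenseMultipartite.const_or_const`). So there are
at most `r!` unbalanced parts, one for each order; and a balanced part is completely joined to all
vertices of other parts and colours. This is the definition of Pfender's family.
-/

/-! ### Complete multipartite blocks in dense sets of cliques -/

section Blocks

open Finset

variable {V : Type*}

/-- The ordered cliques `(T 0, …, T (q - 1))` of `G` with `T i ∈ X i`. -/
noncomputable def cliqueTuples (G : SimpleGraph V) {q : ℕ} (X : Fin q → Finset V) :
    Finset (Fin q → V) :=
  open Classical in {T ∈ Fintype.piFinset X | ∀ i j, i ≠ j → G.Adj (T i) (T j)}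

theorem mem_cliqueTuples {G : SimpleGraph V} {q : ℕ} {X : Fin q → Finset V} {T : Fin q → V} :
    T ∈ cliqueTuples G X ↔ (∀ i, T i ∈ X i) ∧ ∀ i j, i ≠ j → G.Adj (T i) (T j) := by
  simp [cliqueTuples]

open Classical in
/-- A Kővári–Sós–Turán type statement: if each of `H * s` indices is related to a `2 / H` fraction
of `X`, then some `s` of them have at least `|X| / (H * 2 ^ (H * s))` common relatives in `X`. -/
theorem exists_common_of_dense {ι : Type*} [Fintype ι] (X : Finset V) (rel : ι → V → Prop)
    (H s : ℕ) (hH : 0 < H) (hs : 0 < s) (hι : Fintype.card ι = H * s)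
    (h : ∀ p, 2 * #X ≤ H * #{w ∈ X | rel p w}) :
    ∃ e : Fin s ↪ ι, ∃ W ⊆ X, #X ≤ #W * (H * 2 ^ (H * s)) ∧ ∀ w ∈ W, ∀ p, rel (e p) w := by
  -- on average an element of `X` has `2 * s` relatives, so that many have at least `s`
  set W₀ : Finset V := {w ∈ X | s ≤ #{p | rel p w}} with hW₀
  have hW₀card : #X ≤ H * #W₀ := by
    have h1 : ∑ p, #{w ∈ X | rel p w} = ∑ w ∈ X, #{p | rel p w} := by
      simp only [card_filter]
      exact sum_comm
    have h2 : 2 * #X * (H * s) ≤ H * ∑ p, #{w ∈ X | rel p w} := by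
      rw [mul_sum, ← hι, ← card_univ, mul_comm (2 * #X)]
      exact card_nsmul_le_sum _ _ _ fun p _ => h p
    have h3 : ∑ w ∈ X, #{p | rel p w} ≤ #W₀ * (H * s) + #X * s := by
      have : ∀ w ∈ X, #{p | rel p w} ≤ (if s ≤ #{p | rel p w} then H * s else 0) + s := by
        intro w _
        split_ifs with hw
        · refine (card_le_univ _).trans ?_
          omega
        · omega
      refine (sum_le_sum this).trans ?_
      rw [sum_add_distrib, ← sum_filter, sum_const, sum_const, smul_eq_mul, smul_eq_mul]
    rw [h1] at h2
    have h4 := h2.trans (Nat.mul_le_mul_left H h3)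
    have : H * s * #X ≤ H * s * (H * #W₀) := by nlinarith
    exact Nat.le_of_mul_le_mul_left this (by positivity)
  -- every vertex of `W₀` chooses `s` of its relatives; the most popular choice is taken
  have hchoice : ∀ w, ∃ S : Finset ι, #S = s ∧ (w ∈ W₀ → ∀ p ∈ S, rel p w) := by
    intro w
    by_cases hw : w ∈ W₀
    · obtain ⟨S, hS, hSs⟩ := exists_subset_card_eq (mem_filter.1 hw).2
      exact ⟨S, hSs, fun _ p hp => (mem_filter.1 (hS hp)).2⟩
    · obtain ⟨S, -, hSs⟩ := exists_subset_card_eq (s := (univ : Finset ι)) (n := s) (by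
        rw [card_univ, hι]
        exact Nat.le_mul_of_pos_left s hH)
      exact ⟨S, hSs, fun h => absurd h hw⟩
  choose g hgs hg using hchoice
  set Pow : Finset (Finset ι) := powersetCard s univ with hPow
  have hPowcard : #Pow ≤ 2 ^ (H * s) := by
    rw [hPow, card_powersetCard, card_univ, hι]
    exact Nat.choose_le_two_pow _ _
  have hPowne : Pow.Nonempty := by
    rw [hPow, powersetCard_nonempty, card_univ, hι]
    exact Nat.le_mul_of_pos_left s hH
  obtain ⟨S, hS, hSX⟩ := exists_le_of_sum_le (s := Pow) (f := fun _ => #X)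
      (g := fun S => #{w ∈ W₀ | g w = S} * (H * 2 ^ (H * s))) hPowne (by
    rw [sum_const, smul_eq_mul, ← sum_mul, ← card_eq_sum_card_fiberwise
      (fun w _ => by simp [hPow, hgs])]
    calc #Pow * #X ≤ 2 ^ (H * s) * (H * #W₀) := Nat.mul_le_mul hPowcard hW₀card
      _ = #W₀ * (H * 2 ^ (H * s)) := by ring)
  have hScard : #S = s := (mem_powersetCard.1 hS).2
  refine ⟨((S.equivFinOfCardEq hScard).symm.toEmbedding).trans (Function.Embedding.subtype _),
    {w ∈ W₀ | g w = S}, (filter_subset _ _).trans (filter_subset _ _), hSX, ?_⟩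
  intro w hw p
  obtain ⟨hw0, rfl⟩ := mem_filter.1 hw
  exact hg w hw0 _ (Subtype.prop _)

/-- A block: `s` tuples from `𝓜`, disjoint from each other, such that any two of their entries with
different indices are adjacent. -/
def IsBlock (G : SimpleGraph V) {q s : ℕ} (𝓜 : Finset (Fin q → V)) (f : Fin s → Fin q → V) :
    Prop :=
  (∀ p, f p ∈ 𝓜) ∧ (∀ p p' i j, i ≠ j → G.Adj (f p i) (f p' j)) ∧
    ∀ i, Function.Injective fun p => f p i

open Classical in
/-- The tuples in `∏ X i` over the first `q` indices for which at least a `2 / H` fraction of the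
extensions by a vertex of the last set belong to `𝓜`. -/
noncomputable def extendable {q : ℕ} (H : ℕ) (X : Fin (q + 1) → Finset V)
    (𝓜 : Finset (Fin (q + 1) → V)) : Finset (Fin q → V) :=
  {T ∈ Fintype.piFinset fun i : Fin q => X i.castSucc |
    2 * #(X (Fin.last q)) ≤ H * #{w ∈ X (Fin.last q) | (Fin.snoc T w : Fin (q + 1) → V) ∈ 𝓜}}

theorem mem_of_mem_extendable {q H : ℕ} {X : Fin (q + 1) → Finset V}
    {𝓜 : Finset (Fin (q + 1) → V)} {T : Fin q → V} (hT : T ∈ extendable H X 𝓜) (i : Fin q) :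
    T i ∈ X i.castSucc := by
  have := (mem_filter.1 hT).1
  simp only [Fintype.mem_piFinset] at this
  exact this i

theorem adj_of_mem_extendable {G : SimpleGraph V} {q H : ℕ} {X : Fin (q + 1) → Finset V}
    {𝓜 : Finset (Fin (q + 1) → V)} (hadj : ∀ T ∈ 𝓜, ∀ i j, i ≠ j → G.Adj (T i) (T j))
    (hpos : 0 < #(X (Fin.last q))) {T : Fin q → V} (hT : T ∈ extendable H X 𝓜) (i j : Fin q)
    (hij : i ≠ j) : G.Adj (T i) (T j) := by
  classical
  obtain ⟨_, hT⟩ := mem_filter.1 hT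
  have : 0 < #{w ∈ X (Fin.last q) | (Fin.snoc T w : Fin (q + 1) → V) ∈ 𝓜} := by
    refine Nat.pos_of_ne_zero fun h => ?_
    have hT' : 2 * #(X (Fin.last q)) ≤ H * 0 := by
      rw [← h]
      convert hT
    omega
  obtain ⟨w, hw⟩ := card_pos.1 this
  have := hadj _ (mem_filter.1 hw).2 i.castSucc j.castSucc (by simpa using hij)
  simpa using this

open Classical in
/-- If `𝓜` has density `(2 (q + 1) + 1) / H`, then the extendable tuples have density
`(2 q + 1) / H`: a non-extendable tuple accounts for at most `2 / H` of its extensions. -/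
theorem card_extendable {q : ℕ} (H : ℕ) (X : Fin (q + 1) → Finset V)
    (𝓜 : Finset (Fin (q + 1) → V)) (hX : ∀ T ∈ 𝓜, ∀ i, T i ∈ X i) (hpos : 0 < #(X (Fin.last q)))
    (hcard : (2 * (q + 1) + 1) * ∏ i, #(X i) ≤ H * #𝓜) :
    (2 * q + 1) * ∏ i : Fin q, #(X i.castSucc) ≤ H * #(extendable H X 𝓜) := by
  set L := X (Fin.last q)
  have h1 : #𝓜 = ∑ T ∈ Fintype.piFinset fun i : Fin q => X i.castSucc,
      #{w ∈ L | (Fin.snoc T w : Fin (q + 1) → V) ∈ 𝓜} := by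
    rw [card_eq_sum_card_fiberwise (f := fun T : Fin (q + 1) → V => (Fin.init T : Fin q → V))
      (t := Fintype.piFinset fun i : Fin q => X i.castSucc)]
    · refine sum_congr rfl fun T _ => ?_
      refine card_bij (fun U _ => U (Fin.last q)) ?_ ?_ ?_
      · intro U hU
        obtain ⟨hU, h⟩ := mem_filter.1 hU
        rw [mem_filter, ← h, Fin.snoc_init_self]
        exact ⟨hX U hU _, hU⟩
      · intro U hU U' hU' h
        obtain ⟨hU, h1⟩ := mem_filter.1 hU
        obtain ⟨hU', h2⟩ := mem_filter.1 hU'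
        rw [← Fin.snoc_init_self U, ← Fin.snoc_init_self U', h, h1, h2]
      · intro w hw
        obtain ⟨hw, h⟩ := mem_filter.1 hw
        exact ⟨_, mem_filter.2 ⟨h, by simp⟩, by simp⟩
    · intro T hT
      simpa [Fin.init] using fun i : Fin q => hX T hT i.castSucc
  have h2 : H * #𝓜 ≤ H * (#(extendable H X 𝓜) * #L) + (∏ i : Fin q, #(X i.castSucc)) * (2 * #L) := by
    have : ∀ T ∈ Fintype.piFinset fun i : Fin q => X i.castSucc,
        H * #{w ∈ L | (Fin.snoc T w : Fin (q + 1) → V) ∈ 𝓜} ≤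
          (if 2 * #L ≤ H * #{w ∈ L | (Fin.snoc T w : Fin (q + 1) → V) ∈ 𝓜}
            then H * #L else 0) + 2 * #L := by
      intro T _
      split_ifs with hT
      · exact le_add_right (Nat.mul_le_mul_left _ (card_filter_le _ _))
      · omega
    rw [h1, mul_sum]
    refine (sum_le_sum this).trans ?_
    rw [sum_add_distrib, ← sum_filter, sum_const, sum_const, smul_eq_mul, smul_eq_mul,
      Fintype.card_piFinset]
    refine le_of_eq ?_
    rw [extendable]
    ring
  rw [Fin.prod_univ_castSucc] at hcard
  have h3 := hcard.trans h2
  have : #L * ((2 * q + 1) * ∏ i : Fin q, #(X i.castSucc)) ≤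
      #L * (H * #(extendable H X 𝓜)) := by nlinarith
  exact Nat.le_of_mul_le_mul_left this hpos

/-- A block of `H * s` extendable tuples contains a block of `s` tuples which have many common
extensions in `𝓜`. -/
theorem exists_block_snoc (G : SimpleGraph V) {q s H : ℕ} (hH : 0 < H) (hs : 0 < s)
    (X : Fin (q + 1) → Finset V) (𝓜 : Finset (Fin (q + 1) → V))
    (f : Fin (H * s) → Fin q → V) (hf : IsBlock G (extendable H X 𝓜) f) :
    ∃ f' : Fin s → Fin q → V, ∃ W ⊆ X (Fin.last q), IsBlock G (extendable H X 𝓜) f' ∧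
      #(X (Fin.last q)) ≤ #W * (H * 2 ^ (H * s)) ∧
      ∀ w ∈ W, ∀ p, (Fin.snoc (f' p) w : Fin (q + 1) → V) ∈ 𝓜 := by
  classical
  obtain ⟨e, W, hWX, hW, h⟩ := exists_common_of_dense (X (Fin.last q))
    (fun p w => (Fin.snoc (f p) w : Fin (q + 1) → V) ∈ 𝓜) H s hH hs (Fintype.card_fin _)
    (fun p => by
      have := (mem_filter.1 (hf.1 p)).2
      convert this)
  exact ⟨fun p => f (e p), W, hWX, ⟨fun p => hf.1 _, fun p p' => hf.2.1 _ _,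
    fun i => (hf.2.2 i).comp e.injective⟩, hW, h⟩

/-- A set of cliques of density `(2 q + 1) / H` contains a block of size `s`. The induction on `q`
removes the last entry, at the price of asking for a block that is `H` times as large; so the bound
`B` has to exceed `s * H ^ q`. -/
theorem exists_block (G : SimpleGraph V) {H B : ℕ} (hH : 0 < H) :
    ∀ (q s : ℕ) (_ : 0 < s) (_ : s * H ^ q ≤ B) (X : Fin q → Finset V)
      (𝓜 : Finset (Fin q → V)), (∀ T ∈ 𝓜, ∀ i, T i ∈ X i) →
      (∀ T ∈ 𝓜, ∀ i j, i ≠ j → G.Adj (T i) (T j)) →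
      (∀ i, B * (H * 2 ^ B) ≤ #(X i)) → (2 * q + 1) * ∏ i, #(X i) ≤ H * #𝓜 →
      ∃ f : Fin s → Fin q → V, IsBlock G 𝓜 f := by
  intro q
  induction q with
  | zero =>
    intro s _ _ X 𝓜 _ _ _ hcard
    have : 𝓜.Nonempty := by
      rw [← card_pos]
      refine Nat.pos_of_ne_zero fun h => ?_
      simp [h] at hcard
    obtain ⟨T, hT⟩ := this
    exact ⟨fun _ => T, fun _ => hT, fun _ _ i => i.elim0, fun i => i.elim0⟩
  | succ q ih =>
    intro s hs hsB X 𝓜 hX hadj hbig hcard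
    have hBpos : 0 < B := lt_of_lt_of_le (by positivity) hsB
    have hHsB : H * s ≤ B := by
      refine le_trans ?_ hsB
      rw [pow_succ, mul_comm H s]
      exact Nat.mul_le_mul_left _ (Nat.le_mul_of_pos_left _ (by positivity))
    have hpos : 0 < #(X (Fin.last q)) := lt_of_lt_of_le (by positivity) (hbig _)
    have hext := card_extendable H X 𝓜 hX hpos hcard
    obtain ⟨f, hf⟩ := ih (H * s) (by positivity) (by rw [pow_succ] at hsB; linarith)
      (fun i => X i.castSucc) (extendable H X 𝓜) (fun T hT => mem_of_mem_extendable hT)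
      (fun T hT => adj_of_mem_extendable hadj hpos hT) (fun i => hbig _) hext
    obtain ⟨f', W, hWX, hf', hW, hmem⟩ := exists_block_snoc G hH hs X 𝓜 f hf
    have hsW : s ≤ #W := by
      by_contra! hlt
      have h1 : B * (H * 2 ^ B) ≤ #W * (H * 2 ^ B) :=
        (hbig _).trans (hW.trans (Nat.mul_le_mul_left _ (Nat.mul_le_mul_left _
          (Nat.pow_le_pow_right (by norm_num) hHsB))))
      have h2 := Nat.le_of_mul_le_mul_right h1 (by positivity)
      have : s ≤ H * s := Nat.le_mul_of_pos_left s hH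
      omega
    obtain ⟨W', hW'W, hW's⟩ := exists_subset_card_eq hsW
    let e := W'.equivFinOfCardEq hW's
    have hmem' : ∀ p p', (Fin.snoc (f' p) (e.symm p' : V) : Fin (q + 1) → V) ∈ 𝓜 := fun p p' =>
      hmem _ (hW'W (Subtype.prop _)) p
    refine ⟨fun p => Fin.snoc (f' p) (e.symm p : V), fun p => hmem' p p, ?_, ?_⟩
    · intro p p' i j
      refine Fin.lastCases ?_ (fun i => ?_) i <;> refine Fin.lastCases ?_ (fun j => ?_) j <;>
        intro hij
      · exact absurd rfl hij
      · have := hadj _ (hmem' p' p) (Fin.last q) j.castSucc hij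
        simpa using this
      · have := hadj _ (hmem' p p') i.castSucc (Fin.last q) hij
        simpa using this
      · simpa using hf'.2.1 p p' i j (by simpa using hij)
    · intro i
      refine Fin.lastCases ?_ (fun i => ?_) i
      · intro p p' h
        simpa using h
      · intro p p' h
        exact hf'.2.2 i (by simpa using h)

/-- An enumeration of `A`, extended to all natural numbers by the junk value `d`. -/
theorem exists_enum (A : Finset V) (d : V) :
    ∃ g : ℕ → V, (∀ x < #A, g x ∈ A) ∧ ∀ x < #A, ∀ y < #A, g x = g y → x = y := by
  refine ⟨fun x => if h : x < #A then A.equivFin.symm ⟨x, h⟩ else d, fun x hx => ?_,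
    fun x hx y hy h => ?_⟩
  · simp [hx]
  · simpa [hx, hy] using h

/-- An enumeration of `A` which starts with `u` and `v`. -/
theorem exists_enum_of_ne (A : Finset V) {u v : V} (hu : u ∈ A) (hv : v ∈ A) (huv : u ≠ v) :
    ∃ g : ℕ → V, g 0 = u ∧ g 1 = v ∧ (∀ x < #A, g x ∈ A) ∧
      ∀ x < #A, ∀ y < #A, g x = g y → x = y := by
  classical
  obtain ⟨ψ, hψ, hψinj⟩ := exists_enum ((A.erase u).erase v) u
  have hcard : #((A.erase u).erase v) = #A - 1 - 1 := by
    rw [card_erase_of_mem (by simp [hv, huv.symm]), card_erase_of_mem hu]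
  rw [hcard] at hψ hψinj
  have hψ' : ∀ x, x + 2 < #A → ψ x ≠ v ∧ ψ x ≠ u ∧ ψ x ∈ A := fun x hx => by
    simpa using hψ x (by omega)
  refine ⟨fun x => match x with
    | 0 => u
    | 1 => v
    | x + 2 => ψ x, rfl, rfl, ?_, ?_⟩
  · rintro (_ | _ | x) hx
    · exact hu
    · exact hv
    · exact (hψ' x hx).2.2
  · rintro (_ | _ | x) hx (_ | _ | y) hy h
    · rfl
    · exact absurd h huv
    · exact absurd h.symm (hψ' y hy).2.1
    · exact absurd h.symm huv
    · rfl
    · exact absurd h.symm (hψ' y hy).1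
    · exact absurd h (hψ' x hx).2.1
    · exact absurd h (hψ' x hx).1
    · rw [hψinj x (by omega) y (by omega) h]

/-- A block `f` of `a` tuples and a set `W` of `b` common extensions yield a copy of
`K_r^+(a, …, a, b)` as soon as there is an edge `u v` both ends of which are adjacent to all their
vertices but those of the first class: `u` and `v` are put into the first class. -/
theorem completePlus_isContained_of_block (G : SimpleGraph V) {q a b : ℕ} (hq : 0 < q)
    {u v : V} (huv : G.Adj u v) (f : Fin a → Fin q → V) (W : Finset V) (hbW : b ≤ #W)
    (hadj : ∀ p p' i j, i ≠ j → G.Adj (f p i) (f p' j))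
    (hinj : ∀ i, Function.Injective fun p => f p i)
    (hW : ∀ w ∈ W, ∀ p i, G.Adj (f p i) w)
    (hu : ∀ p, ∀ i : Fin q, (i : ℕ) ≠ 0 → G.Adj u (f p i) ∧ G.Adj v (f p i))
    (huW : ∀ w ∈ W, G.Adj u w ∧ G.Adj v w) :
    (completePlus (lastSize (q + 1) a b)).IsContained G := by
  classical
  -- the classes of the copy, where the first one may have up to two vertices to spare
  let A : Fin (q + 1) → Finset V := fun i => Fin.lastCases W
    (fun i => (if (i : ℕ) = 0 then {u, v} else ∅) ∪ univ.image fun p => f p i) i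
  have hA_last : A (Fin.last q) = W := by simp [A]
  have hA_cast : ∀ i : Fin q, A i.castSucc =
      (if (i : ℕ) = 0 then {u, v} else ∅) ∪ univ.image fun p => f p i := fun i => by simp [A]
  have hAcard : ∀ i, lastSize (q + 1) a b i ≤ #(A i) := by
    intro i
    refine Fin.lastCases ?_ (fun i => ?_) i
    · simpa [lastSize, hA_last] using hbW
    · rw [hA_cast]
      have h : (i : ℕ) ≠ q := i.2.ne
      have : a = #(univ.image fun p => f p i) := by
        rw [card_image_of_injective _ (hinj i), card_univ, Fintype.card_fin]
      simp only [lastSize, Fin.val_castSucc, add_left_inj, h, if_false]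
      refine this.le.trans (card_le_card ?_)
      exact subset_union_right
  have hAadj_cast : ∀ i j : Fin q, i < j → ∀ x ∈ A i.castSucc, ∀ y ∈ A j.castSucc,
      G.Adj x y := by
    intro i j hij x hx y hy
    have hj : (j : ℕ) ≠ 0 := by have := Fin.lt_def.1 hij; omega
    rw [hA_cast, if_neg hj, empty_union] at hy
    obtain ⟨p', -, rfl⟩ := mem_image.1 hy
    rw [hA_cast, mem_union] at hx
    rcases hx with hx | hx
    · split_ifs at hx
      · rcases mem_insert.1 hx with rfl | hx
        · exact (hu _ _ hj).1
        · rw [mem_singleton.1 hx]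
          exact (hu _ _ hj).2
      · simp at hx
    · obtain ⟨p, -, rfl⟩ := mem_image.1 hx
      exact hadj _ _ _ _ hij.ne
  have hAadj_last : ∀ i : Fin q, ∀ x ∈ A i.castSucc, ∀ y ∈ A (Fin.last q), G.Adj x y := by
    intro i x hx y hy
    rw [hA_last] at hy
    rw [hA_cast, mem_union] at hx
    rcases hx with hx | hx
    · split_ifs at hx
      · rcases mem_insert.1 hx with rfl | hx
        · exact (huW _ hy).1
        · rw [mem_singleton.1 hx]
          exact (huW _ hy).2
      · simp at hx
    · obtain ⟨p, -, rfl⟩ := mem_image.1 hx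
      exact hW _ hy _ _
  have hAadj : ∀ i j, i ≠ j → ∀ x ∈ A i, ∀ y ∈ A j, G.Adj x y := by
    intro i j
    refine Fin.lastCases ?_ (fun i => ?_) i <;> refine Fin.lastCases ?_ (fun j => ?_) j <;>
      intro hij x hx y hy
    · exact absurd rfl hij
    · exact (hAadj_last _ _ hy _ hx).symm
    · exact hAadj_last _ _ hx _ hy
    · have hij' : i ≠ j := by simpa using hij
      rcases lt_or_gt_of_ne hij' with h | h
      · exact hAadj_cast _ _ h _ hx _ hy
      · exact (hAadj_cast _ _ h _ hy _ hx).symm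
  have henum : ∀ i : Fin (q + 1), ∃ g : ℕ → V, ((i : ℕ) = 0 → g 0 = u ∧ g 1 = v) ∧
      (∀ x < #(A i), g x ∈ A i) ∧ ∀ x < #(A i), ∀ y < #(A i), g x = g y → x = y := by
    intro i
    by_cases hi : (i : ℕ) = 0
    · have hA0 : {u, v} ⊆ A i := by
        have : i = Fin.castSucc ⟨0, hq⟩ := Fin.ext (by simpa using hi)
        rw [this, hA_cast, if_pos rfl]
        exact subset_union_left
      obtain ⟨g, h0, h1, h2⟩ := exists_enum_of_ne (A i) (u := u) (v := v) (hA0 (by simp))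
        (hA0 (by simp)) huv.ne
      exact ⟨g, fun _ => ⟨h0, h1⟩, h2⟩
    · obtain ⟨g, h2⟩ := exists_enum (A i) u
      exact ⟨g, fun h => absurd h hi, h2⟩
  choose g guv gmem ginj using henum
  have hmem : ∀ (i : Fin (q + 1)) (x : Fin (lastSize (q + 1) a b i)), g i x ∈ A i := fun i x =>
    gmem i x (x.2.trans_le (hAcard i))
  refine ⟨⟨⟨fun z => g z.1 z.2, ?_⟩, ?_⟩⟩
  · rintro ⟨i, x⟩ ⟨j, y⟩ h
    rcases h with h | h
    · exact hAadj i j (by simpa using h) _ (hmem i x) _ (hmem j y)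
    · obtain ⟨-, h | h⟩ := h
      · obtain ⟨hi, hj, hx, hy⟩ := h
        dsimp only at hi hj hx hy ⊢
        rw [hx, hy, (guv i hi).1, (guv j hj).2]
        exact huv
      · obtain ⟨hj, hi, hy, hx⟩ := h
        dsimp only at hi hj hx hy ⊢
        rw [hx, hy, (guv i hi).2, (guv j hj).1]
        exact huv.symm
  · rintro ⟨i, x⟩ ⟨j, y⟩ h
    have h' : g i x = g j y := h
    by_cases hij : i = j
    · subst hij
      have := ginj i x (x.2.trans_le (hAcard i)) y (y.2.trans_le (hAcard i)) h'
      rw [Fin.ext this]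
    · exact absurd h' (hAadj i j hij _ (hmem i x) _ (hmem j y)).ne

/-- Let `X i` be large sets, which for `i ≠ 0` consist of common neighbours of the ends of an edge
`u v`. If a positive proportion of the tuples in `∏ X i` are cliques, then `G` contains a copy of
`K_r^+(a, …, a, b)`. -/
theorem completePlus_isContained_of_cliqueTuples (G : SimpleGraph V) {r a b H B N : ℕ}
    (hr : 2 ≤ r) (ha : 0 < a) (hH : 0 < H) (hB : a * H ^ r ≤ B) (hN : B * (H * 2 ^ B) ≤ N)
    (hbN : b * (H * 2 ^ (H * a)) ≤ N) {u v : V} (huv : G.Adj u v) (X : Fin r → Finset V)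
    (hX : ∀ i, N ≤ #(X i)) (huvX : ∀ i : Fin r, (i : ℕ) ≠ 0 → ∀ x ∈ X i, G.Adj u x ∧ G.Adj v x)
    (hcard : (2 * r + 1) * ∏ i, #(X i) ≤ H * #(cliqueTuples G X)) :
    (completePlus (lastSize r a b)).IsContained G := by
  obtain ⟨q, rfl⟩ : ∃ q, r = q + 1 := ⟨r - 1, by omega⟩
  have hadj : ∀ T ∈ cliqueTuples G X, ∀ i j, i ≠ j → G.Adj (T i) (T j) := fun T hT =>
    (mem_cliqueTuples.1 hT).2
  have hmemX : ∀ T ∈ cliqueTuples G X, ∀ i, T i ∈ X i := fun T hT => (mem_cliqueTuples.1 hT).1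
  have hBpos : 0 < B := lt_of_lt_of_le (by positivity) hB
  have hNpos : 0 < N := lt_of_lt_of_le (by positivity) hN
  have hpos := hNpos.trans_le (hX (Fin.last q))
  have hext := card_extendable H X _ hmemX hpos hcard
  obtain ⟨f₀, hf₀⟩ := exists_block G hH q (H * a) (by positivity)
    (by rw [pow_succ] at hB; linarith) (fun i => X i.castSucc)
    (extendable H X (cliqueTuples G X)) (fun T hT => mem_of_mem_extendable hT)
    (fun T hT => adj_of_mem_extendable hadj hpos hT) (fun i => hN.trans (hX _)) hext
  obtain ⟨f, W, hWX, hf, hW, hmem⟩ := exists_block_snoc G hH ha X _ f₀ hf₀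
  have hbW : b ≤ #W := Nat.le_of_mul_le_mul_right
    (hbN.trans ((hX _).trans hW)) (show 0 < H * 2 ^ (H * a) by positivity)
  refine completePlus_isContained_of_block G (by omega) huv f W hbW hf.2.1 hf.2.2 ?_ ?_ ?_
  · intro w hw p i
    have := hadj _ (hmem w hw p) i.castSucc (Fin.last q) i.castSucc_ne_last
    simpa using this
  · intro p i hi
    exact huvX i.castSucc hi _ (mem_of_mem_extendable (hf.1 p) i)
  · intro w hw
    exact huvX (Fin.last q) (by simp; omega) w (hWX hw)

end Blocks

/-! ### Cliques and joints -/

section Cliques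

open Finset

variable {V : Type*}

open Classical in
/-- Choosing the first entry last: each clique on the remaining classes has many extensions. -/
theorem card_cliqueTuples_succ (G : SimpleGraph V) {q : ℕ} (X : Fin (q + 1) → Finset V) (x : ℝ)
    (h : ∀ T ∈ cliqueTuples G (fun i : Fin q => X i.succ),
      x ≤ #{w ∈ X 0 | ∀ i, G.Adj w (T i)}) :
    #(cliqueTuples G fun i : Fin q => X i.succ) * x ≤ #(cliqueTuples G X) := by
  have h1 : ∀ T ∈ cliqueTuples G (fun i : Fin q => X i.succ),
      #{w ∈ X 0 | ∀ i, G.Adj w (T i)} ≤ #{U ∈ cliqueTuples G X | Fin.tail U = T} := by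
    intro T hT
    obtain ⟨hT1, hT2⟩ := mem_cliqueTuples.1 hT
    refine card_le_card_of_injOn (fun w => (Fin.cons w T : Fin (q + 1) → V)) ?_ ?_
    · intro w hw
      obtain ⟨hw1, hw2⟩ := mem_filter.1 hw
      refine mem_filter.2 ⟨mem_cliqueTuples.2 ⟨fun i => ?_, fun i j => ?_⟩, by simp⟩
      · refine Fin.cases ?_ (fun i => ?_) i
        · simpa using hw1
        · simpa using hT1 i
      · refine Fin.cases ?_ (fun i => ?_) i <;> refine Fin.cases ?_ (fun j => ?_) j <;> intro hij
        · exact absurd rfl hij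
        · simpa using hw2 j
        · simpa using (hw2 i).symm
        · simpa using hT2 i j (by simpa using hij)
    · intro w _ w' _ hww
      have := congrFun hww 0
      simpa using this
  have h2 : #(cliqueTuples G X) = ∑ T ∈ cliqueTuples G (fun i : Fin q => X i.succ),
      #{U ∈ cliqueTuples G X | Fin.tail U = T} := by
    refine card_eq_sum_card_fiberwise fun U hU => ?_
    obtain ⟨hU1, hU2⟩ := mem_cliqueTuples.1 hU
    exact mem_cliqueTuples.2 ⟨fun i => hU1 _, fun i j hij => hU2 _ _ (by simpa using hij)⟩
  rw [h2, ← nsmul_eq_mul]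
  push_cast
  exact card_nsmul_le_sum _ _ _ fun T hT => (h T hT).trans (by exact_mod_cast h1 T hT)

open Classical in
/-- Vertices with at most `δ` non-neighbours in `Y` each have many common neighbours in `Y`. -/
theorem card_common_adj (G : SimpleGraph V) {q : ℕ} (Y : Finset V) (T : Fin q → V) (δ : ℝ)
    (h : ∀ i, #{w ∈ Y | ¬ G.Adj w (T i)} ≤ δ) :
    (#Y : ℝ) - q * δ ≤ #{w ∈ Y | ∀ i, G.Adj w (T i)} := by
  have h1 : Y ⊆ {w ∈ Y | ∀ i, G.Adj w (T i)} ∪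
      (univ : Finset (Fin q)).biUnion fun i => {w ∈ Y | ¬ G.Adj w (T i)} := by
    intro w hw
    by_cases h : ∀ i, G.Adj w (T i)
    · simp [hw, h]
    · obtain ⟨i, hi⟩ := not_forall.1 h
      simp only [mem_union, mem_biUnion, mem_filter]
      exact Or.inr ⟨i, mem_univ _, hw, hi⟩
  have h2 := (card_le_card h1).trans (card_union_le _ _)
  have h3 : (#((univ : Finset (Fin q)).biUnion fun i => {w ∈ Y | ¬ G.Adj w (T i)}) : ℝ)
      ≤ q * δ := by
    have : (#((univ : Finset (Fin q)).biUnion fun i => {w ∈ Y | ¬ G.Adj w (T i)}) : ℝ) ≤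
        ∑ i : Fin q, (#{w ∈ Y | ¬ G.Adj w (T i)} : ℝ) := by exact_mod_cast card_biUnion_le
    refine this.trans ((sum_le_sum fun i _ => h i).trans ?_)
    simp
  have h4 : (#Y : ℝ) ≤ _ := Nat.cast_le.2 h2
  push_cast at h4
  linarith

open Classical in
/-- If every vertex of each class is adjacent to nearly all vertices of the other classes, then a
positive proportion of the tuples are cliques. -/
theorem prod_card_le_card_cliqueTuples (G : SimpleGraph V) (δ : ℝ) (hδ : 0 ≤ δ) :
    ∀ (q : ℕ) (X : Fin q → Finset V),
      (∀ i j, i ≠ j → ∀ x ∈ X i, (#{w ∈ X j | ¬ G.Adj w x} : ℝ) ≤ δ) →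
      (∀ i, 2 * q * δ ≤ #(X i)) → ∏ i, (#(X i) : ℝ) ≤ 2 ^ q * #(cliqueTuples G X) := by
  intro q
  induction q with
  | zero =>
    intro X _ _
    have : Fin.elim0 ∈ cliqueTuples G X :=
      mem_cliqueTuples.2 ⟨fun i => i.elim0, fun i => i.elim0⟩
    have : 1 ≤ #(cliqueTuples G X) := card_pos.2 ⟨_, this⟩
    simpa using this
  | succ q ih =>
    intro X h1 h2
    have ih' := ih (fun i => X i.succ)
      (fun i j hij => h1 _ _ (by simpa using hij))
      (fun i => by
        refine le_trans ?_ (h2 i.succ)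
        push_cast
        nlinarith)
    have h3 := card_cliqueTuples_succ G X (#(X 0) / 2) (fun T hT => by
      have hT := (mem_cliqueTuples.1 hT).1
      have := card_common_adj G (X 0) T δ fun i =>
        h1 i.succ 0 (Fin.succ_ne_zero i) _ (hT i)
      have h20 := h2 0
      push_cast at h20
      linarith)
    rw [Fin.prod_univ_succ, pow_succ]
    calc (#(X 0) : ℝ) * ∏ i : Fin q, (#(X i.succ) : ℝ)
        ≤ #(X 0) * (2 ^ q * #(cliqueTuples G fun i : Fin q => X i.succ)) :=
          mul_le_mul_of_nonneg_left ih' (Nat.cast_nonneg _)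
      _ = 2 ^ q * 2 * (#(cliqueTuples G fun i : Fin q => X i.succ) * (#(X 0) / 2)) := by ring
      _ ≤ 2 ^ q * 2 * #(cliqueTuples G X) := mul_le_mul_of_nonneg_left h3 (by positivity)

open Classical in
/-- The number of vertices of `S` with another colour than `x` which are not adjacent to `x`. -/
noncomputable def missing (G : SimpleGraph V) {r : ℕ} (χ : V → Fin r) (S : Finset V) (x : V) : ℕ :=
  #{y ∈ S | χ x ≠ χ y ∧ ¬ G.Adj x y}

/-- There are no joints, that is, no edges in many cliques: whenever `u v` is an edge and `X i` are
sets of at least `N` vertices which, except for `i = 0`, consist of common neighbours of `u` and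
`v`, less than a `(2 r + 1) / H` fraction of the tuples in `∏ X i` are cliques. The set `X 0` is
arbitrary because `u` and `v` are to become vertices of the first class of a copy of `K_r^+`. -/
def JointFree (G : SimpleGraph V) (r H N : ℕ) : Prop :=
  ∀ u v, G.Adj u v → ∀ X : Fin r → Finset V, (∀ i, N ≤ #(X i)) →
    (∀ i : Fin r, (i : ℕ) ≠ 0 → ∀ x ∈ X i, G.Adj u x ∧ G.Adj v x) →
    H * #(cliqueTuples G X) < (2 * r + 1) * ∏ i, #(X i)

theorem jointFree_of_not_isContained {G : SimpleGraph V} {r a b H B N : ℕ}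
    (hr : 2 ≤ r) (ha : 0 < a) (hH : 0 < H) (hB : a * H ^ r ≤ B) (hN : B * (H * 2 ^ B) ≤ N)
    (hbN : b * (H * 2 ^ (H * a)) ≤ N)
    (hG : ¬ (completePlus (lastSize r a b)).IsContained G) : JointFree G r H N := by
  intro u v huv X hX huvX
  by_contra! hcard
  exact hG (completePlus_isContained_of_cliqueTuples G hr ha hH hB hN hbN huv X hX huvX hcard)

open Classical in
/-- Let `S` be nearly complete `r`-partite with the colours `χ` as classes. In a graph without
joints, an edge cannot have many common neighbours in all colours but one. -/
theorem JointFree.false_of_missing {G : SimpleGraph V} {r H N : ℕ} (hG : JointFree G r H N)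
    (hr : 2 ≤ r) (hN0 : 0 < N) (hHr : (2 * r + 1) * 2 ^ r ≤ H)
    (χ : V → Fin r) (S : Finset V) (z : ℝ) (hz : 2 * (N : ℝ) ≤ z)
    (hmiss : 8 * r * (∑ x ∈ S, (missing G χ S x : ℝ)) ≤ z ^ 2)
    {u v : V} (huv : G.Adj u v) (s₀ : Fin r) (hs₀ : z ≤ #{x ∈ S | χ x = s₀})
    (hs : ∀ s ≠ s₀, z ≤ #{x ∈ S | χ x = s ∧ G.Adj u x ∧ G.Adj v x}) : False := by
  have hz0 : 0 < z := by have : (0 : ℝ) < N := by exact_mod_cast hN0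
                         linarith
  have hr0 : (0 : ℝ) < r := by exact_mod_cast (by omega : 0 < r)
  set δ := z / (4 * r) with hδ
  have hδ0 : 0 < δ := by positivity
  -- the vertices with many missing edges are left out
  set S' : Finset V := {x ∈ S | (missing G χ S x : ℝ) ≤ δ} with hS'
  have hbad : (#(S \ S') : ℝ) ≤ z / 2 := by
    have h1 : #(S \ S') * δ ≤ ∑ x ∈ S, (missing G χ S x : ℝ) := by
      rw [← nsmul_eq_mul]
      refine (card_nsmul_le_sum _ _ _ fun x hx => ?_).trans
        (sum_le_sum_of_subset_of_nonneg sdiff_subset fun _ _ _ => Nat.cast_nonneg _)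
      have : x ∈ S ∧ (x ∈ S → δ < missing G χ S x) := by simpa [hS'] using hx
      exact (this.2 this.1).le
    have h2 : 8 * r * (#(S \ S') * δ) ≤ z ^ 2 :=
      (mul_le_mul_of_nonneg_left h1 (by positivity)).trans hmiss
    have h3 : 8 * r * (#(S \ S') * δ) = 2 * #(S \ S') * z := by
      rw [hδ]; field_simp; ring
    rw [h3] at h2
    have : 2 * (#(S \ S') : ℝ) ≤ z := le_of_mul_le_mul_right (by linarith [sq z]) hz0
    linarith
  -- the exceptional colour `s₀` is moved to the first place
  let e : Equiv.Perm (Fin r) := Equiv.swap ⟨0, by omega⟩ s₀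
  let Y : Fin r → Finset V := fun i => {x ∈ S | χ x = e i ∧ (e i ≠ s₀ → G.Adj u x ∧ G.Adj v x)}
  have hY : ∀ i, z ≤ #(Y i) := by
    intro i
    by_cases hi : e i = s₀
    · simpa [Y, hi] using hs₀
    · simpa [Y, hi] using hs _ hi
  let X : Fin r → Finset V := fun i => Y i ∩ S'
  have hX : ∀ i, z / 2 ≤ #(X i) := by
    intro i
    have : #(Y i) ≤ #(X i) + #(S \ S') := by
      refine (card_le_card (t := X i ∪ (S \ S')) ?_).trans (card_union_le _ _)
      intro x hx
      have hxS := (mem_filter.1 hx).1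
      by_cases hx' : x ∈ S'
      · simp [X, hx, hx']
      · simp [hxS, hx']
    have : (#(Y i) : ℝ) ≤ #(X i) + #(S \ S') := by exact_mod_cast this
    linarith [hY i]
  have hXN : ∀ i, N ≤ #(X i) := fun i => by
    have : (N : ℝ) ≤ #(X i) := by linarith [hX i]
    exact_mod_cast this
  have hXmem : ∀ i, ∀ x ∈ X i, x ∈ S ∧ χ x = e i ∧ (e i ≠ s₀ → G.Adj u x ∧ G.Adj v x) ∧
      (missing G χ S x : ℝ) ≤ δ := by
    intro i x hx
    have h1 := mem_inter.1 hx
    have h2 := mem_filter.1 h1.1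
    exact ⟨h2.1, h2.2.1, h2.2.2, (mem_filter.1 h1.2).2⟩
  refine (hG u v huv X hXN ?_).not_ge ?_
  · intro i hi x hx
    refine (hXmem i x hx).2.2.1 fun h => hi ?_
    have : e i = e ⟨0, by omega⟩ := by rw [h]; simp [e]
    have := e.injective this
    simp [this]
  · have h1 := prod_card_le_card_cliqueTuples G δ hδ0.le r X (fun i j hij x hx => by
        obtain ⟨-, hx1, -, hx2⟩ := hXmem i x hx
        refine le_trans ?_ hx2
        have : #{w ∈ X j | ¬ G.Adj w x} ≤ missing G χ S x := by
          refine card_le_card fun w hw => ?_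
          obtain ⟨hw1, hw2⟩ := mem_filter.1 hw
          obtain ⟨hw3, hw4, -⟩ := hXmem j w hw1
          refine mem_filter.2 ⟨hw3, ?_, fun h => hw2 h.symm⟩
          rw [hx1, hw4]
          exact fun h => hij (e.injective h)
        exact_mod_cast this) (fun i => by
        refine le_trans (le_of_eq ?_) (hX i)
        rw [hδ]; field_simp; norm_num)
    have h2 : ∏ i, #(X i) ≤ 2 ^ r * #(cliqueTuples G X) := by exact_mod_cast h1
    calc (2 * r + 1) * ∏ i, #(X i) ≤ (2 * r + 1) * (2 ^ r * #(cliqueTuples G X)) :=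
          Nat.mul_le_mul_left _ h2
      _ = ((2 * r + 1) * 2 ^ r) * #(cliqueTuples G X) := by ring
      _ ≤ H * #(cliqueTuples G X) := Nat.mul_le_mul_right _ hHr

end Cliques

/-! ### Dense graphs: minimum degree and common neighbourhoods -/

section Coloring

open Finset

variable {V : Type*}

open Classical in
/-- The number of neighbours of `u` in `S`. -/
noncomputable def degIn (G : SimpleGraph V) (S : Finset V) (u : V) : ℕ := #{w ∈ S | G.Adj u w}

open Classical in
theorem sum_degIn_insert (G : SimpleGraph V) {S : Finset V} {u : V} (hu : u ∉ S) :
    ∑ x ∈ insert u S, degIn G (insert u S) x = 2 * degIn G S u + ∑ x ∈ S, degIn G S x := by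
  have h : ∀ x, degIn G (insert u S) x = (if G.Adj x u then 1 else 0) + degIn G S x := by
    intro x
    simp only [degIn, card_filter, sum_insert hu]
  rw [sum_insert hu, h]
  simp only [h, sum_add_distrib, SimpleGraph.irrefl, if_false]
  have : ∑ x ∈ S, (if G.Adj x u then 1 else 0) = degIn G S u := by
    simp only [degIn, card_filter, G.adj_comm]
  rw [this]
  ring

/-- There is a set `S` of large minimum degree with at least as large a value of `2 e(S) - c |S|²` as
the whole graph: a set maximising this value, since removing a vertex does not increase it. -/
theorem exists_large_minDegree [Fintype V] (G : SimpleGraph V) (c : ℝ) (hc : c ≤ 1) :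
    ∃ S : Finset V, (∀ u ∈ S, c * #S - 1 / 2 ≤ degIn G S u) ∧
      ∑ x, (degIn G univ x : ℝ) - c * (Fintype.card V : ℝ) ^ 2 ≤
        ∑ x ∈ S, (degIn G S x : ℝ) - c * (#S : ℝ) ^ 2 := by
  classical
  obtain ⟨S, -, hS⟩ := exists_max_image (univ : Finset (Finset V))
    (fun S => ∑ x ∈ S, (degIn G S x : ℝ) - c * (#S : ℝ) ^ 2) univ_nonempty
  refine ⟨S, fun u hu => ?_, by simpa using hS univ (mem_univ _)⟩
  have h1 := hS (S.erase u) (mem_univ _)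
  have h2 := sum_degIn_insert G (notMem_erase u S)
  rw [insert_erase hu] at h2
  have h3 : #S = #(S.erase u) + 1 := (card_erase_add_one hu).symm
  have h4 : degIn G (S.erase u) u = degIn G S u := by
    unfold degIn
    congr 1
    ext w
    simp only [mem_filter, mem_erase]
    exact ⟨fun h => ⟨h.1.2, h.2⟩, fun h => ⟨⟨h.2.ne', h.1⟩, h.2⟩⟩
  rw [h4] at h2
  have h5 : ∑ x ∈ S, (degIn G S x : ℝ) =
      2 * degIn G S u + ∑ x ∈ S.erase u, (degIn G (S.erase u) x : ℝ) := by exact_mod_cast h2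
  have h6 : (#S : ℝ) = #(S.erase u) + 1 := by exact_mod_cast h3
  rw [h5, h6] at h1
  rw [h6]
  nlinarith

open Classical in
theorem card_not_adj_le (G : SimpleGraph V) {S Y : Finset V} (hY : Y ⊆ S) {x : V} {d : ℝ}
    (hx : d ≤ degIn G S x) : (#{w ∈ Y | ¬ G.Adj w x} : ℝ) ≤ #S - d := by
  have h1 : #{w ∈ Y | ¬ G.Adj w x} ≤ #{w ∈ S | ¬ G.Adj x w} := by
    refine card_le_card fun w hw => ?_
    rw [mem_filter] at hw ⊢
    exact ⟨hY hw.1, fun h => hw.2 h.symm⟩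
  have h2 : degIn G S x + #{w ∈ S | ¬ G.Adj x w} = #S := card_filter_add_card_filter_not _
  have h3 : (degIn G S x : ℝ) + #{w ∈ S | ¬ G.Adj x w} = #S := by exact_mod_cast h2
  have h4 : (#{w ∈ Y | ¬ G.Adj w x} : ℝ) ≤ #{w ∈ S | ¬ G.Adj x w} := by exact_mod_cast h1
  linarith

open Classical in
/-- In a graph of large minimum degree, a clique with `r + 1` vertices contains an edge which has
more common neighbours than an edge of the `r`-partite Turán graph, where the proportion is
`1 - 2 / r`. -/
theorem exists_codegree (G : SimpleGraph V) {r : ℕ} (hr : 2 ≤ r) (S R : Finset V) (hRS : R ⊆ S)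
    (hR : G.IsNClique (r + 1) R) (η : ℝ) (hη : 0 ≤ η)
    (hdeg : ∀ u ∈ S, (1 - 1 / r - η) * #S ≤ degIn G S u) :
    ∃ u ∈ R, ∃ v ∈ R, u ≠ v ∧
      (1 - 2 / r + 1 / r ^ 3 - 2 * η) * #S ≤ #{w ∈ S | G.Adj u w ∧ G.Adj v w} := by
  by_contra! hcon
  set y : ℝ := (1 - 2 / r + 1 / r ^ 3 - 2 * η) * #S
  have hRcard : #R = r + 1 := hR.card_eq
  have hRne : R.Nonempty := card_pos.1 (by omega)
  have hN : (0 : ℝ) < #S := by exact_mod_cast card_pos.2 (hRne.mono hRS)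
  have hr0 : (2 : ℝ) ≤ r := by exact_mod_cast hr
  let A : V → V → ℝ := fun u w => if G.Adj u w then 1 else 0
  let f : V → ℝ := fun w => ∑ u ∈ R, A u w
  have hdegA : ∀ u, (degIn G S u : ℝ) = ∑ w ∈ S, A u w := fun u => by simp [degIn, A]
  have hcod : ∀ u v, (#{w ∈ S | G.Adj u w ∧ G.Adj v w} : ℝ) = ∑ w ∈ S, A u w * A v w := by
    intro u v
    simp only [A, card_filter, ite_and]
    push_cast
    refine sum_congr rfl fun w _ => ?_
    split_ifs <;> simp
  have hD : ∑ u ∈ R, (degIn G S u : ℝ) = ∑ w ∈ S, f w := by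
    simp only [hdegA, f]
    exact sum_comm
  have hf2 : ∑ u ∈ R, ∑ v ∈ R, (#{w ∈ S | G.Adj u w ∧ G.Adj v w} : ℝ) = ∑ w ∈ S, f w ^ 2 := by
    simp only [hcod, f, sq, sum_mul_sum]
    rw [sum_comm (s := S)]
    exact sum_congr rfl fun u _ => sum_comm
  -- the clique sends `f w` edges to `w`; as `(f w - r) * (f w - r + 1) ≥ 0`, the sum of the squares of
  -- these numbers is large, and it counts the common neighbours of pairs of vertices of the clique:
  -- `f w` is an integer, so that it does not lie strictly between `r - 1` and `r`
  have hfint : ∀ w, (2 * r - 1) * f w - r * (r - 1) ≤ f w ^ 2 := by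
    intro w
    have : f w = (#{u ∈ R | G.Adj u w} : ℝ) := by simp [f, A]
    rw [this]
    set d := #{u ∈ R | G.Adj u w}
    rcases le_or_gt r d with h | h
    · have : (r : ℝ) ≤ d := by exact_mod_cast h
      nlinarith
    · have : (d : ℝ) + 1 ≤ r := by exact_mod_cast h
      nlinarith
  have h1 : (2 * r - 1) * ∑ w ∈ S, f w - r * (r - 1) * #S ≤ ∑ w ∈ S, f w ^ 2 := by
    have := sum_le_sum fun w (_ : w ∈ S) => hfint w
    rw [sum_sub_distrib, ← mul_sum, sum_const, nsmul_eq_mul] at this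
    linarith
  have h2 : ∑ u ∈ R, ∑ v ∈ R, (#{w ∈ S | G.Adj u w ∧ G.Adj v w} : ℝ) ≤
      ∑ u ∈ R, (degIn G S u : ℝ) + (r + 1) * r * y := by
    have : ∀ u ∈ R, ∑ v ∈ R, (#{w ∈ S | G.Adj u w ∧ G.Adj v w} : ℝ) ≤ degIn G S u + r * y := by
      intro u hu
      rw [← add_sum_erase _ _ hu]
      have h1 : (#{w ∈ S | G.Adj u w ∧ G.Adj u w} : ℝ) = degIn G S u := by simp [degIn]
      rw [h1]
      have h2 : ∑ v ∈ R.erase u, (#{w ∈ S | G.Adj u w ∧ G.Adj v w} : ℝ) ≤ #(R.erase u) • y :=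
        sum_le_card_nsmul _ _ _ fun v hv =>
          (hcon u hu v (mem_of_mem_erase hv) (ne_of_mem_erase hv).symm).le
      rw [card_erase_of_mem hu, hRcard, nsmul_eq_mul] at h2
      simpa using h2
    refine (sum_le_sum this).trans (le_of_eq ?_)
    rw [sum_add_distrib, sum_const, hRcard, nsmul_eq_mul]
    push_cast
    ring
  have h3 : (r + 1) * ((1 - 1 / r - η) * #S) ≤ ∑ u ∈ R, (degIn G S u : ℝ) := by
    have := card_nsmul_le_sum R (fun u => (degIn G S u : ℝ)) _ fun u hu => hdeg u (hRS hu)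
    rw [hRcard, nsmul_eq_mul] at this
    exact_mod_cast this
  have h4 : (2 * r - 2) * (r + 1) * (1 - 1 / r - η) - r * (r - 1)
      - r * (r + 1) * (1 - 2 / r + 1 / r ^ 3 - 2 * η) = (r - 1) / (r : ℝ) ^ 2 + (2 * r + 2) * η := by
    field_simp
    ring
  have h5 : 0 < (r - 1) / (r : ℝ) ^ 2 + (2 * r + 2) * η := by
    have : 0 < (r - 1) / (r : ℝ) ^ 2 := div_pos (by linarith) (by positivity)
    positivity
  have h6 : 0 < ((2 * r - 2) * (r + 1) * (1 - 1 / r - η) - r * (r - 1)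
      - r * (r + 1) * (1 - 2 / r + 1 / r ^ 3 - 2 * η)) * #S := by
    rw [h4]
    exact mul_pos h5 hN
  have h7 := mul_le_mul_of_nonneg_left h3 (by linarith : (0 : ℝ) ≤ 2 * r - 2)
  have h8 : r * (r + 1) * y = r * (r + 1) * (1 - 2 / r + 1 / r ^ 3 - 2 * η) * #S := by
    simp only [y]
    ring
  nlinarith

open Classical in
/-- In a graph without joints, a set of large minimum degree contains no clique with `r + 1`
vertices: the common neighbourhood of one of its edges is so large that cliques in it can be built
greedily. -/
theorem JointFree.not_isNClique {G : SimpleGraph V} {r H N : ℕ} (hG : JointFree G r H N)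
    (hr : 2 ≤ r) (hHr : 4 * (2 * r + 1) * r ^ (r + 2) ≤ H) (S : Finset V) (η : ℝ) (hη : 0 ≤ η)
    (hηr : 8 * (r : ℝ) ^ 4 * η ≤ 1) (hN : 2 * r ^ 3 * N ≤ #S) (hS : S.Nonempty)
    (hdeg : ∀ u ∈ S, (1 - 1 / r - η) * #S ≤ degIn G S u) (R : Finset V) (hRS : R ⊆ S) :
    ¬ G.IsNClique (r + 1) R := by
  intro hR
  obtain ⟨u, hu, v, hv, huv, hcod⟩ := exists_codegree G hr S R hRS hR η hη hdeg
  have hadj : G.Adj u v := hR.isClique hu hv huv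
  obtain ⟨t, rfl⟩ : ∃ t, r = t + 2 := ⟨r - 2, by omega⟩
  set r : ℕ := t + 2 with hrt
  have hr0 : (2 : ℝ) ≤ r := by exact_mod_cast hr
  have htr : (t : ℝ) = r - 2 := by rw [hrt]; push_cast; ring
  set n : ℝ := (#S : ℝ) with hn
  have hn0 : 0 < n := by rw [hn]; exact_mod_cast card_pos.2 hS
  -- `μ` bounds the number of non-neighbours of a vertex of `S`
  set μ : ℝ := (1 / r + η) * n with hμ
  have hη3 : r * η ≤ 1 / (8 * r ^ 3) := by
    rw [le_div_iff₀ (by positivity)]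
    nlinarith
  set Y : Finset V := {w ∈ S | G.Adj u w ∧ G.Adj v w} with hY
  have hYS : Y ⊆ S := filter_subset _ _
  have hμY : ∀ Z ⊆ S, ∀ x ∈ S, (#{w ∈ Z | ¬ G.Adj w x} : ℝ) ≤ μ := by
    intro Z hZ x hx
    refine (card_not_adj_le G hZ (hdeg x hx)).trans (le_of_eq ?_)
    rw [hμ]
    ring
  -- cliques are built greedily, each new vertex avoiding at most `μ` vertices for each old one
  have hstep : ∀ (q : ℕ) (X : Fin (q + 1) → Finset V), (∀ i, X i ⊆ S) → ∀ c : ℝ,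
      c ≤ #(X 0) - q * μ →
      #(cliqueTuples G fun i : Fin q => X i.succ) * c ≤ #(cliqueTuples G X) := by
    intro q X hX c hc
    refine card_cliqueTuples_succ G X c fun T hT => hc.trans ?_
    exact card_common_adj G _ T μ fun i =>
      hμY _ (hX 0) _ (hX i.succ ((mem_cliqueTuples.1 hT).1 i))
  have hsmall : ∀ q ≤ t, (n / r) ^ q ≤ #(cliqueTuples G fun _ : Fin q => Y) := by
    intro q
    induction q with
    | zero =>
      intro _
      have : Fin.elim0 ∈ cliqueTuples G fun _ : Fin 0 => Y :=
        mem_cliqueTuples.2 ⟨fun i => i.elim0, fun i => i.elim0⟩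
      have : 1 ≤ #(cliqueTuples G fun _ : Fin 0 => Y) := card_pos.2 ⟨_, this⟩
      simpa using this
    | succ q ih =>
      intro hq
      have hq' : (q : ℝ) + 3 ≤ r := by
        have : q + 3 ≤ r := by omega
        exact_mod_cast this
      refine le_trans ?_ (hstep q (fun _ => Y) (fun _ => hYS) (n / r) ?_)
      · rw [pow_succ]
        exact mul_le_mul_of_nonneg_right (ih (by omega)) (by positivity)
      · have h1 : n / r ≤ (1 - 2 / r + 1 / r ^ 3 - 2 * η) * n - q * μ := by
          have h2 : (q : ℝ) * μ ≤ (r - 3) * μ :=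
            mul_le_mul_of_nonneg_right (by linarith) (by positivity)
          have h3 : (1 - 2 / r + 1 / r ^ 3 - 2 * η) * n - (r - 3) * μ - n / r =
              (1 / (r : ℝ) ^ 3 - (r * η) + η) * n := by
            rw [hμ]
            field_simp
            ring
          have h4 : 1 / (8 * (r : ℝ) ^ 3) ≤ 1 / (r : ℝ) ^ 3 :=
            one_div_le_one_div_of_le (by positivity) (by nlinarith [pow_pos (by linarith : (0 : ℝ) < r) 3])
          have h5 : 0 ≤ (1 / (r : ℝ) ^ 3 - (r * η) + η) * n := by
            have : 0 ≤ 1 / (r : ℝ) ^ 3 - (r * η) + η := by linarith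
            positivity
          linarith
        linarith
  have h8 : 1 / (2 * (r : ℝ) ^ 3) ≤ 1 / (r : ℝ) ^ 3 - r * η := by
    have h1 : 1 / (8 * (r : ℝ) ^ 3) = 1 / (r : ℝ) ^ 3 / 8 := by field_simp
    have h2 : 1 / (2 * (r : ℝ) ^ 3) = 1 / (r : ℝ) ^ 3 / 2 := by field_simp
    have h3 : 0 < 1 / (r : ℝ) ^ 3 := by positivity
    linarith
  have hYlast : n / (2 * r ^ 3) ≤ #Y - t * μ := by
    have h3 : (1 - 2 / r + 1 / r ^ 3 - 2 * η) * n - t * μ = (1 / (r : ℝ) ^ 3 - r * η) * n := by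
      rw [hμ, htr]
      field_simp
      ring
    have h4 : n / (2 * r ^ 3) = 1 / (2 * (r : ℝ) ^ 3) * n := by ring
    have := mul_le_mul_of_nonneg_right h8 hn0.le
    linarith
  have hSlast : n / (2 * r) ≤ #S - (t + 1 : ℕ) * μ := by
    have h3 : n - (t + 1 : ℕ) * μ = (1 / r - (r * η - η)) * n := by
      rw [hμ]
      push_cast
      rw [htr]
      field_simp
      ring
    have h4 : n / (2 * r) = 1 / (2 * (r : ℝ)) * n := by ring
    have h5 : 1 / (2 * (r : ℝ)) ≤ 1 / r - (r * η - η) := by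
      have h6 : 1 / (8 * (r : ℝ) ^ 3) ≤ 1 / (2 * (r : ℝ)) := by
        refine one_div_le_one_div_of_le (by positivity) ?_
        have : (r : ℝ) ^ 3 = r * r ^ 2 := by ring
        nlinarith
      have h7 : 1 / (r : ℝ) = 1 / (2 * (r : ℝ)) + 1 / (2 * (r : ℝ)) := by field_simp; norm_num
      linarith
    have := mul_le_mul_of_nonneg_right h5 hn0.le
    rw [← hn]
    linarith
  -- the first entry of the cliques is an arbitrary vertex of `S`, the others lie in `Y`
  let X : Fin (t + 2) → Finset V := Fin.cons S fun _ => Y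
  have hXS : ∀ i, X i ⊆ S := by
    intro i
    refine Fin.cases ?_ (fun i => ?_) i
    · simp [X]
    · simpa [X] using hYS
  have hcount : (n / r) ^ t * (n / (2 * r ^ 3)) * (n / (2 * r)) ≤ #(cliqueTuples G X) := by
    have h1 := hstep t (fun _ => Y) (fun _ => hYS) _ hYlast
    have h2 := hstep (t + 1) X hXS (n / (2 * r)) (by simpa [X] using hSlast)
    have h3 : (fun i : Fin (t + 1) => X i.succ) = fun _ => Y := by
      funext i
      simp [X]
    rw [h3] at h2
    refine le_trans (mul_le_mul_of_nonneg_right ?_ (by positivity)) h2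
    exact le_trans (mul_le_mul_of_nonneg_right (hsmall t le_rfl) (by positivity)) h1
  have hYN : N ≤ #Y := by
    have h1 : 2 * (r : ℝ) ^ 3 * N ≤ n := by rw [hn]; exact_mod_cast hN
    have h2 : (N : ℝ) ≤ n / (2 * r ^ 3) := by
      rw [le_div_iff₀ (by positivity)]
      linarith
    have h3 : 0 ≤ (t : ℝ) * μ := by positivity
    have h4 : (N : ℝ) ≤ #Y := by linarith
    exact_mod_cast h4
  refine (hG u v hadj X ?_ ?_).not_ge ?_
  · intro i
    refine Fin.cases ?_ (fun i => ?_) i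
    · simpa [X] using hYN.trans (card_le_card hYS)
    · simpa [X] using hYN
  · intro i
    refine Fin.cases ?_ (fun i => ?_) i
    · intro h
      exact absurd rfl h
    · intro _ x hx
      have : x ∈ Y := by simpa [X] using hx
      exact (mem_filter.1 this).2
  · have h1 : ∏ i, (#(X i) : ℝ) ≤ n ^ r := by
      refine (prod_le_prod (g := fun _ => n) (fun _ _ => Nat.cast_nonneg _) fun i _ => ?_).trans
        (by simp [hrt])
      rw [hn]
      exact_mod_cast card_le_card (hXS i)
    have h2 : (2 * r + 1) * n ^ r ≤ H * ((n / r) ^ t * (n / (2 * r ^ 3)) * (n / (2 * r))) := by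
      have h3 : (4 * (2 * r + 1) * r ^ (r + 2) : ℝ) ≤ H := by exact_mod_cast hHr
      have h4 : (n / r) ^ t * (n / (2 * r ^ 3)) * (n / (2 * r)) =
          n ^ r / (4 * (r : ℝ) ^ (r + 2)) := by
        have h5 : n ^ r = n ^ t * n ^ 2 := pow_add n t 2
        have h6 : (r : ℝ) ^ (r + 2) = (r : ℝ) ^ t * (r : ℝ) ^ 4 := pow_add (r : ℝ) t 4
        rw [h5, h6, div_pow]
        field_simp
        norm_num
      rw [h4, ← mul_div_assoc, le_div_iff₀ (by positivity)]
      have := mul_le_mul_of_nonneg_right h3 (by positivity : (0 : ℝ) ≤ n ^ r)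
      linarith
    have h5 : (2 * r + 1) * ∏ i, (#(X i) : ℝ) ≤ H * #(cliqueTuples G X) :=
      (mul_le_mul_of_nonneg_left h1 (by positivity)).trans
        (h2.trans (mul_le_mul_of_nonneg_left hcount (by positivity)))
    exact_mod_cast h5

end Coloring

/-! ### Colouring a dense joint-free graph -/

section Coloring

open Finset

variable {V : Type*}

/-- The ends of an edge which are adjacent to all vertices but one of a clique of size `r` form a
clique of size `r + 1` with them. -/
theorem exists_isNClique_of_edge {G : SimpleGraph V} {r : ℕ} {S : Finset V} {T : Fin r → V}
    (hTS : ∀ i, T i ∈ S) (hT : ∀ i j, i ≠ j → G.Adj (T i) (T j)) {u v : V} (hu : u ∈ S)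
    (hv : v ∈ S) (huv : G.Adj u v) (s₀ : Fin r)
    (h : ∀ s ≠ s₀, G.Adj u (T s) ∧ G.Adj v (T s)) : ∃ R ⊆ S, G.IsNClique (r + 1) R := by
  classical
  have hTinj : Function.Injective T := fun i j hij => by
    by_contra hne
    exact (hT i j hne).ne hij
  have hr : 0 < r := s₀.pos
  have h1 : G.IsNClique (r - 1) ((univ.erase s₀).image T) := by
    constructor
    · intro x hx y hy hxy
      simp only [coe_image, Set.mem_image, mem_coe, mem_erase] at hx hy
      obtain ⟨i, -, rfl⟩ := hx
      obtain ⟨j, -, rfl⟩ := hy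
      exact hT i j fun h => hxy (by rw [h])
    · rw [card_image_of_injective _ hTinj, card_erase_of_mem (mem_univ _), card_univ,
        Fintype.card_fin]
  have h2 : G.IsNClique (r - 1 + 1) (insert v ((univ.erase s₀).image T)) :=
    h1.insert fun b hb => by
      obtain ⟨s, hs, rfl⟩ := mem_image.1 hb
      exact (h s (ne_of_mem_erase hs)).2
  have h3 : G.IsNClique (r - 1 + 1 + 1) (insert u (insert v ((univ.erase s₀).image T))) :=
    h2.insert fun b hb => by
      rcases mem_insert.1 hb with rfl | hb
      · exact huv
      · obtain ⟨s, hs, rfl⟩ := mem_image.1 hb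
        exact (h s (ne_of_mem_erase hs)).1
  refine ⟨_, ?_, by rwa [Nat.sub_add_cancel hr] at h3⟩
  intro x hx
  simp only [mem_insert, mem_image] at hx
  rcases hx with rfl | rfl | ⟨i, -, rfl⟩
  exacts [hu, hv, hTS i]

open Classical in
/-- If the sets `C i` are pairwise nearly completely joined, then the ends of an edge which have many
common neighbours in all of them but one lie in a clique of size `r + 1`. -/
theorem exists_isNClique_of_common {G : SimpleGraph V} {r : ℕ} {S : Finset V}
    (C : Fin r → Finset V) (hCS : ∀ i, C i ⊆ S) {δ : ℝ} (hδ : 0 ≤ δ)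
    (hC : ∀ i j, i ≠ j → ∀ x ∈ C i, (#{w ∈ C j | ¬ G.Adj w x} : ℝ) ≤ δ) {u v : V} (hu : u ∈ S)
    (hv : v ∈ S) (huv : G.Adj u v) (s₀ : Fin r) {z : ℝ} (hz : 2 * r * δ ≤ z) (hz0 : 0 < z)
    (hs₀ : z ≤ #(C s₀))
    (hs : ∀ s ≠ s₀, z ≤ #{w ∈ C s | G.Adj u w ∧ G.Adj v w}) :
    ∃ R ⊆ S, G.IsNClique (r + 1) R := by
  let X : Fin r → Finset V := fun s => {w ∈ C s | s ≠ s₀ → G.Adj u w ∧ G.Adj v w}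
  have hXC : ∀ s, X s ⊆ C s := fun s => filter_subset _ _
  have hX : ∀ s, z ≤ #(X s) := by
    intro s
    by_cases h : s = s₀
    · simpa [X, h] using hs₀
    · simpa [X, h] using hs s h
  have h1 := prod_card_le_card_cliqueTuples G δ hδ r X (fun i j hij x hx => by
    refine le_trans ?_ (hC i j hij x (hXC i hx))
    exact_mod_cast card_le_card (filter_subset_filter _ (hXC j))) fun i => hz.trans (hX i)
  have h2 : 0 < ∏ i, (#(X i) : ℝ) := prod_pos fun i _ => hz0.trans_le (hX i)
  have h3 : 0 < #(cliqueTuples G X) := by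
    refine Nat.pos_of_ne_zero fun h => ?_
    rw [h] at h1
    simp only [Nat.cast_zero, mul_zero] at h1
    linarith
  obtain ⟨T, hT⟩ := card_pos.1 h3
  obtain ⟨hT1, hT2⟩ := mem_cliqueTuples.1 hT
  exact exists_isNClique_of_edge (fun i => hCS i (hXC i (hT1 i))) hT2 hu hv huv s₀ fun s hs =>
    (mem_filter.1 (hT1 s)).2 hs

open Classical in
/-- A weak form of the theorem of Andrásfai, Erdős and Sós: a graph of large minimum degree
without cliques of size `r + 1` is `r`-partite. The classes are read off from a clique of size `r`:
nearly every vertex is adjacent to all of its vertices but one. -/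
theorem exists_coloring_of_minDegree {G : SimpleGraph V} {r : ℕ} (hr : 2 ≤ r) (S : Finset V)
    (hS : S.Nonempty) (η : ℝ) (hη : 0 ≤ η) (hηr : 8 * (r : ℝ) ^ 4 * η ≤ 1)
    (hdeg : ∀ u ∈ S, (1 - 1 / r - η) * #S ≤ degIn G S u)
    (hfree : ∀ R ⊆ S, ¬ G.IsNClique (r + 1) R) :
    ∃ χ : V → Fin r, ∀ u ∈ S, ∀ v ∈ S, G.Adj u v → χ u ≠ χ v := by
  have hr0 : (2 : ℝ) ≤ r := by exact_mod_cast hr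
  set n : ℝ := (#S : ℝ) with hn
  have hn0 : 0 < n := by rw [hn]; exact_mod_cast card_pos.2 hS
  set p : ℝ := 1 / r with hp
  have hp0 : 0 < p := by positivity
  have hrp : r * p = 1 := by rw [hp]; field_simp
  have hp2 : p ≤ 1 / 2 := by nlinarith
  -- `μ` bounds the number of non-neighbours of a vertex of `S`
  set μ : ℝ := (p + η) * n with hμ
  -- the error term: up to multiples of `e * n` the classes have size `p * n`
  set e : ℝ := r * η with he
  have he0 : 0 ≤ e := by positivity
  have hre : r * e ≤ p / 16 := by
    have h1 : r * e * (8 * r ^ 2) ≤ 1 := by rw [he]; nlinarith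
    have h2 : p * (r * e * (8 * r ^ 2)) ≤ p := by nlinarith
    have h3 : p * (r * e * (8 * r ^ 2)) = (r * p) * (8 * (r * (r * e))) := by ring
    rw [h3, hrp] at h2
    have : 0 ≤ r * e := by positivity
    nlinarith
  have hep : e ≤ p / 32 := by nlinarith
  have hηe : 2 * η ≤ e := by rw [he]; nlinarith
  have hμY : ∀ Z ⊆ S, ∀ x ∈ S, (#{w ∈ Z | ¬ G.Adj w x} : ℝ) ≤ μ := by
    intro Z hZ x hx
    refine (card_not_adj_le G hZ (hdeg x hx)).trans (le_of_eq ?_)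
    rw [hμ]
    ring
  have hrμ : ∀ q : ℕ, (q : ℝ) + 1 ≤ r → (p - e) * n ≤ n - q * μ := by
    intro q hq
    have h1 : (q : ℝ) * μ ≤ (r - 1) * μ := mul_le_mul_of_nonneg_right (by linarith) (by positivity)
    have h2 : n - (r - 1) * μ = (1 - r * p + p - e + η) * n := by rw [hμ, he]; ring
    rw [hrp] at h2
    nlinarith
  -- a clique of size `r`
  have hclique : ∀ q ≤ r, 0 < #(cliqueTuples G fun _ : Fin q => S) := by
    intro q
    induction q with
    | zero =>
      intro _
      exact card_pos.2 ⟨Fin.elim0, mem_cliqueTuples.2 ⟨fun i => i.elim0, fun i => i.elim0⟩⟩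
    | succ q ih =>
      intro hq
      have h1 := card_cliqueTuples_succ G (fun _ : Fin (q + 1) => S) ((p - e) * n) fun T hT =>
        (hrμ q (by exact_mod_cast hq)).trans
          (card_common_adj G _ T μ fun i => hμY S subset_rfl _ ((mem_cliqueTuples.1 hT).1 i))
      have h2 : (0 : ℝ) < #(cliqueTuples G fun _ : Fin q => S) := by
        exact_mod_cast ih (by omega)
      have h3 : 0 < (p - e) * n := mul_pos (by linarith) hn0
      exact_mod_cast (mul_pos h2 h3).trans_le h1
  obtain ⟨T, hT⟩ := card_pos.1 (hclique r le_rfl)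
  obtain ⟨hTS, hTadj⟩ := mem_cliqueTuples.1 hT
  let C : Fin r → Finset V := fun s => {w ∈ S | ∀ j ≠ s, G.Adj w (T j)}
  have hCS : ∀ s, C s ⊆ S := fun s => filter_subset _ _
  have hCadj : ∀ s, ∀ w ∈ C s, ∀ j ≠ s, G.Adj w (T j) := fun s w hw => (mem_filter.1 hw).2
  have hCindep : ∀ s, ∀ u ∈ C s, ∀ v ∈ C s, ¬ G.Adj u v := by
    intro s u hu v hv huv
    obtain ⟨R, hR, hR'⟩ := exists_isNClique_of_edge hTS hTadj (hCS s hu) (hCS s hv) huv s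
      fun j hj => ⟨hCadj s u hu j hj, hCadj s v hv j hj⟩
    exact hfree R hR hR'
  have hCdisj : ∀ s s', s ≠ s' → Disjoint (C s) (C s') := by
    intro s s' hss
    rw [disjoint_left]
    intro w hw hw'
    obtain ⟨R, hR, hR'⟩ := exists_isNClique_of_edge hTS hTadj (hCS s hw) (hTS s)
      (hCadj s' w hw' s hss) s fun j hj => ⟨hCadj s w hw j hj, hTadj s j hj.symm⟩
    exact hfree R hR hR'
  have hCcard : ∀ s, (p - e) * n ≤ #(C s) := by
    intro s
    obtain ⟨q, hq⟩ : ∃ q, r = q + 1 := ⟨r - 1, by omega⟩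
    subst hq
    have h1 := card_common_adj G S (fun i : Fin q => T (s.succAbove i)) μ
      fun i => hμY S subset_rfl _ (hTS _)
    refine (hrμ q (by push_cast; rfl)).trans (h1.trans ?_)
    have : ({w ∈ S | ∀ i : Fin q, G.Adj w (T (s.succAbove i))} : Finset V) ⊆ C s := by
      intro w hw
      rw [mem_filter] at hw ⊢
      refine ⟨hw.1, fun j hj => ?_⟩
      obtain ⟨i, rfl⟩ := Fin.exists_succAbove_eq hj
      exact hw.2 i
    exact_mod_cast card_le_card this
  -- a vertex without neighbours in `C s` is adjacent to nearly all vertices of the other classes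
  have hmiss : ∀ s, ∀ x ∈ S, (∀ w ∈ C s, ¬ G.Adj x w) → ∀ s' ≠ s,
      (#{w ∈ C s' | ¬ G.Adj w x} : ℝ) ≤ 2 * e * n := by
    intro s x hx hxs s' hs'
    have h1 := hμY _ (union_subset (hCS s) (hCS s')) x hx
    have h2 : #(C s) + #{w ∈ C s' | ¬ G.Adj w x} ≤ #{w ∈ C s ∪ C s' | ¬ G.Adj w x} := by
      have : {w ∈ C s | ¬ G.Adj w x} = C s := filter_true_of_mem fun w hw h => hxs w hw h.symm
      rw [filter_union, card_union_of_disjoint (disjoint_filter_filter (hCdisj s s' hs'.symm)),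
        this]
    have h3 : (#(C s) : ℝ) + #{w ∈ C s' | ¬ G.Adj w x} ≤ #{w ∈ C s ∪ C s' | ¬ G.Adj w x} := by
      exact_mod_cast h2
    have h4 := hCcard s
    have h5 : μ - (p - e) * n = (η + e) * n := by rw [hμ]; ring
    nlinarith
  have hCC : ∀ i j, i ≠ j → ∀ x ∈ C i, (#{w ∈ C j | ¬ G.Adj w x} : ℝ) ≤ 2 * e * n :=
    fun i j hij x hx => hmiss i x (hCS i hx) (fun w hw => hCindep i x hx w hw) j hij.symm
  have hδ : 0 ≤ 2 * e * n := by positivity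
  set z : ℝ := p / 4 * n with hz
  have hz0 : 0 < z := by positivity
  have hzδ : 2 * r * (2 * e * n) ≤ z := by
    have h1 : 2 * r * (2 * e * n) = 4 * (r * e) * n := by ring
    rw [h1, hz]
    exact mul_le_mul_of_nonneg_right (by linarith) hn0.le
  have hCz : ∀ s, z ≤ #(C s) := fun s => le_trans (by rw [hz]; nlinarith) (hCcard s)
  -- a vertex `u` with neighbours in all classes lies in a clique of size `r + 1`, together with a
  -- neighbour `v` in the class `C s₀` where it has the fewest: having at most `μ` non-neighbours, it
  -- has many neighbours in each other class, nearly all of which are adjacent to `v`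
  have hexists : ∀ u ∈ S, ∃ s, ∀ w ∈ C s, ¬ G.Adj u w := by
    intro u hu
    by_contra! hcon
    obtain ⟨s₀, -, hs₀⟩ := exists_min_image (univ : Finset (Fin r)) (fun s => #{w ∈ C s | G.Adj u w})
      ⟨⟨0, by omega⟩, mem_univ _⟩
    obtain ⟨v, hv, huv⟩ := hcon s₀
    obtain ⟨R, hR, hR'⟩ := exists_isNClique_of_common C hCS hδ hCC hu (hCS _ hv) huv s₀ hzδ hz0
      (hCz _) (by
        intro s hs
        have h1 := hμY _ (union_subset (hCS s) (hCS s₀)) u hu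
        have h2 : #{w ∈ C s | ¬ G.Adj w u} + #{w ∈ C s₀ | ¬ G.Adj w u} ≤
            #{w ∈ C s ∪ C s₀ | ¬ G.Adj w u} := by
          rw [filter_union, card_union_of_disjoint (disjoint_filter_filter (hCdisj s s₀ hs))]
        have h3 : ∀ s, #{w ∈ C s | G.Adj u w} + #{w ∈ C s | ¬ G.Adj w u} = #(C s) := by
          intro s
          simp only [G.adj_comm u]
          exact card_filter_add_card_filter_not _
        have h4 := hs₀ s (mem_univ _)
        have h5 : #{w ∈ C s | G.Adj u w} ≤
            #{w ∈ C s | G.Adj u w ∧ G.Adj v w} + #{w ∈ C s | ¬ G.Adj w v} := by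
          refine (card_le_card ?_).trans (card_union_le _ _)
          intro w hw
          rw [mem_filter] at hw
          by_cases h : G.Adj v w
          · exact mem_union_left _ (mem_filter.2 ⟨hw.1, hw.2, h⟩)
          · exact mem_union_right _ (mem_filter.2 ⟨hw.1, fun h' => h h'.symm⟩)
        have h6 := hCC s₀ s hs.symm v hv
        have h7 := hCcard s
        have h8 := hCcard s₀
        have h9 : (#{w ∈ C s | ¬ G.Adj w u} : ℝ) + #{w ∈ C s₀ | ¬ G.Adj w u} ≤
            #{w ∈ C s ∪ C s₀ | ¬ G.Adj w u} := by exact_mod_cast h2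
        have h10 : ∀ s, (#{w ∈ C s | G.Adj u w} : ℝ) + #{w ∈ C s | ¬ G.Adj w u} = #(C s) :=
          fun s => by exact_mod_cast h3 s
        have h11 : (#{w ∈ C s₀ | G.Adj u w} : ℝ) ≤ #{w ∈ C s | G.Adj u w} := by exact_mod_cast h4
        have h12 : (#{w ∈ C s | G.Adj u w} : ℝ) ≤
            #{w ∈ C s | G.Adj u w ∧ G.Adj v w} + #{w ∈ C s | ¬ G.Adj w v} := by exact_mod_cast h5
        have h13 := h10 s
        have h14 := h10 s₀
        have h15 : z ≤ (2 * ((p - e) * n) - μ) / 2 - 2 * e * n := by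
          have : (2 * ((p - e) * n) - μ) / 2 - 2 * e * n - z = (p / 4 - 3 * e - η / 2) * n := by
            rw [hμ, hz]; ring
          have : 0 ≤ (p / 4 - 3 * e - η / 2) * n := mul_nonneg (by linarith) hn0.le
          linarith
        linarith)
    exact hfree R hR hR'
  have hchoice : ∀ u, ∃ s, u ∈ S → ∀ w ∈ C s, ¬ G.Adj u w := by
    intro u
    by_cases hu : u ∈ S
    · obtain ⟨s, hs⟩ := hexists u hu
      exact ⟨s, fun _ => hs⟩
    · exact ⟨⟨0, by omega⟩, fun h => absurd h hu⟩
  choose χ hχ using hchoice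
  refine ⟨χ, fun u hu v hv huv hχuv => ?_⟩
  obtain ⟨R, hR, hR'⟩ := exists_isNClique_of_common C hCS hδ hCC hu hv huv (χ u) hzδ hz0
    (hCz _) (by
      intro s hs
      have h1 := hmiss _ u hu (hχ u hu) s hs
      have h2 := hmiss _ v hv (hχ v hv) s (hχuv ▸ hs)
      have h3 : #(C s) ≤ #{w ∈ C s | G.Adj u w ∧ G.Adj v w} +
          (#{w ∈ C s | ¬ G.Adj w u} + #{w ∈ C s | ¬ G.Adj w v}) := by
        refine le_trans (card_le_card (t := {w ∈ C s | G.Adj u w ∧ G.Adj v w} ∪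
          ({w ∈ C s | ¬ G.Adj w u} ∪ {w ∈ C s | ¬ G.Adj w v})) ?_)
          ((card_union_le _ _).trans (Nat.add_le_add_left (card_union_le _ _) _))
        intro w hw
        simp only [mem_union, mem_filter, hw, true_and, G.adj_comm w]
        tauto
      have h4 : (#(C s) : ℝ) ≤ #{w ∈ C s | G.Adj u w ∧ G.Adj v w} +
          (#{w ∈ C s | ¬ G.Adj w u} + #{w ∈ C s | ¬ G.Adj w v}) := by exact_mod_cast h3
      have h5 := hCcard s
      have h6 : z ≤ (p - e) * n - 2 * (2 * e * n) := by
        have : (p - e) * n - 2 * (2 * e * n) - z = (p * (3 / 4) - 5 * e) * n := by rw [hz]; ring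
        have : 0 ≤ (p * (3 / 4) - 5 * e) * n := mul_nonneg (by linarith) hn0.le
        linarith
      linarith)
  exact hfree R hR hR'

open Classical in
/-- At least a fraction `1 / r` of the pairs are monochromatic. -/
theorem sq_card_le_sum_card_fiber {r : ℕ} (χ : V → Fin r) (S : Finset V) :
    (#S : ℝ) ^ 2 ≤ r * ∑ x ∈ S, (#{y ∈ S | χ y = χ x} : ℝ) := by
  have h1 : (#S : ℝ) = ∑ s, (#{y ∈ S | χ y = s} : ℝ) := by
    exact_mod_cast card_eq_sum_card_fiberwise (f := χ) (t := univ) fun _ _ => mem_univ _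
  have h2 : ∑ x ∈ S, (#{y ∈ S | χ y = χ x} : ℝ) = ∑ s, (#{y ∈ S | χ y = s} : ℝ) ^ 2 := by
    rw [← sum_fiberwise_of_maps_to (g := χ) (t := univ) fun _ _ => mem_univ _]
    refine sum_congr rfl fun s _ => ?_
    rw [sum_congr rfl (g := fun _ => (#{y ∈ S | χ y = s} : ℝ)) fun x hx => by
      rw [(mem_filter.1 hx).2], sum_const, nsmul_eq_mul, sq]
  rw [h1, h2]
  refine (sq_sum_le_card_mul_sum_sq).trans (le_of_eq ?_)
  simp

open Classical in
/-- A graph without joints and with nearly as many edges as the Turán graph is properly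
`r`-coloured, and nearly complete `r`-partite, outside a small set of vertices. -/
theorem JointFree.exists_coloring [Fintype V] {G : SimpleGraph V} {r H N m : ℕ}
    (hG : JointFree G r H N) (hr : 2 ≤ r) (hHr : 4 * (2 * r + 1) * r ^ (r + 2) ≤ H)
    (hHr' : 16 * r ^ 4 ≤ H) (hN : 4 * r ^ 3 * H * N ≤ Fintype.card V)
    (hm : H ^ 5 * m ≤ Fintype.card V) (hm0 : 0 < m)
    (hsum : (1 - 1 / (r : ℝ)) * ((Fintype.card V : ℝ) ^ 2 - Fintype.card V * m) ≤
      ∑ x, (degIn G univ x : ℝ)) :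
    ∃ (S : Finset V) (χ : V → Fin r), (∀ u ∈ S, ∀ v ∈ S, G.Adj u v → χ u ≠ χ v) ∧
      (Fintype.card V : ℝ) - #S ≤ H * m ∧
      ∑ x ∈ S, (missing G χ S x : ℝ) ≤ Fintype.card V * m := by
  set n : ℝ := (Fintype.card V : ℝ) with hn
  have hr0 : (2 : ℝ) ≤ r := by exact_mod_cast hr
  have hHr'' : 16 * (r : ℝ) ^ 4 ≤ H := by exact_mod_cast hHr'
  have hr4 : (16 : ℝ) ≤ r ^ 4 := by
    calc (16 : ℝ) = 2 ^ 4 := by norm_num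
      _ ≤ r ^ 4 := by gcongr
  have hH : (256 : ℝ) ≤ H := by linarith
  have hm' : (1 : ℝ) ≤ m := by exact_mod_cast hm0
  have hmn : (H : ℝ) ^ 5 * m ≤ n := by rw [hn]; exact_mod_cast hm
  have hH4 : (256 : ℝ) ^ 4 ≤ H ^ 4 := by gcongr
  have hHm : (H : ℝ) * (m * H ^ 4) ≤ n := by
    linarith [show (H : ℝ) ^ 5 * m = H * (m * H ^ 4) by ring]
  have hn0 : 0 < n := lt_of_lt_of_le (by positivity) hmn
  set p : ℝ := 1 / r with hp
  have hp0 : 0 < p := by positivity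
  have hp2 : p ≤ 1 / 2 := one_div_le_one_div_of_le (by norm_num) hr0
  set ε : ℝ := 1 / H with hε
  have hε0 : 0 < ε := by positivity
  have hHε : H * ε = 1 := by rw [hε]; field_simp
  have hε1 : ε ≤ 1 / 256 := one_div_le_one_div_of_le (by norm_num) hH
  obtain ⟨S, hSdeg, hSsum⟩ := exists_large_minDegree G (1 - p - ε) (by linarith)
  have hSn : (#S : ℝ) ≤ n := by rw [hn]; exact_mod_cast card_le_univ S
  have hsum' : (1 - p - ε) * (#S : ℝ) ^ 2 + ε * n ^ 2 - n * m ≤ ∑ x ∈ S, (degIn G S x : ℝ) := by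
    rw [← hn] at hSsum
    have : 0 ≤ p * (n * m) := by positivity
    nlinarith
  have hmn' : 2 * m ≤ ε * n := by
    have h1 : ε * (H * (m * H ^ 4)) ≤ ε * n := mul_le_mul_of_nonneg_left hHm hε0.le
    have h2 : ε * (H * (m * H ^ 4)) = (H * ε) * (m * H ^ 4) := by ring
    rw [h2, hHε] at h1
    nlinarith
  -- the set `S` is not too small
  have hSlarge : ε / 2 * n ≤ #S := by
    have h1 : ∑ x ∈ S, (degIn G S x : ℝ) ≤ (#S : ℝ) ^ 2 := by
      have : ∀ x ∈ S, (degIn G S x : ℝ) ≤ #S := fun x _ => by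
        exact_mod_cast card_filter_le _ _
      refine (sum_le_card_nsmul _ _ _ this).trans (le_of_eq ?_)
      rw [nsmul_eq_mul, sq]
    have h2 : ε / 2 * n ^ 2 ≤ (#S : ℝ) ^ 2 := by
      have h3 : 0 ≤ (#S : ℝ) ^ 2 := by positivity
      have h4 : (1 - (1 - p - ε)) * (#S : ℝ) ^ 2 ≤ 1 * (#S : ℝ) ^ 2 :=
        mul_le_mul_of_nonneg_right (by linarith) h3
      have h5 : n * (2 * m) ≤ n * (ε * n) := mul_le_mul_of_nonneg_left hmn' hn0.le
      nlinarith
    have h3 : (#S : ℝ) ^ 2 ≤ n * #S := by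
      have : (0 : ℝ) ≤ #S := Nat.cast_nonneg _
      nlinarith
    have h4 : n * (ε / 2 * n) ≤ n * #S := by nlinarith
    exact le_of_mul_le_mul_left h4 hn0
  have hHS : n ≤ 2 * H * #S := by
    have h1 : H * (ε / 2 * n) ≤ H * #S := mul_le_mul_of_nonneg_left hSlarge (by positivity)
    have h2 : H * (ε / 2 * n) = (H * ε) * n / 2 := by ring
    rw [h2, hHε] at h1
    linarith
  have hSne : S.Nonempty := by
    rw [← card_pos]
    have : (0 : ℝ) < #S := lt_of_lt_of_le (by positivity) hSlarge
    exact_mod_cast this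
  have hdeg : ∀ u ∈ S, (1 - 1 / r - 2 * ε) * #S ≤ degIn G S u := by
    intro u hu
    refine le_trans ?_ (hSdeg u hu)
    have h2 : (H : ℝ) * H ≤ n := by
      refine le_trans (mul_le_mul_of_nonneg_left ?_ (by positivity)) hHm
      exact (le_self_pow₀ (by linarith) (by norm_num)).trans
        (le_mul_of_one_le_left (by positivity) hm')
    have h3 : (H : ℝ) ≤ ε * n := by
      have := mul_le_mul_of_nonneg_left h2 hε0.le
      rwa [show ε * ((H : ℝ) * H) = H * ε * H by ring, hHε, one_mul] at this
    have h4 : 1 ≤ ε * (ε * n) := by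
      have := mul_le_mul_of_nonneg_left h3 hε0.le
      rwa [mul_comm ε, hHε] at this
    have h5 : (1 / 2 : ℝ) ≤ ε * #S := by
      have := mul_le_mul_of_nonneg_left hSlarge hε0.le
      linarith
    rw [← hp]
    linarith
  have hη : 8 * (r : ℝ) ^ 4 * (2 * ε) ≤ 1 := by
    have := mul_le_mul_of_nonneg_right hHr'' hε0.le
    rw [hHε] at this
    linarith
  have hfree := hG.not_isNClique hr hHr S (2 * ε) (by positivity) hη (by
    have h1 : (4 * r ^ 3 * H * N : ℝ) ≤ n := by rw [hn]; exact_mod_cast hN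
    have h2 : (2 * H : ℝ) * (2 * r ^ 3 * N) ≤ 2 * H * #S := by linarith
    have h3 : (2 * r ^ 3 * N : ℝ) ≤ #S := le_of_mul_le_mul_left h2 (by positivity)
    exact_mod_cast h3) hSne hdeg
  obtain ⟨χ, hχ⟩ := exists_coloring_of_minDegree hr S hSne (2 * ε) (by positivity) hη hdeg hfree
  -- the edges, the missing pairs and the monochromatic pairs are disjoint
  have hcount : ∑ x ∈ S, (degIn G S x : ℝ) + ∑ x ∈ S, (missing G χ S x : ℝ) ≤
      (1 - p) * (#S : ℝ) ^ 2 := by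
    have h1 : ∀ x ∈ S, (degIn G S x : ℝ) + missing G χ S x + #{y ∈ S | χ y = χ x} ≤ #S := by
      intro x hx
      have h2 : degIn G S x + missing G χ S x + #{y ∈ S | χ y = χ x} ≤ #S := by
        unfold degIn missing
        rw [← card_union_of_disjoint, ← card_union_of_disjoint]
        · refine card_le_card (union_subset (union_subset ?_ ?_) ?_) <;> exact filter_subset _ _
        · rw [disjoint_left]
          intro y hy hy'
          have hyc := (mem_filter.1 hy').2
          rcases mem_union.1 hy with hy | hy
          · exact hχ x hx y (mem_filter.1 hy).1 (mem_filter.1 hy).2 hyc.symm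
          · exact (mem_filter.1 hy).2.1 hyc.symm
        · rw [disjoint_left]
          intro y hy hy'
          exact (mem_filter.1 hy').2.2 (mem_filter.1 hy).2
      exact_mod_cast h2
    have h2 := sum_le_sum h1
    rw [sum_add_distrib, sum_add_distrib, sum_const, nsmul_eq_mul] at h2
    have h3 := mul_le_mul_of_nonneg_left (sq_card_le_sum_card_fiber χ S) hp0.le
    rw [← mul_assoc, show p * r = 1 by rw [hp]; field_simp, one_mul] at h3
    linarith [sq (#S : ℝ)]
  have hmiss0 : 0 ≤ ∑ x ∈ S, (missing G χ S x : ℝ) := sum_nonneg fun _ _ => Nat.cast_nonneg _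
  refine ⟨S, χ, hχ, ?_, ?_⟩
  · have h1 : ε * n ^ 2 - n * m ≤ ε * (#S : ℝ) ^ 2 := by linarith
    have h2 : H * (ε * n ^ 2 - n * m) ≤ H * (ε * (#S : ℝ) ^ 2) :=
      mul_le_mul_of_nonneg_left h1 (by positivity)
    have h3 : n ^ 2 - n * (H * m) ≤ (#S : ℝ) ^ 2 := by
      have h4 : H * (ε * n ^ 2 - n * m) = (H * ε) * n ^ 2 - n * (H * m) := by ring
      have h5 : H * (ε * (#S : ℝ) ^ 2) = (H * ε) * (#S : ℝ) ^ 2 := by ring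
      rw [h4, h5, hHε, one_mul, one_mul] at h2
      exact h2
    have h6 : n * (n - #S) ≤ n * (H * m) := by
      have : (0 : ℝ) ≤ #S := Nat.cast_nonneg _
      nlinarith
    exact le_of_mul_le_mul_left h6 hn0
  · have : ε * (#S : ℝ) ^ 2 ≤ ε * n ^ 2 := by gcongr
    linarith

end Coloring

/-! ### Extending the colouring to all vertices -/

section Extension

open Finset

variable {V : Type*}

open Classical in
/-- A graph without joints and with nearly as many edges as the Turán graph has an `r`-colouring under
which each vertex has few neighbours of its own colour, and which is nearly complete on a set `S` of
nearly all vertices. -/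
theorem JointFree.exists_coloring_univ [Fintype V] {G : SimpleGraph V} {r H N m : ℕ}
    (hG : JointFree G r H N) (hr : 2 ≤ r) (hHr : 4 * (2 * r + 1) * r ^ (r + 2) ≤ H)
    (hHr' : 16 * r ^ 4 ≤ H) (hHr2 : (2 * r + 1) * 2 ^ r ≤ H)
    (hN0 : 0 < N) (hN : 4 * r ^ 3 * H * N ≤ Fintype.card V)
    (hm : H ^ 5 * m ≤ Fintype.card V) (hm0 : 0 < m)
    (hsum : (1 - 1 / (r : ℝ)) * ((Fintype.card V : ℝ) ^ 2 - Fintype.card V * m) ≤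
      ∑ x, (degIn G univ x : ℝ)) :
    ∃ (S : Finset V) (χ : V → Fin r), #(univ \ S) ≤ H * m ∧
      8 * r * ∑ x ∈ S, (missing G χ S x : ℝ) ≤ ((Fintype.card V : ℝ) / (2 * H)) ^ 2 ∧
      ∀ u, (#{w | χ w = χ u ∧ G.Adj u w} : ℝ) ≤ 2 * ((Fintype.card V : ℝ) / H) := by
  obtain ⟨S, χ, hχ, hS, hmiss⟩ := hG.exists_coloring hr hHr hHr' hN hm hm0 hsum
  set n : ℝ := (Fintype.card V : ℝ) with hn
  have hr0 : (2 : ℝ) ≤ r := by exact_mod_cast hr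
  have hHr'' : 16 * (r : ℝ) ^ 4 ≤ H := by exact_mod_cast hHr'
  have hr4 : 8 * (r : ℝ) ≤ r ^ 4 := by
    calc 8 * (r : ℝ) = 2 ^ 3 * r := by norm_num
      _ ≤ r ^ 3 * r := by gcongr
      _ = r ^ 4 := by ring
  have hH : 128 * r ≤ (H : ℝ) := by linarith
  have hH1 : (1 : ℝ) ≤ H := by linarith
  have hm' : (1 : ℝ) ≤ m := by exact_mod_cast hm0
  have hmn : (H : ℝ) ^ 5 * m ≤ n := by rw [hn]; exact_mod_cast hm
  have hH0 : (0 : ℝ) < H := by linarith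
  have hn0 : 0 < n := lt_of_lt_of_le (by positivity) hmn
  have hmnH : 2 * (H * m) ≤ n / H := by
    rw [le_div_iff₀ hH0]
    refine le_trans ?_ hmn
    have h1 : (H : ℝ) ^ 3 * m * H ^ 2 = H ^ 5 * m := by ring
    have h2 : (2 : ℝ) ≤ H ^ 3 := le_trans (by linarith) (le_self_pow₀ hH1 (by norm_num))
    have h3 : 0 ≤ m * (H : ℝ) ^ 2 := by positivity
    nlinarith
  have h8 : 8 * r * ∑ x ∈ S, (missing G χ S x : ℝ) ≤ (n / (2 * H)) ^ 2 := by
    refine (mul_le_mul_of_nonneg_left hmiss (by positivity)).trans ?_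
    rw [div_pow, le_div_iff₀ (by positivity)]
    have h1 : 32 * r * (H : ℝ) ^ 2 * m ≤ H ^ 5 * m := by
      have : 32 * r * (H : ℝ) ^ 2 ≤ H ^ 5 := by
        calc 32 * r * (H : ℝ) ^ 2 ≤ (H : ℝ) ^ 3 * (H : ℝ) ^ 2 := by
              gcongr
              exact le_trans (by linarith) (le_self_pow₀ hH1 (by norm_num))
          _ = (H : ℝ) ^ 5 := by ring
      gcongr
    have h2 := mul_le_mul_of_nonneg_left (h1.trans hmn) hn0.le
    linarith
  have hscard : (#(univ \ S) : ℝ) ≤ H * m := by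
    rw [cast_card_sdiff (subset_univ S), card_univ]
    exact hS
  -- every vertex `u` has few neighbours in some colour: otherwise it forms a joint with one of its
  -- neighbours `v` of colour `s₀` at which few pairs are missing
  have hexists : ∀ u, ∃ s, (#{w ∈ S | χ w = s ∧ G.Adj u w} : ℝ) ≤ n / H := by
    intro u
    by_contra! hcon
    set s₀ : Fin r := ⟨0, by omega⟩
    set A : Finset V := {w ∈ S | χ w = s₀ ∧ G.Adj u w} with hA
    obtain ⟨v, hvA, hv⟩ : ∃ v ∈ A, (missing G χ S v : ℝ) ≤ H * m := by
      by_contra! hlt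
      have h1 : #A * (H * m : ℝ) ≤ ∑ x ∈ S, (missing G χ S x : ℝ) := by
        rw [← nsmul_eq_mul]
        exact (card_nsmul_le_sum _ _ _ fun x hx => (hlt x hx).le).trans
          (sum_le_sum_of_subset_of_nonneg (filter_subset _ _) fun _ _ _ => Nat.cast_nonneg _)
      have h2 : n / H * (H * m) < #A * (H * m : ℝ) :=
        mul_lt_mul_of_pos_right (hcon s₀) (by positivity)
      have h3 : n / H * (H * m) = n * m := by field_simp
      linarith
    have hvA' := (mem_filter.1 hvA)
    have hz : 2 * (N : ℝ) ≤ n / (2 * H) := by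
      rw [le_div_iff₀ (by positivity)]
      have h1 : (4 * r ^ 3 * H * N : ℝ) ≤ n := by rw [hn]; exact_mod_cast hN
      have h2 : (1 : ℝ) ≤ r ^ 3 := one_le_pow₀ (by linarith)
      have h3 : (0 : ℝ) ≤ H * N := by positivity
      nlinarith
    have hnH : n / (2 * H) = n / H / 2 := by field_simp
    refine hG.false_of_missing hr hN0 hHr2 χ S _ hz h8 hvA'.2.2 s₀ ?_ ?_
    · have h1 : #A ≤ #{x ∈ S | χ x = s₀} :=
        card_le_card (monotone_filter_right _ fun _ _ h => h.1)
      have h2 : (#A : ℝ) ≤ #{x ∈ S | χ x = s₀} := by exact_mod_cast h1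
      have h3 := hcon s₀
      have : 0 < n / H := by positivity
      linarith
    · intro s hs
      have h1 : #{w ∈ S | χ w = s ∧ G.Adj u w} ≤
          #{x ∈ S | χ x = s ∧ G.Adj u x ∧ G.Adj v x} + missing G χ S v := by
        refine (card_le_card ?_).trans (card_union_le _ _)
        intro w hw
        obtain ⟨hw1, hw2, hw3⟩ := mem_filter.1 hw
        by_cases h : G.Adj v w
        · exact mem_union_left _ (mem_filter.2 ⟨hw1, hw2, hw3, h⟩)
        · refine mem_union_right _ (mem_filter.2 ⟨hw1, ?_, h⟩)
          rw [hvA'.2.1, hw2]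
          exact hs.symm
      have h2 : (#{w ∈ S | χ w = s ∧ G.Adj u w} : ℝ) ≤
          #{x ∈ S | χ x = s ∧ G.Adj u x ∧ G.Adj v x} + missing G χ S v := by exact_mod_cast h1
      have := hcon s
      linarith
  choose g hg using hexists
  set χ' : V → Fin r := fun u => if u ∈ S then χ u else g u with hχ'
  have hχS : ∀ u ∈ S, χ' u = χ u := fun u hu => by simp [hχ', hu]
  refine ⟨S, χ', by exact_mod_cast hscard, ?_, ?_⟩
  · refine le_trans (le_of_eq ?_) h8
    congr 1
    refine sum_congr rfl fun x hx => ?_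
    congr 1
    refine congrArg card (filter_congr fun y hy => ?_)
    rw [hχS x hx, hχS y hy]
  · intro u
    have h1 : #{w | χ' w = χ' u ∧ G.Adj u w} ≤
        #{w ∈ S | χ w = χ' u ∧ G.Adj u w} + #(univ \ S) := by
      refine (card_le_card ?_).trans (card_union_le _ _)
      intro w hw
      obtain ⟨-, hw1, hw2⟩ := mem_filter.1 hw
      by_cases h : w ∈ S
      · exact mem_union_left _ (mem_filter.2 ⟨h, by rwa [← hχS w h], hw2⟩)
      · exact mem_union_right _ (by simpa using h)
    have h2 : (#{w ∈ S | χ w = χ' u ∧ G.Adj u w} : ℝ) ≤ n / H := by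
      by_cases hu : u ∈ S
      · rw [hχS u hu, filter_eq_empty_iff.2]
        · simpa using by positivity
        · rintro w hw ⟨h, h'⟩
          exact hχ u hu w hw h' h.symm
      · simpa [hχ', hu] using hg u
    have h3 : (#{w | χ' w = χ' u ∧ G.Adj u w} : ℝ) ≤
        #{w ∈ S | χ w = χ' u ∧ G.Adj u w} + #(univ \ S) := by exact_mod_cast h1
    have h4 : (0 : ℝ) ≤ H * m := by positivity
    linarith

end Extension

/-! ### Densities between the parts -/

section Parts

open Finset

variable {V : Type*} [Fintype V]

open Classical in
/-- The number of pairs `(u, v)` with `u` in part `i`, `v` in part `j` which are related by `Q`. -/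
noncomputable def pairCount {ℓ : ℕ} (part : V → Fin ℓ) (Q : V → V → Prop) (i j : Fin ℓ) : ℕ :=
  #{x : V × V | part x.1 = i ∧ part x.2 = j ∧ Q x.1 x.2}

/-- The vertices are partitioned by `part` into independent sets of size `m`, and the density
between any two of them is at least `(r - 1) / r`. -/
structure IsDenseMultipartite (G : SimpleGraph V) (r m : ℕ) {ℓ : ℕ} (part : V → Fin ℓ) :
    Prop where
  card_part : ∀ i, open Classical in #{v | part v = i} = m
  part_ne : ∀ u v, G.Adj u v → part u ≠ part v
  dense : ∀ i j, i ≠ j → (r - 1 : ℝ) * m ^ 2 ≤ r * pairCount part G.Adj i j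

open Classical in
/-- The number of vertices of colour `s` in part `i`. -/
noncomputable def colorCount {ℓ r : ℕ} (part : V → Fin ℓ) (χ : V → Fin r) (i : Fin ℓ)
    (s : Fin r) : ℕ :=
  #{v | part v = i ∧ χ v = s}

open Classical in
theorem sum_colorCount {ℓ r : ℕ} (part : V → Fin ℓ) (χ : V → Fin r) (i : Fin ℓ) :
    ∑ s, colorCount part χ i s = #{v | part v = i} := by
  rw [card_eq_sum_card_fiberwise (f := χ) (t := univ) fun _ _ => mem_univ _]
  refine sum_congr rfl fun s _ => ?_
  rw [colorCount, filter_filter]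

theorem pairCount_true {ℓ : ℕ} (part : V → Fin ℓ) (i j : Fin ℓ) :
    open Classical in pairCount part (fun _ _ => True) i j =
      #{v | part v = i} * #{v | part v = j} := by
  classical
  rw [← card_product, pairCount]
  congr 1
  ext x
  simp

/-- The number of pairs with equal colours. -/
theorem pairCount_same {ℓ r : ℕ} (part : V → Fin ℓ) (χ : V → Fin r) (i j : Fin ℓ) :
    pairCount part (fun u v => χ u = χ v) i j =
      ∑ s, colorCount part χ i s * colorCount part χ j s := by
  classical
  rw [pairCount, card_eq_sum_card_fiberwise (f := fun x => χ x.1) (t := univ)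
    fun _ _ => mem_univ _]
  refine sum_congr rfl fun s _ => ?_
  rw [colorCount, colorCount, ← card_product]
  congr 1
  ext x
  simp only [mem_filter, mem_univ, true_and, mem_product]
  constructor
  · rintro ⟨⟨h1, h2, h3⟩, h4⟩
    exact ⟨⟨h1, h4⟩, h2, h3 ▸ h4⟩
  · rintro ⟨⟨h1, h4⟩, h2, h3⟩
    exact ⟨⟨h1, h2, h4.trans h3.symm⟩, h4⟩

theorem pairCount_add_compl {ℓ : ℕ} (part : V → Fin ℓ) (Q R : V → V → Prop) (i j : Fin ℓ) :
    pairCount part (fun u v => Q u v ∧ R u v) i j + pairCount part (fun u v => Q u v ∧ ¬ R u v) i j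
      = pairCount part Q i j := by
  classical
  simp only [pairCount]
  rw [← card_filter_add_card_filter_not (s := {x : V × V | part x.1 = i ∧ part x.2 = j ∧ Q x.1 x.2})
    (fun x => R x.1 x.2), filter_filter, filter_filter]
  simp only [and_assoc]

/-- Missing edges between colour classes are compensated by edges inside of colour classes, up to
the deviation of the number of pairs with equal colours from `m² / r`. -/
theorem IsDenseMultipartite.missing_le {G : SimpleGraph V} {r m ℓ : ℕ} {part : V → Fin ℓ}
    (hG : IsDenseMultipartite G r m part) (χ : V → Fin r) {i j : Fin ℓ} (hij : i ≠ j) :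
    (r : ℝ) * pairCount part (fun u v => ¬ χ u = χ v ∧ ¬ G.Adj u v) i j +
        r * ∑ s, (colorCount part χ i s : ℝ) * colorCount part χ j s ≤
      m ^ 2 + r * pairCount part (fun u v => χ u = χ v ∧ G.Adj u v) i j := by
  have h1 := pairCount_add_compl part (fun _ _ => True) (fun u v => χ u = χ v) i j
  have h2 := pairCount_add_compl part (fun u v => ¬ χ u = χ v) G.Adj i j
  have h3 := pairCount_add_compl part G.Adj (fun u v => χ u = χ v) i j
  rw [pairCount_true, hG.card_part, hG.card_part] at h1
  simp only [true_and] at h1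
  rw [pairCount_same] at h1
  have h4 : pairCount part (fun u v => G.Adj u v ∧ χ u = χ v) i j =
      pairCount part (fun u v => χ u = χ v ∧ G.Adj u v) i j := by simp only [and_comm]
  have h5 : pairCount part (fun u v => G.Adj u v ∧ ¬ χ u = χ v) i j =
      pairCount part (fun u v => ¬ χ u = χ v ∧ G.Adj u v) i j := by simp only [and_comm]
  rw [h4, h5] at h3
  have h6 := hG.dense i j hij
  have h1' : ∑ s, (colorCount part χ i s : ℝ) * colorCount part χ j s +
      pairCount part (fun u v => ¬ χ u = χ v) i j = m * m := by exact_mod_cast h1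
  have h2' : (pairCount part (fun u v => ¬ χ u = χ v ∧ G.Adj u v) i j : ℝ) +
      pairCount part (fun u v => ¬ χ u = χ v ∧ ¬ G.Adj u v) i j =
      pairCount part (fun u v => ¬ χ u = χ v) i j := by exact_mod_cast h2
  have h3' : (pairCount part (fun u v => χ u = χ v ∧ G.Adj u v) i j : ℝ) +
      pairCount part (fun u v => ¬ χ u = χ v ∧ G.Adj u v) i j = pairCount part G.Adj i j := by
    exact_mod_cast h3
  have h7 : (r : ℝ) * (pairCount part (fun u v => ¬ χ u = χ v ∧ ¬ G.Adj u v) i j +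
      ∑ s, (colorCount part χ i s : ℝ) * colorCount part χ j s + pairCount part G.Adj i j -
      pairCount part (fun u v => χ u = χ v ∧ G.Adj u v) i j) = r * (m * m) := by
    congr 1
    linarith
  linarith

open Classical in
/-- Double counting of the related pairs between different parts of the family `J`. -/
theorem sum_offDiag_pairCount {ℓ : ℕ} (part : V → Fin ℓ) (Q : V → V → Prop)
    (J : Finset (Fin ℓ)) :
    ∑ x ∈ J.offDiag, pairCount part Q x.1 x.2 =
      ∑ u with part u ∈ J, #{w | part w ∈ J ∧ part w ≠ part u ∧ Q u w} := by
  have h1 : ∑ x ∈ J.offDiag, pairCount part Q x.1 x.2 =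
      #{x : V × V | part x.1 ∈ J ∧ part x.2 ∈ J ∧ part x.2 ≠ part x.1 ∧ Q x.1 x.2} := by
    rw [card_eq_sum_card_fiberwise (f := fun x : V × V => (part x.1, part x.2)) (t := J.offDiag)]
    · refine sum_congr rfl fun x hx => ?_
      rw [mem_offDiag] at hx
      rw [pairCount, filter_filter]
      congr 1
      ext y
      simp only [mem_filter, mem_univ, true_and, Prod.ext_iff]
      constructor
      · rintro ⟨hy1, hy2, hy3⟩
        rw [hy1, hy2]
        exact ⟨⟨hx.1, hx.2.1, hx.2.2.symm, hy3⟩, rfl, rfl⟩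
      · rintro ⟨⟨-, -, -, hy3⟩, hy1, hy2⟩
        exact ⟨hy1, hy2, hy3⟩
    · intro x hx
      have hx' : part x.1 ∈ J ∧ part x.2 ∈ J ∧ part x.2 ≠ part x.1 ∧ Q x.1 x.2 := by simpa using hx
      simpa using ⟨hx'.1, hx'.2.1, hx'.2.2.1.symm⟩
  have h2 : #{x : V × V | part x.1 ∈ J ∧ part x.2 ∈ J ∧ part x.2 ≠ part x.1 ∧ Q x.1 x.2} =
      ∑ u, #{w | part u ∈ J ∧ part w ∈ J ∧ part w ≠ part u ∧ Q u w} := by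
    simp only [card_filter]
    rw [← univ_product_univ, sum_product]
  rw [h1, h2, sum_filter]
  refine sum_congr rfl fun u _ => ?_
  split_ifs with h <;> simp [h]

theorem card_eq_mul_card {ℓ m : ℕ} (part : V → Fin ℓ)
    (h : ∀ i, open Classical in #{v | part v = i} = m) (J : Finset (Fin ℓ)) :
    open Classical in #{v | part v ∈ J} = #J * m := by
  classical
  rw [card_eq_sum_card_fiberwise (f := part) (t := J) (by intro x hx; simpa using hx)]
  rw [sum_congr rfl (g := fun _ => m), sum_const, smul_eq_mul]
  intro i hi
  rw [filter_filter, ← h i]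
  congr 1
  ext v
  simp only [mem_filter, mem_univ, true_and]
  exact ⟨fun h => h.2, fun h => ⟨h ▸ hi, h⟩⟩

open Classical in
theorem card_color_eq_sum {ℓ r : ℕ} (part : V → Fin ℓ) (χ : V → Fin r) (J : Finset (Fin ℓ))
    (s : Fin r) : #{v | part v ∈ J ∧ χ v = s} = ∑ j ∈ J, colorCount part χ j s := by
  rw [card_eq_sum_card_fiberwise (f := part) (t := J) (by
    intro x hx
    have : part x ∈ J ∧ χ x = s := by simpa using hx
    exact this.1)]
  refine sum_congr rfl fun j hj => ?_
  rw [colorCount, filter_filter]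
  congr 1
  ext v
  simp only [mem_filter, mem_univ, true_and]
  exact ⟨fun h => ⟨h.2, h.1.2⟩, fun h => ⟨⟨h.1 ▸ hj, h.2⟩, h.1⟩⟩

open Classical in
theorem sum_pairCount {ℓ : ℕ} (part : V → Fin ℓ) (Q : V → V → Prop) (i : Fin ℓ)
    (J : Finset (Fin ℓ)) :
    ∑ j ∈ J, pairCount part Q i j = ∑ u with part u = i, #{w | part w ∈ J ∧ Q u w} := by
  have h1 : ∀ j, pairCount part Q i j = ∑ u with part u = i, #{w | part w = j ∧ Q u w} := by
    intro j
    simp only [pairCount, card_filter, sum_filter]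
    rw [← univ_product_univ, sum_product]
    refine sum_congr rfl fun u _ => ?_
    split_ifs with h <;> simp [h]
  rw [sum_congr rfl fun j _ => h1 j, sum_comm]
  refine sum_congr rfl fun u _ => ?_
  rw [card_eq_sum_card_fiberwise (f := part) (t := J) (by
    intro x hx
    have : part x ∈ J ∧ Q u x := by simpa using hx
    exact this.1)]
  refine sum_congr rfl fun j hj => ?_
  rw [filter_filter]
  congr 1
  ext v
  simp only [mem_filter, mem_univ, true_and]
  exact ⟨fun h => ⟨⟨h.1 ▸ hj, h.2⟩, h.1⟩, fun h => ⟨h.2, h.1.2⟩⟩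

end Parts

section Chebyshev

open Finset

/-- Chebyshev's sum inequality for two functions which are sorted by the same permutation, with the
case of equality. -/
theorem chebyshev_of_sort_eq {r : ℕ} (f g : Fin r → ℕ) (h : Tuple.sort f = Tuple.sort g) :
    (∑ s, (f s : ℝ)) * ∑ s, (g s : ℝ) ≤ r * ∑ s, (f s : ℝ) * g s ∧
      (r * ∑ s, (f s : ℝ) * g s ≤ (∑ s, (f s : ℝ)) * ∑ s, (g s : ℝ) →
        (∀ s t, f s = f t) ∨ ∀ s t, g s = g t) := by
  have hf := Tuple.monotone_sort f
  have hg := Tuple.monotone_sort g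
  rw [← h] at hg
  set e := Tuple.sort f
  have hsurj : ∀ s, ∃ s', e s' = s := e.surjective
  have hmono : ∀ s t, (0 : ℝ) ≤ ((f s : ℝ) - f t) * (g s - g t) := by
    intro s t
    obtain ⟨s, rfl⟩ := hsurj s
    obtain ⟨t, rfl⟩ := hsurj t
    rcases le_total s t with hst | hst
    · have h1 : (f (e s) : ℝ) ≤ f (e t) := by exact_mod_cast hf hst
      have h2 : (g (e s) : ℝ) ≤ g (e t) := by exact_mod_cast hg hst
      nlinarith
    · have h1 : (f (e t) : ℝ) ≤ f (e s) := by exact_mod_cast hf hst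
      have h2 : (g (e t) : ℝ) ≤ g (e s) := by exact_mod_cast hg hst
      nlinarith
  have hsum : ∑ s, ∑ t, ((f s : ℝ) - f t) * (g s - g t) =
      2 * (r * ∑ s, (f s : ℝ) * g s - (∑ s, (f s : ℝ)) * ∑ s, (g s : ℝ)) := by
    have : ∀ s t, ((f s : ℝ) - f t) * (g s - g t) = f s * g s - f s * g t - g s * f t + f t * g t :=
      fun s t => by ring
    simp only [this, sum_add_distrib, sum_sub_distrib, ← mul_sum, ← sum_mul, sum_const, card_univ,
      Fintype.card_fin, nsmul_eq_mul]
    have : ∑ s, (f s : ℝ) * (r * g s) = r * ∑ s, (f s : ℝ) * g s := by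
      rw [mul_sum]
      exact sum_congr rfl fun _ _ => by ring
    rw [this]
    ring
  have hnonneg : 0 ≤ ∑ s, ∑ t, ((f s : ℝ) - f t) * (g s - g t) :=
    sum_nonneg fun s _ => sum_nonneg fun t _ => hmono s t
  refine ⟨by linarith, fun hle => ?_⟩
  have hzero : ∀ s t, ((f s : ℝ) - f t) * (g s - g t) = 0 := by
    intro s t
    have h0 : ∑ s, ∑ t, ((f s : ℝ) - f t) * (g s - g t) = 0 := le_antisymm (by linarith) hnonneg
    have h1 := (sum_eq_zero_iff_of_nonneg fun s _ => sum_nonneg fun t _ => hmono s t).1 h0 s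
      (mem_univ s)
    exact (sum_eq_zero_iff_of_nonneg fun t _ => hmono s t).1 h1 t (mem_univ t)
  -- it suffices to compare the smallest and the largest values
  rcases Nat.eq_zero_or_pos r with rfl | hr
  · exact Or.inl fun s => s.elim0
  obtain ⟨q, rfl⟩ : ∃ q, r = q + 1 := ⟨r - 1, by omega⟩
  have hconst : ∀ f' : Fin (q + 1) → ℕ, Monotone (f' ∘ e) → f' (e 0) = f' (e (Fin.last q)) →
      ∀ s t, f' s = f' t := by
    intro f' hf' h0
    have : ∀ s, f' s = f' (e 0) := by
      intro s
      obtain ⟨s, rfl⟩ := hsurj s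
      exact le_antisymm (h0 ▸ hf' (Fin.le_last s)) (hf' (Fin.zero_le s))
    intro s t
    rw [this s, this t]
  rcases mul_eq_zero.1 (hzero (e 0) (e (Fin.last q))) with h0 | h0
  · exact Or.inl (hconst f hf (by exact_mod_cast sub_eq_zero.1 h0))
  · exact Or.inr (hconst g hg (by exact_mod_cast sub_eq_zero.1 h0))

end Chebyshev

/-! ### Exact densities -/

section Exact

open Finset

variable {V : Type*} [Fintype V]

open Classical in
/-- In a large family `J` of parts each colour class is large. The density condition bounds the number
of monochromatic pairs from above, as few of them are edges; so the sizes of the colour classes have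
a small variance. -/
theorem IsDenseMultipartite.le_card_color {G : SimpleGraph V} {r m ℓ : ℕ} {part : V → Fin ℓ}
    (hD : IsDenseMultipartite G r m part) (hr : 2 ≤ r) (χ : V → Fin r) (B : ℝ)
    (hin : ∀ u, (#{w | χ w = χ u ∧ G.Adj u w} : ℝ) ≤ 2 * B) (hmB : (m : ℝ) ≤ B)
    (J : Finset (Fin ℓ)) (hM : 16 * (r : ℝ) ^ 2 * B ≤ #J * m) (s : Fin r) :
    #J * m / (2 * r : ℝ) ≤ #{v | part v ∈ J ∧ χ v = s} := by
  have hr0 : (2 : ℝ) ≤ r := by exact_mod_cast hr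
  set M : ℝ := #J * m with hMdef
  have hM0 : 0 ≤ M := by positivity
  have hB0 : 0 ≤ B := le_trans (Nat.cast_nonneg _) hmB
  let c : Fin r → ℝ := fun s => #{v | part v ∈ J ∧ χ v = s}
  have hcM : ∑ s, c s = M := by
    have h1 := card_eq_mul_card part hD.card_part J
    rw [card_eq_sum_card_fiberwise (f := χ) (t := univ) fun _ _ => mem_univ _] at h1
    simp only [filter_filter] at h1
    simp only [c, hMdef]
    exact_mod_cast h1
  have hcJ : ∀ s, c s = ∑ j ∈ J, (colorCount part χ j s : ℝ) := by
    intro s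
    simp only [c]
    exact_mod_cast card_color_eq_sum part χ J s
  have hsq : ∑ s, c s ^ 2 = ∑ i ∈ J, ∑ s, (colorCount part χ i s : ℝ) * colorCount part χ i s +
      ∑ x ∈ J.offDiag, ∑ s, (colorCount part χ x.1 s : ℝ) * colorCount part χ x.2 s := by
    have h1 : ∀ s, c s ^ 2 = ∑ x ∈ J ×ˢ J,
        (colorCount part χ x.1 s : ℝ) * colorCount part χ x.2 s := by
      intro s
      rw [hcJ, sq, sum_mul_sum, sum_product]
    rw [sum_congr rfl fun s _ => h1 s, sum_comm, ← diag_union_offDiag,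
      sum_union (disjoint_diag_offDiag J), sum_diag]
  have hdiag : r * ∑ i ∈ J, ∑ s, (colorCount part χ i s : ℝ) * colorCount part χ i s ≤
      r * (M * m) := by
    refine mul_le_mul_of_nonneg_left ?_ (by positivity)
    have : ∀ i ∈ J, ∑ s, (colorCount part χ i s : ℝ) * colorCount part χ i s ≤ (m : ℝ) * m := by
      intro i _
      have h2 : ∑ s, (colorCount part χ i s : ℝ) = m := by
        exact_mod_cast (sum_colorCount part χ i).trans (hD.card_part i)
      nth_rewrite 1 [← h2]
      rw [sum_mul]
      refine sum_le_sum fun s _ => mul_le_mul_of_nonneg_left ?_ (Nat.cast_nonneg _)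
      rw [← h2]
      exact single_le_sum (f := fun s => (colorCount part χ i s : ℝ))
        (fun _ _ => Nat.cast_nonneg _) (mem_univ s)
    refine (sum_le_sum this).trans (le_of_eq ?_)
    rw [sum_const, nsmul_eq_mul, hMdef]
    ring
  have hoff : r * ∑ x ∈ J.offDiag, ∑ s, (colorCount part χ x.1 s : ℝ) * colorCount part χ x.2 s ≤
      M ^ 2 + r * (M * (2 * B)) := by
    have h1 : ∀ x ∈ J.offDiag, r * ∑ s, (colorCount part χ x.1 s : ℝ) * colorCount part χ x.2 s ≤
        m ^ 2 + r * pairCount part (fun u v => χ u = χ v ∧ G.Adj u v) x.1 x.2 := by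
      intro x hx
      have h2 := hD.missing_le χ (mem_offDiag.1 hx).2.2
      have : (0 : ℝ) ≤ r * pairCount part (fun u v => ¬ χ u = χ v ∧ ¬ G.Adj u v) x.1 x.2 := by
        positivity
      linarith
    have h2 := sum_le_sum h1
    rw [← mul_sum, sum_add_distrib, ← mul_sum, sum_const, nsmul_eq_mul] at h2
    refine h2.trans (add_le_add ?_ (mul_le_mul_of_nonneg_left ?_ (by positivity)))
    · have : (#J.offDiag : ℝ) ≤ #J * #J := by
        rw [offDiag_card]
        exact_mod_cast Nat.sub_le _ _
      calc (#J.offDiag : ℝ) * m ^ 2 ≤ #J * #J * m ^ 2 := by gcongr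
        _ = M ^ 2 := by rw [hMdef]; ring
    · have h3 := sum_offDiag_pairCount part (fun u v => χ u = χ v ∧ G.Adj u v) J
      have h4 : ∑ x ∈ J.offDiag, (pairCount part (fun u v => χ u = χ v ∧ G.Adj u v) x.1 x.2 : ℝ) =
          ∑ u with part u ∈ J,
            (#{w | part w ∈ J ∧ part w ≠ part u ∧ χ u = χ w ∧ G.Adj u w} : ℝ) := by
        exact_mod_cast h3
      have h5 := card_eq_mul_card part hD.card_part J
      have h6 : (#{v | part v ∈ J} : ℝ) = M := by rw [hMdef]; exact_mod_cast h5
      rw [h4, ← h6, ← nsmul_eq_mul]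
      refine sum_le_card_nsmul _ _ _ fun u _ => le_trans ?_ (hin u)
      refine Nat.cast_le.2 (card_le_card fun w hw => ?_)
      have h := (mem_filter.1 hw).2
      exact mem_filter.2 ⟨mem_univ _, h.2.2.1.symm, h.2.2.2⟩
  have hdev : ∑ t, (c t - M / r) ^ 2 = ∑ t, c t ^ 2 - M ^ 2 / r := by
    have : ∀ t, (c t - M / r) ^ 2 = c t ^ 2 - 2 * (M / r) * c t + (M / r) ^ 2 := fun t => by ring
    simp only [this, sum_add_distrib, sum_sub_distrib, ← mul_sum, hcM, sum_const, card_univ,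
      Fintype.card_fin, nsmul_eq_mul]
    field_simp
    ring
  have hs : (c s - M / r) ^ 2 ≤ ∑ t, (c t - M / r) ^ 2 :=
    single_le_sum (f := fun t => (c t - M / r) ^ 2) (fun _ _ => sq_nonneg _) (mem_univ s)
  have hmain : r * (c s - M / r) ^ 2 ≤ r * (M / (2 * r)) ^ 2 := by
    have h1 : r * (c s - M / r) ^ 2 ≤ r * (M * m) + r * (M * (2 * B)) := by
      have h2 : r * (∑ t, c t ^ 2 - M ^ 2 / r) = r * ∑ t, c t ^ 2 - M ^ 2 := by field_simp
      have h3 := mul_le_mul_of_nonneg_left (hs.trans hdev.le) (by linarith : (0 : ℝ) ≤ r)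
      rw [h2, hsq, mul_add] at h3
      linarith
    have h2 : r * (M * m) + r * (M * (2 * B)) ≤ r * (M * (3 * B)) := by
      have : r * (M * m) ≤ r * (M * B) := by gcongr
      linarith
    refine (h1.trans h2).trans (mul_le_mul_of_nonneg_left ?_ (by positivity))
    rw [div_pow, le_div_iff₀ (by positivity)]
    have h3 := mul_le_mul_of_nonneg_left hM hM0
    have h4 : 0 ≤ M * ((r : ℝ) ^ 2 * B) := by positivity
    nlinarith
  have habs := abs_le_of_sq_le_sq (le_of_mul_le_mul_left hmain (by linarith)) (by positivity)
  have h1 := (abs_le.1 habs).1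
  have h2 : M / r = M / (2 * r) + M / (2 * r) := by field_simp; norm_num
  show M / (2 * r) ≤ c s
  linarith

open Classical in
/-- In a family `J` of parts in which the colours are distributed in the same order, the colouring
is exactly complete `r`-partite. By Chebyshev's inequality there are at most as many missing pairs
as edges inside of colour classes. But each such edge has an end at which many pairs are missing,
whereas only few of them meet at a vertex. -/
theorem JointFree.exact_of_chebyshev {G : SimpleGraph V} {r H N m ℓ : ℕ} {part : V → Fin ℓ}
    (hG : JointFree G r H N) (hD : IsDenseMultipartite G r m part) (hr : 2 ≤ r)
    (hHr : (2 * r + 1) * 2 ^ r ≤ H) (hN0 : 0 < N) (B : ℝ) (hNB : 4 * N ≤ B) (hmB : 2 * m ≤ B)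
    (S : Finset V) (χ : V → Fin r) (hS : #(univ \ S) ≤ B)
    (hmiss : 8 * r * ∑ x ∈ S, (missing G χ S x : ℝ) ≤ (B / 2) ^ 2)
    (hin : ∀ u, (#{w | χ w = χ u ∧ G.Adj u w} : ℝ) ≤ 2 * B)
    (J : Finset (Fin ℓ)) (hM : 16 * (r : ℝ) ^ 2 * B ≤ #J * m)
    (hJ : ∀ i ∈ J, ∀ j ∈ J, (m : ℝ) ^ 2 ≤
      r * ∑ s, (colorCount part χ i s : ℝ) * colorCount part χ j s) :
    (∀ u v, part u ∈ J → part v ∈ J → part u ≠ part v → (G.Adj u v ↔ χ u ≠ χ v)) ∧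
      ∀ i ∈ J, ∀ j ∈ J, i ≠ j →
        r * ∑ s, (colorCount part χ i s : ℝ) * colorCount part χ j s ≤ m ^ 2 := by
  have hr0 : (2 : ℝ) ≤ r := by exact_mod_cast hr
  have hB0 : 0 < B := lt_of_lt_of_le (by positivity) hNB
  set M : ℝ := #J * m with hMdef
  have hcol := hD.le_card_color hr χ B hin (by linarith [(Nat.cast_nonneg m : (0 : ℝ) ≤ m)]) J hM
  rw [← hMdef] at hcol
  have hMB : 16 * B ≤ M / (2 * r) := by
    rw [le_div_iff₀ (by positivity)]
    have : r * B * 2 ≤ r * B * r := by gcongr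
    linarith
  let VJ : Finset V := {v | part v ∈ J}
  have hVJ : ∀ v, v ∈ VJ ↔ part v ∈ J := fun v => by simp [VJ]
  -- `inn u` and `mis u` count the edges inside of the class of `u`, and the missing pairs, at `u`
  let inn : V → ℝ := fun u => #{w | part w ∈ J ∧ part w ≠ part u ∧ χ u = χ w ∧ G.Adj u w}
  let mis : V → ℝ := fun u => #{w | part w ∈ J ∧ part w ≠ part u ∧ ¬ χ u = χ w ∧ ¬ G.Adj u w}
  have hinn : ∀ u, inn u ≤ 2 * B := fun u => by
    refine le_trans ?_ (hin u)
    refine Nat.cast_le.2 (card_le_card fun w hw => ?_)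
    have h := (mem_filter.1 hw).2
    exact mem_filter.2 ⟨mem_univ _, h.2.2.1.symm, h.2.2.2⟩
  have hmis0 : ∀ u, 0 ≤ mis u := fun u => Nat.cast_nonneg _
  have hpair : ∀ x ∈ J.offDiag,
      (pairCount part (fun u v => ¬ χ u = χ v ∧ ¬ G.Adj u v) x.1 x.2 : ℝ) ≤
        pairCount part (fun u v => χ u = χ v ∧ G.Adj u v) x.1 x.2 := by
    intro x hx
    rw [mem_offDiag] at hx
    have h1 := hD.missing_le χ hx.2.2
    have h2 := hJ _ hx.1 _ hx.2.1
    have : (r : ℝ) * pairCount part (fun u v => ¬ χ u = χ v ∧ ¬ G.Adj u v) x.1 x.2 ≤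
        r * pairCount part (fun u v => χ u = χ v ∧ G.Adj u v) x.1 x.2 := by linarith
    exact le_of_mul_le_mul_left this (by linarith)
  have hsumInn : ∑ x ∈ J.offDiag,
      (pairCount part (fun u v => χ u = χ v ∧ G.Adj u v) x.1 x.2 : ℝ) = ∑ u ∈ VJ, inn u := by
    simp only [inn]
    exact_mod_cast sum_offDiag_pairCount part (fun u v => χ u = χ v ∧ G.Adj u v) J
  have hsumMis : ∑ x ∈ J.offDiag,
      (pairCount part (fun u v => ¬ χ u = χ v ∧ ¬ G.Adj u v) x.1 x.2 : ℝ) =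
        ∑ u ∈ VJ, mis u := by
    simp only [mis]
    exact_mod_cast sum_offDiag_pairCount part (fun u v => ¬ χ u = χ v ∧ ¬ G.Adj u v) J
  have hle : ∑ u ∈ VJ, mis u ≤ ∑ u ∈ VJ, inn u := by
    rw [← hsumInn, ← hsumMis]
    exact sum_le_sum hpair
  -- an edge inside of a colour class has an end at which many pairs are missing
  set τ : ℝ := (M / (2 * r) - 3 * B) / 2 with hτ
  have hτB : 4 * B < τ := by rw [hτ]; linarith
  have hedge : ∀ u ∈ VJ, ∀ v ∈ VJ, χ u = χ v → G.Adj u v → τ ≤ mis u ∨ τ ≤ mis v := by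
    intro u hu v hv hχ huv
    by_contra! hlt
    refine hG.false_of_missing hr hN0 hHr χ S (B / 2) (by linarith) hmiss huv (χ u) ?_ ?_
    · have h1 : #{v | part v ∈ J ∧ χ v = χ u} ≤ #{x ∈ S | χ x = χ u} + #(univ \ S) := by
        refine (card_le_card ?_).trans (card_union_le _ _)
        intro w hw
        have hw' : part w ∈ J ∧ χ w = χ u := by simpa using hw
        by_cases h : w ∈ S
        · exact mem_union_left _ (mem_filter.2 ⟨h, hw'.2⟩)
        · exact mem_union_right _ (by simpa using h)
      have h2 : (#{v | part v ∈ J ∧ χ v = χ u} : ℝ) ≤ #{x ∈ S | χ x = χ u} + #(univ \ S) := by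
        exact_mod_cast h1
      have := hcol (χ u)
      linarith
    · intro s hs
      let M₁ : Finset V := {w | part w ∈ J ∧ part w ≠ part u ∧ ¬ χ u = χ w ∧ ¬ G.Adj u w}
      let M₂ : Finset V := {w | part w ∈ J ∧ part w ≠ part v ∧ ¬ χ v = χ w ∧ ¬ G.Adj v w}
      have h1 : #{w | part w ∈ J ∧ χ w = s} ≤ #{x ∈ S | χ x = s ∧ G.Adj u x ∧ G.Adj v x} +
          (#(univ \ S) + ((#{w | part w = part u} + #{w | part w = part v}) + (#M₁ + #M₂))) := by
        have hsub : ({w | part w ∈ J ∧ χ w = s} : Finset V) ⊆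
            {x ∈ S | χ x = s ∧ G.Adj u x ∧ G.Adj v x} ∪ ((univ \ S) ∪
              ((({w | part w = part u} : Finset V) ∪ ({w | part w = part v} : Finset V)) ∪
              (M₁ ∪ M₂))) := by
          intro w hw
          have hw' : part w ∈ J ∧ χ w = s := by simpa using hw
          have h2 : ¬ χ u = s := fun h => hs h.symm
          have h3 : ¬ χ v = s := by rw [← hχ]; exact h2
          simp only [mem_union, mem_filter, mem_sdiff, mem_univ, true_and, M₁, M₂, h2, h3, hw'.1,
            hw'.2, not_false_eq_true]
          tauto
        refine (card_le_card hsub).trans ((card_union_le _ _).trans ?_)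
        refine Nat.add_le_add_left ((card_union_le _ _).trans ?_) _
        refine Nat.add_le_add_left ((card_union_le _ _).trans ?_) _
        exact Nat.add_le_add (card_union_le _ _) (card_union_le _ _)
      rw [hD.card_part, hD.card_part] at h1
      have h2 : (#{w | part w ∈ J ∧ χ w = s} : ℝ) ≤
          #{x ∈ S | χ x = s ∧ G.Adj u x ∧ G.Adj v x} +
          (#(univ \ S) + ((m + m) + (mis u + mis v))) := by
        rw [show mis u = #M₁ from rfl, show mis v = #M₂ from rfl]
        exact_mod_cast h1
      have h3 := hcol s
      linarith [hlt.1, hlt.2]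
  -- so the vertices of `A` meet all edges inside of the classes; if there are any, the few such edges
  -- at each vertex of `A` are outnumbered by the missing pairs
  set A : Finset V := {u ∈ VJ | τ ≤ mis u} with hA
  have hcover : ∑ u ∈ VJ, inn u ≤ 2 * ∑ u ∈ A, inn u := by
    let a : V → V → ℝ := fun u w => if part w ≠ part u ∧ χ u = χ w ∧ G.Adj u w then 1 else 0
    have ha0 : ∀ u w, 0 ≤ a u w := fun u w => by simp only [a]; split_ifs <;> norm_num
    have hasymm : ∀ u w, a u w = a w u := fun u w => by
      simp only [a, G.adj_comm u, eq_comm (a := χ u), ne_comm (a := part w)]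
    have hinna : ∀ u, inn u = ∑ w ∈ VJ, a u w := by
      intro u
      simp only [inn, a, VJ, sum_boole, filter_filter]
    have h1 : ∀ u ∈ VJ, ∀ w ∈ VJ, a u w ≤ (if τ ≤ mis u then a u w else 0) +
        (if τ ≤ mis w then a u w else 0) := by
      intro u hu w hw
      have := ha0 u w
      by_cases h : part w ≠ part u ∧ χ u = χ w ∧ G.Adj u w
      · rcases hedge u hu w hw h.2.1 h.2.2 with h' | h'
        · rw [if_pos h']
          split_ifs <;> linarith
        · rw [if_pos h']
          split_ifs <;> linarith
      · have : a u w = 0 := if_neg h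
        simp [this]
    have h2 : ∑ u ∈ VJ, inn u ≤ ∑ u ∈ VJ, ∑ w ∈ VJ, (if τ ≤ mis u then a u w else 0) +
        ∑ u ∈ VJ, ∑ w ∈ VJ, (if τ ≤ mis w then a u w else 0) := by
      simp only [hinna, ← sum_add_distrib]
      exact sum_le_sum fun u hu => sum_le_sum fun w hw => h1 u hu w hw
    have h3 : ∑ u ∈ VJ, ∑ w ∈ VJ, (if τ ≤ mis w then a u w else 0) =
        ∑ u ∈ VJ, ∑ w ∈ VJ, (if τ ≤ mis u then a u w else 0) := by
      rw [sum_comm]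
      simp only [hasymm]
    have h4 : ∑ u ∈ VJ, ∑ w ∈ VJ, (if τ ≤ mis u then a u w else 0) = ∑ u ∈ A, inn u := by
      rw [show ∑ u ∈ A, inn u = ∑ u ∈ VJ, if τ ≤ mis u then inn u else 0 from sum_filter _ _]
      refine sum_congr rfl fun u _ => ?_
      rw [hinna]
      split_ifs <;> simp
    rw [h3, h4] at h2
    linarith
  have hAempty : A = ∅ := by
    by_contra hne
    have hpos : (0 : ℝ) < #A := by
      exact_mod_cast card_pos.2 (nonempty_iff_ne_empty.2 hne)
    have h1 : #A * τ ≤ ∑ u ∈ VJ, mis u := by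
      rw [← nsmul_eq_mul]
      exact (card_nsmul_le_sum _ _ _ fun u hu => (mem_filter.1 hu).2).trans
        (sum_le_sum_of_subset_of_nonneg (filter_subset _ _) fun u _ _ => hmis0 u)
    have h2 : ∑ u ∈ A, inn u ≤ #A * (2 * B) := by
      rw [← nsmul_eq_mul]
      exact sum_le_card_nsmul _ _ _ fun u _ => hinn u
    have h3 : #A * (4 * B) < #A * τ := mul_lt_mul_of_pos_left hτB hpos
    linarith
  have hinn0 : ∑ u ∈ VJ, inn u ≤ 0 := by
    rw [hAempty] at hcover
    simpa using hcover
  have hinnz : ∑ u ∈ VJ, inn u = 0 :=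
    le_antisymm hinn0 (sum_nonneg fun u _ => Nat.cast_nonneg _)
  have hmisz : ∑ u ∈ VJ, mis u = 0 :=
    le_antisymm (hle.trans hinn0) (sum_nonneg fun u _ => hmis0 u)
  refine ⟨fun u v hu hv huv => ⟨fun h hχ => ?_, fun hχ => ?_⟩, fun i hi j hj hij => ?_⟩
  · have h1 := (sum_eq_zero_iff_of_nonneg fun u _ => Nat.cast_nonneg _).1 hinnz u ((hVJ u).2 hu)
    have h2 : #{w | part w ∈ J ∧ part w ≠ part u ∧ χ u = χ w ∧ G.Adj u w} = 0 :=
      Nat.cast_eq_zero.1 h1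
    have h3 : v ∈ ({w | part w ∈ J ∧ part w ≠ part u ∧ χ u = χ w ∧ G.Adj u w} : Finset V) := by
      simp [hv, huv.symm, hχ, h]
    rw [card_eq_zero.1 h2] at h3
    exact notMem_empty _ h3
  · by_contra h
    have h1 := (sum_eq_zero_iff_of_nonneg fun u _ => hmis0 u).1 hmisz u ((hVJ u).2 hu)
    have h2 : #{w | part w ∈ J ∧ part w ≠ part u ∧ ¬ χ u = χ w ∧ ¬ G.Adj u w} = 0 :=
      Nat.cast_eq_zero.1 h1
    have h3 : v ∈ ({w | part w ∈ J ∧ part w ≠ part u ∧ ¬ χ u = χ w ∧ ¬ G.Adj u w} : Finset V) := by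
      simp [hv, huv.symm, hχ, h]
    rw [card_eq_zero.1 h2] at h3
    exact notMem_empty _ h3
  · have h3 := (sum_eq_zero_iff_of_nonneg fun x _ => Nat.cast_nonneg _).1
      (hsumInn.trans hinnz) (i, j)
      (mem_offDiag.2 ⟨hi, hj, hij⟩)
    have h4 := hD.missing_le χ hij
    simp only at h3
    rw [h3] at h4
    have : (0 : ℝ) ≤ r * pairCount part (fun u v => ¬ χ u = χ v ∧ ¬ G.Adj u v) i j := by
      positivity
    linarith

end Exact

/-! ### Propagating the colouring -/

section ProperColoring

open Finset

variable {V : Type*} [Fintype V]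

/-- There is a large family of parts which have all colours equally often and on which `G` is exactly
complete `r`-partite: among the parts with the most popular order of colours, all but at most one
are like this. -/
theorem JointFree.exists_balanced_family {G : SimpleGraph V} {r H N m ℓ : ℕ} {part : V → Fin ℓ}
    (hG : JointFree G r H N) (hD : IsDenseMultipartite G r m part) (hr : 2 ≤ r)
    (hHr : (2 * r + 1) * 2 ^ r ≤ H) (hN0 : 0 < N) (B : ℝ) (hNB : 4 * N ≤ B) (hmB : 2 * m ≤ B)
    (S : Finset V) (χ : V → Fin r) (hS : open Classical in (#(univ \ S) : ℝ) ≤ B)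
    (hmiss : 8 * r * ∑ x ∈ S, (missing G χ S x : ℝ) ≤ (B / 2) ^ 2)
    (hin : ∀ u, open Classical in (#{w | χ w = χ u ∧ G.Adj u w} : ℝ) ≤ 2 * B)
    (hM : r ! * (16 * (r : ℝ) ^ 2 * B) ≤ ℓ * m) :
    ∃ J : Finset (Fin ℓ), 15 * (r : ℝ) ^ 2 * B ≤ #J * m ∧
      (∀ u v, part u ∈ J → part v ∈ J → part u ≠ part v → (G.Adj u v ↔ χ u ≠ χ v)) ∧
      ∀ i ∈ J, ∀ s, r * colorCount part χ i s = m := by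
  classical
  have hr0 : (2 : ℝ) ≤ r := by exact_mod_cast hr
  have hB0 : 0 ≤ B := le_trans (by positivity) hmB
  let f : Fin ℓ → Equiv.Perm (Fin r) := fun i => Tuple.sort (colorCount part χ i)
  obtain ⟨σ, -, hσ⟩ := exists_le_of_sum_le (s := (univ : Finset (Equiv.Perm (Fin r))))
    (f := fun _ => (ℓ : ℝ)) (g := fun σ => r ! * (#{i | f i = σ} : ℝ)) univ_nonempty (by
      rw [sum_const, card_univ, Fintype.card_perm, Fintype.card_fin, nsmul_eq_mul, ← mul_sum]
      refine mul_le_mul_of_nonneg_left (le_of_eq ?_) (by positivity)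
      have := card_eq_sum_card_fiberwise (f := f) (s := univ) (t := univ) fun _ _ => mem_univ _
      rw [card_univ, Fintype.card_fin] at this
      exact_mod_cast this)
  set J : Finset (Fin ℓ) := {i | f i = σ}
  have hJM : 16 * (r : ℝ) ^ 2 * B ≤ #J * m := by
    have h1 : (ℓ : ℝ) * m ≤ r ! * #J * m := mul_le_mul_of_nonneg_right hσ (Nat.cast_nonneg _)
    have h2 : (0 : ℝ) < r ! := by exact_mod_cast Nat.factorial_pos r
    exact le_of_mul_le_mul_left (by linarith) h2
  have hcm : ∀ i, ∑ s, (colorCount part χ i s : ℝ) = m := fun i => by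
    exact_mod_cast (sum_colorCount part χ i).trans (hD.card_part i)
  have hcheb : ∀ i ∈ J, ∀ j ∈ J, _ := fun i hi j hj =>
    chebyshev_of_sort_eq (colorCount part χ i) (colorCount part χ j)
      ((mem_filter.1 hi).2.trans (mem_filter.1 hj).2.symm)
  simp only [hcm, ← sq] at hcheb
  obtain ⟨hexact, hle⟩ := hG.exact_of_chebyshev hD hr hHr hN0 B hNB hmB S χ hS hmiss hin J hJM
    fun i hi j hj => (hcheb i hi j hj).1
  refine ⟨{i ∈ J | ∀ s t, colorCount part χ i s = colorCount part χ i t}, ?_, ?_, ?_⟩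
  · have h1 : #{i ∈ J | ¬ ∀ s t, colorCount part χ i s = colorCount part χ i t} ≤ 1 := by
      refine card_le_one.2 fun i hi j hj => ?_
      obtain ⟨hi, hi'⟩ := mem_filter.1 hi
      obtain ⟨hj, hj'⟩ := mem_filter.1 hj
      by_contra hij
      rcases (hcheb i hi j hj).2 (hle i hi j hj hij) with h | h
      exacts [hi' h, hj' h]
    have h2 := card_filter_add_card_filter_not (s := J)
      (fun i => ∀ s t, colorCount part χ i s = colorCount part χ i t)
    have h3 : (#J : ℝ) ≤ #{i ∈ J | ∀ s t, colorCount part χ i s = colorCount part χ i t} + 1 := by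
      exact_mod_cast h2.symm.le.trans (Nat.add_le_add_left h1 _)
    have h4 := mul_le_mul_of_nonneg_right h3 (Nat.cast_nonneg m)
    have h5 : B ≤ (r : ℝ) ^ 2 * B := le_mul_of_one_le_left hB0 (one_le_pow₀ (by linarith))
    linarith
  · exact fun u v hu hv => hexact u v (mem_filter.1 hu).1 (mem_filter.1 hv).1
  · intro i hi s
    have h1 := sum_colorCount part χ i
    rw [hD.card_part, sum_congr rfl fun t _ => (mem_filter.1 hi).2 t s] at h1
    simpa using h1

open Classical in
/-- A large family of parts on which `G` is exactly complete `r`-partite with equal classes forces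
`G` to be `r`-partite: each vertex outside has to be joined to all classes but one of the family, in
order that the densities are attained. -/
theorem JointFree.exists_proper {G : SimpleGraph V} {r H N m ℓ : ℕ} {part : V → Fin ℓ}
    (hG : JointFree G r H N) (hD : IsDenseMultipartite G r m part) (hr : 2 ≤ r)
    (hHr : (2 * r + 1) * 2 ^ r ≤ H) (hN0 : 0 < N) (B : ℝ) (hNB : 4 * N ≤ B) (hmB : 2 * m ≤ B)
    (hmn : 8 * r * (Fintype.card V * m : ℝ) ≤ (B / 2) ^ 2)
    (χ : V → Fin r) (J : Finset (Fin ℓ)) (hM : 15 * (r : ℝ) ^ 2 * B ≤ #J * m)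
    (hexact : ∀ u v, part u ∈ J → part v ∈ J → part u ≠ part v → (G.Adj u v ↔ χ u ≠ χ v))
    (hconst : ∀ i ∈ J, ∀ s, r * colorCount part χ i s = m) :
    ∃ g : V → Fin r, ∀ u v, G.Adj u v → g u ≠ g v := by
  have hr0 : (2 : ℝ) ≤ r := by exact_mod_cast hr
  have hB0 : 0 < B := lt_of_lt_of_le (by positivity) hNB
  have hm0 : (0 : ℝ) ≤ m := Nat.cast_nonneg _
  let S : Finset V := {v | part v ∈ J}
  have hSmem : ∀ v, v ∈ S ↔ part v ∈ J := fun v => by simp [S]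
  have hmiss : 8 * r * ∑ x ∈ S, (missing G χ S x : ℝ) ≤ (B / 2) ^ 2 := by
    refine le_trans (mul_le_mul_of_nonneg_left ?_ (by positivity)) hmn
    have : ∀ x ∈ S, (missing G χ S x : ℝ) ≤ m := by
      intro x hx
      have h1 : missing G χ S x ≤ #{w | part w = part x} := by
        refine card_le_card fun w hw => ?_
        obtain ⟨hw1, hw2, hw3⟩ := mem_filter.1 hw
        refine mem_filter.2 ⟨mem_univ _, ?_⟩
        by_contra hne
        exact hw3 ((hexact x w ((hSmem x).1 hx) ((hSmem w).1 hw1) (Ne.symm hne)).2 hw2)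
      rw [hD.card_part] at h1
      exact_mod_cast h1
    refine (sum_le_card_nsmul _ _ _ this).trans ?_
    rw [nsmul_eq_mul]
    exact mul_le_mul_of_nonneg_right (by exact_mod_cast card_le_univ S) hm0
  -- the sizes of the colour classes
  have hclass : ∀ J' ⊆ J, ∀ s, (#{w | part w ∈ J' ∧ χ w = s} : ℝ) = #J' * m / r := by
    intro J' hJ' s
    rw [eq_div_iff (by positivity), card_color_eq_sum, mul_comm]
    have : r * ∑ j ∈ J', colorCount part χ j s = #J' * m := by
      rw [mul_sum, sum_congr rfl fun j hj => hconst j (hJ' hj) s, sum_const, smul_eq_mul]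
    exact_mod_cast this
  have hJr : 30 * B ≤ #J * m / r := by
    rw [le_div_iff₀ (by positivity)]
    have : r * B * 2 ≤ r * B * r := by gcongr
    linarith
  have hclassS : ∀ s, B / 2 ≤ #{x ∈ S | χ x = s} := by
    intro s
    have h1 := hclass J subset_rfl s
    rw [show ({x ∈ S | χ x = s} : Finset V) = ({w | part w ∈ J ∧ χ w = s} : Finset V) from
      filter_filter _ _ _, h1]
    linarith
  -- `κ i` is the size of the colour classes of the family without part `i`
  let κ : Fin ℓ → ℝ := fun i => #(J.erase i) * m / r
  have hκ : ∀ i, 2 * B < κ i := by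
    intro i
    have h1 : (#J : ℝ) ≤ #(J.erase i) + 1 := by
      exact_mod_cast Nat.sub_le_iff_le_add.1 (pred_card_le_card_erase (s := J) (a := i))
    have h2 : (#J : ℝ) * m / r ≤ κ i + m / r := by
      simp only [κ]
      rw [← add_div]
      gcongr
      linarith [mul_le_mul_of_nonneg_right h1 hm0]
    have h3 : m / (r : ℝ) ≤ m := div_le_self hm0 (by linarith)
    linarith
  have hκcard : ∀ i s, (#{w ∈ S | χ w = s ∧ part w ≠ i} : ℝ) = κ i := by
    intro i s
    rw [show κ i = _ from (hclass _ (erase_subset i J) s).symm]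
    congr 2
    ext w
    simp only [mem_filter, mem_univ, true_and, hSmem, mem_erase]
    tauto
  have hcard_le : ∀ u s, (#{w ∈ S | χ w = s ∧ G.Adj u w} : ℝ) ≤ κ (part u) := by
    intro u s
    rw [← hκcard _ s]
    refine Nat.cast_le.2 (card_le_card (monotone_filter_right _ ?_))
    exact fun w _ h => ⟨h.1, (hD.part_ne u w h.2).symm⟩
  have hdegsum : ∀ u, (degIn G S u : ℝ) = ∑ s, (#{w ∈ S | χ w = s ∧ G.Adj u w} : ℝ) := by
    intro u
    have : degIn G S u = ∑ s, #{w ∈ S | χ w = s ∧ G.Adj u w} := by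
      rw [degIn, card_eq_sum_card_fiberwise (f := χ) (t := univ) fun _ _ => mem_univ _]
      refine sum_congr rfl fun s _ => ?_
      rw [filter_filter]
      simp only [and_comm]
    exact_mod_cast this
  have hsum_le : ∀ u s₀, ∑ s ∈ univ.erase s₀, (#{w ∈ S | χ w = s ∧ G.Adj u w} : ℝ) ≤
      (r - 1) * κ (part u) := by
    intro u s₀
    refine (sum_le_card_nsmul _ _ _ fun s _ => hcard_le u s).trans (le_of_eq ?_)
    rw [card_erase_of_mem (mem_univ _), card_univ, Fintype.card_fin, nsmul_eq_mul,
      Nat.cast_pred (by omega)]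
  -- a vertex with neighbours in all classes has too small a degree
  have hlt : ∀ u, (∀ s, ∃ w ∈ S, χ w = s ∧ G.Adj u w) →
      (degIn G S u : ℝ) < (r - 1) * κ (part u) := by
    intro u hu
    obtain ⟨s₀, -, hs₀⟩ := exists_min_image (univ : Finset (Fin r))
      (fun s => (#{w ∈ S | χ w = s ∧ G.Adj u w} : ℝ)) ⟨⟨0, by omega⟩, mem_univ _⟩
    obtain ⟨v, hvS, hvχ, huv⟩ := hu s₀
    obtain ⟨s₁, hs₁, hs₁B⟩ : ∃ s ≠ s₀, (#{w ∈ S | χ w = s ∧ G.Adj u w} : ℝ) < B := by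
      by_contra! hge
      refine hG.false_of_missing hr hN0 hHr χ S (B / 2) (by linarith) hmiss huv s₀ (hclassS s₀) ?_
      intro s hs
      have h1 : #{w ∈ S | χ w = s ∧ G.Adj u w} ≤
          #{x ∈ S | χ x = s ∧ G.Adj u x ∧ G.Adj v x} + #{w | part w = part v} := by
        refine (card_le_card ?_).trans (card_union_le _ _)
        intro w hw
        obtain ⟨hw1, hw2, hw3⟩ := mem_filter.1 hw
        by_cases h : part w = part v
        · exact mem_union_right _ (by simpa using h)
        · refine mem_union_left _ (mem_filter.2 ⟨hw1, hw2, hw3, ?_⟩)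
          refine (hexact v w ((hSmem v).1 hvS) ((hSmem w).1 hw1) (Ne.symm h)).2 ?_
          rw [hvχ, hw2]
          exact hs.symm
      rw [hD.card_part] at h1
      have h2 : (#{w ∈ S | χ w = s ∧ G.Adj u w} : ℝ) ≤
          #{x ∈ S | χ x = s ∧ G.Adj u x ∧ G.Adj v x} + m := by exact_mod_cast h1
      linarith [hge s hs]
    have h1 := hs₀ s₁ (mem_univ _)
    rw [hdegsum, ← add_sum_erase _ _ (mem_univ s₀),
      ← add_sum_erase _ _ (mem_erase.2 ⟨hs₁, mem_univ s₁⟩)]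
    have h2 : ∑ s ∈ (univ.erase s₀).erase s₁, (#{w ∈ S | χ w = s ∧ G.Adj u w} : ℝ) ≤
        (r - 2) * κ (part u) := by
      refine (sum_le_card_nsmul _ _ _ fun s _ => hcard_le u s).trans (le_of_eq ?_)
      rw [card_erase_of_mem (mem_erase.2 ⟨hs₁, mem_univ s₁⟩), card_erase_of_mem (mem_univ _),
        card_univ, Fintype.card_fin, nsmul_eq_mul, Nat.sub_sub, Nat.cast_sub hr]
      norm_num
    have h3 := hκ (part u)
    linarith
  have hle : ∀ u, (degIn G S u : ℝ) ≤ (r - 1) * κ (part u) := by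
    intro u
    by_cases hu : ∀ s, ∃ w ∈ S, χ w = s ∧ G.Adj u w
    · exact (hlt u hu).le
    · push Not at hu
      obtain ⟨s₀, hs₀⟩ := hu
      rw [hdegsum, ← add_sum_erase _ _ (mem_univ s₀),
        filter_eq_empty_iff.2 fun w hw h => hs₀ w hw h.1 h.2]
      simpa using hsum_le u s₀
  -- the densities between the part of `u` and the family are attained, hence so is the maximal degree
  have hdeg : ∀ u, (degIn G S u : ℝ) = (r - 1) * κ (part u) := by
    intro u
    set i := part u with hi
    have h1 : ∑ v with part v = i, (degIn G S v : ℝ) = ∑ j ∈ J, (pairCount part G.Adj i j : ℝ) := by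
      have h2 := sum_pairCount part G.Adj i J
      have h3 : ∀ v, degIn G S v = #{w | part w ∈ J ∧ G.Adj v w} := fun v => by
        rw [degIn, filter_filter]
      simp only [h3]
      exact_mod_cast h2.symm
    have h2 : ∑ v with part v = i, (r - 1) * κ i ≤ ∑ v with part v = i, (degIn G S v : ℝ) := by
      rw [h1, sum_const, hD.card_part, nsmul_eq_mul]
      refine le_trans ?_ (sum_le_sum_of_subset_of_nonneg (erase_subset i J)
        fun _ _ _ => Nat.cast_nonneg _)
      have h3 : ∀ j ∈ J.erase i, ((r : ℝ) - 1) * m ^ 2 / r ≤ pairCount part G.Adj i j := by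
        intro j hj
        rw [div_le_iff₀ (by positivity)]
        linarith [hD.dense i j (ne_of_mem_erase hj).symm]
      refine le_trans (le_of_eq ?_) (card_nsmul_le_sum _ _ _ h3)
      rw [nsmul_eq_mul]
      simp only [κ]
      ring
    have h3 : ∀ v ∈ ({v | part v = i} : Finset V), (degIn G S v : ℝ) ≤ (r - 1) * κ i := by
      intro v hv
      have := hle v
      rwa [(mem_filter.1 hv).2] at this
    exact (sum_eq_sum_iff_of_le h3).1 (le_antisymm (sum_le_sum h3) h2) u (by simp [hi])
  have hchoice : ∀ u, ∃ s, ∀ w ∈ S, χ w ≠ s → part w ≠ part u → G.Adj u w := by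
    intro u
    by_cases hu : ∀ s, ∃ w ∈ S, χ w = s ∧ G.Adj u w
    · exact absurd (hdeg u) (hlt u hu).ne
    push Not at hu
    obtain ⟨s₀, hs₀⟩ := hu
    refine ⟨s₀, fun w hw hwχ hwu => ?_⟩
    have h1 := hdeg u
    rw [hdegsum, ← add_sum_erase _ _ (mem_univ s₀),
      filter_eq_empty_iff.2 fun w hw h => hs₀ w hw h.1 h.2] at h1
    simp only [card_empty, Nat.cast_zero, zero_add] at h1
    have h2 : ∑ s ∈ univ.erase s₀, κ (part u) = (r - 1) * κ (part u) := by
      rw [sum_const, card_erase_of_mem (mem_univ _), card_univ, Fintype.card_fin, nsmul_eq_mul,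
        Nat.cast_pred (by omega)]
    have h3 := (sum_eq_sum_iff_of_le fun s _ => hcard_le u s).1 (h1.trans h2.symm) (χ w)
      (mem_erase.2 ⟨hwχ, mem_univ _⟩)
    rw [← hκcard _ (χ w)] at h3
    have h4 := eq_of_subset_of_card_le (s := {x ∈ S | χ x = χ w ∧ G.Adj u x})
      (t := {x ∈ S | χ x = χ w ∧ part x ≠ part u})
      (monotone_filter_right _ fun x _ h => ⟨h.1, (hD.part_ne u x h.2).symm⟩)
      (by exact_mod_cast h3.ge)
    have h5 : w ∈ ({x ∈ S | χ x = χ w ∧ part x ≠ part u} : Finset V) :=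
      mem_filter.2 ⟨hw, rfl, hwu⟩
    rw [← h4] at h5
    exact (mem_filter.1 h5).2.2
  -- vertices of the same new colour are joined to nearly all vertices of all other colours of the
  -- family, so that an edge between them would be a joint
  choose g hg using hchoice
  refine ⟨g, fun u v huv hguv => ?_⟩
  refine hG.false_of_missing hr hN0 hHr χ S (B / 2) (by linarith) hmiss huv (g u) (hclassS _) ?_
  intro s hs
  have h1 : #{w ∈ S | χ w = s ∧ part w ≠ part u} ≤
      #{x ∈ S | χ x = s ∧ G.Adj u x ∧ G.Adj v x} + #{w | part w = part v} := by
    refine (card_le_card ?_).trans (card_union_le _ _)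
    intro w hw
    obtain ⟨hw1, hw2, hw3⟩ := mem_filter.1 hw
    by_cases h : part w = part v
    · exact mem_union_right _ (by simpa using h)
    · refine mem_union_left _ (mem_filter.2 ⟨hw1, hw2, hg u w hw1 ?_ hw3, hg v w hw1 ?_ h⟩)
      · rwa [hw2]
      · rwa [hw2, ← hguv]
  rw [hD.card_part] at h1
  have h2 : (#{w ∈ S | χ w = s ∧ part w ≠ part u} : ℝ) ≤
      #{x ∈ S | χ x = s ∧ G.Adj u x ∧ G.Adj v x} + m := by exact_mod_cast h1
  rw [hκcard] at h2
  linarith [hκ (part u)]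

end ProperColoring

/-! ### Properly coloured graphs and the family of Pfender -/

section Pfender

open Finset

variable {V : Type*} [Fintype V]

theorem pairCount_eq_zero_iff {ℓ : ℕ} (part : V → Fin ℓ) (Q : V → V → Prop) (i j : Fin ℓ) :
    pairCount part Q i j = 0 ↔ ∀ u v, part u = i → part v = j → ¬ Q u v := by
  classical
  simp only [pairCount, card_eq_zero, filter_eq_empty_iff, mem_univ, true_imp_iff, Prod.forall,
    not_and]

/-- In a properly coloured graph, two parts with the same order of colours cannot both have an
uneven distribution of colours. -/
theorem IsDenseMultipartite.const_or_const {G : SimpleGraph V} {r m ℓ : ℕ} {part : V → Fin ℓ}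
    (hD : IsDenseMultipartite G r m part) {g : V → Fin r} (hg : ∀ u v, G.Adj u v → g u ≠ g v)
    {i j : Fin ℓ} (hij : i ≠ j)
    (hsort : Tuple.sort (colorCount part g i) = Tuple.sort (colorCount part g j)) :
    (∀ s t, colorCount part g i s = colorCount part g i t) ∨
      ∀ s t, colorCount part g j s = colorCount part g j t := by
  have hcm : ∀ i, ∑ s, (colorCount part g i s : ℝ) = m := fun i => by
    exact_mod_cast (sum_colorCount part g i).trans (hD.card_part i)
  refine (chebyshev_of_sort_eq _ _ hsort).2 ?_
  have h1 := hD.missing_le g hij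
  have h2 : pairCount part (fun u v => g u = g v ∧ G.Adj u v) i j = 0 := by
    rw [pairCount_eq_zero_iff]
    exact fun x y _ _ h => hg _ _ h.2 h.1
  have h3 : (0 : ℝ) ≤ r * pairCount part (fun u v => ¬ g u = g v ∧ ¬ G.Adj u v) i j := by
    positivity
  rw [h2] at h1
  simp only [hcm, Nat.cast_zero, mul_zero, add_zero] at h1 ⊢
  linarith [sq (m : ℝ)]

/-- In a properly coloured graph, a part with an even distribution of colours is completely joined
to the vertices of other colours in the other parts. -/
theorem IsDenseMultipartite.adj_of_const {G : SimpleGraph V} {r m ℓ : ℕ} {part : V → Fin ℓ}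
    (hD : IsDenseMultipartite G r m part) {g : V → Fin r} (hg : ∀ u v, G.Adj u v → g u ≠ g v)
    {u v : V} (huv : part u ≠ part v) (hguv : g u ≠ g v)
    (hconst : ∀ s t, colorCount part g (part u) s = colorCount part g (part u) t) :
    G.Adj u v := by
  have hr : (0 : ℝ) < r := by exact_mod_cast (g u).pos
  have hcm : ∀ i, ∑ s, (colorCount part g i s : ℝ) = m := fun i => by
    exact_mod_cast (sum_colorCount part g i).trans (hD.card_part i)
  have h1 := hD.missing_le g huv
  have h2 : pairCount part (fun u v => g u = g v ∧ G.Adj u v) (part u) (part v) = 0 := by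
    rw [pairCount_eq_zero_iff]
    exact fun x y _ _ h => hg _ _ h.2 h.1
  have h3 : ∀ s, r * (colorCount part g (part u) s : ℝ) = m := by
    intro s
    rw [← hcm (part u), sum_congr rfl fun t _ => congrArg Nat.cast (hconst t s)]
    simp
  have h4 : r * ∑ s, (colorCount part g (part u) s : ℝ) * colorCount part g (part v) s =
      m ^ 2 := by
    rw [mul_sum]
    simp only [← mul_assoc, h3]
    rw [← mul_sum, hcm, sq]
  rw [h2, h4] at h1
  have h5 : r * (pairCount part (fun u v => ¬ g u = g v ∧ ¬ G.Adj u v) (part u) (part v) : ℝ) ≤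
      r * 0 := by simpa using h1
  have h6 := le_of_mul_le_mul_left h5 hr
  have h7 : pairCount part (fun u v => ¬ g u = g v ∧ ¬ G.Adj u v) (part u) (part v) = 0 := by
    exact_mod_cast le_antisymm h6 (Nat.cast_nonneg _)
  by_contra h
  exact (pairCount_eq_zero_iff _ _ _ _).1 h7 u v rfl rfl ⟨hguv, h⟩

/-- An enumeration `π` of all permutations and a renumbering `τ` of the index set such that the
functions `c i` with numbers below `r!` are sorted by `π`, and all others are constant. This is
possible if functions with the same sorting permutation are all constant but one. -/
theorem exists_renumbering {r ℓ : ℕ} (hℓ : r ! ≤ ℓ) (c : Fin ℓ → Fin r → ℕ)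
    (hc : ∀ i j, i ≠ j → Tuple.sort (c i) = Tuple.sort (c j) →
      (∀ s t, c i s = c i t) ∨ ∀ s t, c j s = c j t) :
    ∃ (τ : Equiv.Perm (Fin ℓ)) (π : Fin (r !) ≃ Equiv.Perm (Fin r)),
      (∀ (i : Fin ℓ) (hi : (i : ℕ) < r !), Antitone (c (τ i) ∘ π ⟨i, hi⟩)) ∧
      ∀ i : Fin ℓ, r ! ≤ (i : ℕ) → ∀ s t, c (τ i) s = c (τ i) t := by
  classical
  have : Nonempty (Fin ℓ) := ⟨⟨0, (Nat.factorial_pos r).trans_le hℓ⟩⟩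
  -- the non-constant functions have distinct sorting permutations `σ i`; `h` extends the inverse of `σ`
  -- to a bijection of all permutations onto a set `t ⊇ I`, whose members are numbered first
  let I : Finset (Fin ℓ) := {i | ¬ ∀ s t, c i s = c i t}
  have hI : ∀ i, i ∉ I → ∀ s t, c i s = c i t := fun i hi => by
    by_contra h
    exact hi (mem_filter.2 ⟨mem_univ _, h⟩)
  -- `Tuple.sort` sorts increasingly, so that the order has to be reversed
  let σ : Fin ℓ → Equiv.Perm (Fin r) := fun i => Fin.revPerm.trans (Tuple.sort (c i))
  have hσ : ∀ i, Antitone (c i ∘ σ i) := fun i =>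
    (Tuple.monotone_sort (c i)).comp_antitone Fin.rev_anti
  have hσinj : Set.InjOn σ I := by
    intro i hi j hj hij
    by_contra hne
    have hsort : Tuple.sort (c i) = Tuple.sort (c j) := by
      ext s
      have := congrArg (fun e : Equiv.Perm (Fin r) => e (Fin.rev s)) hij
      simpa [σ] using congrArg Fin.val this
    rcases hc i j hne hsort with h | h
    exacts [(mem_filter.1 hi).2 h, (mem_filter.1 hj).2 h]
  have hcardP : Fintype.card (Equiv.Perm (Fin r)) = r ! := by
    rw [Fintype.card_perm, Fintype.card_fin]
  have hIcard : #I ≤ r ! := by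
    rw [← hcardP]
    exact card_le_card_of_injOn σ (fun _ _ => mem_univ _) hσinj
  obtain ⟨t, hIt, ht⟩ := exists_superset_card_eq hIcard (by simpa using hℓ)
  have hinv : ∀ i ∈ I, Function.invFunOn σ I (σ i) = i := fun i hi =>
    hσinj.leftInvOn_invFunOn hi
  obtain ⟨h, hh⟩ := exists_equiv_extend_of_card_eq (α := Equiv.Perm (Fin r)) (t := t)
    (hcardP.trans ht.symm) (s := I.image σ) (f := Function.invFunOn σ I) (by
      intro i hi
      simp only [mem_image] at hi
      obtain ⟨_, ⟨j, hj, rfl⟩, rfl⟩ := hi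
      rw [hinv j hj]
      exact hIt hj) (by
      intro p hp q hq hpq
      simp only [coe_image, Set.mem_image, mem_coe] at hp hq
      obtain ⟨i, hi, rfl⟩ := hp
      obtain ⟨j, hj, rfl⟩ := hq
      rw [hinv i hi, hinv j hj] at hpq
      rw [hpq])
  let π : Fin (r !) ≃ Equiv.Perm (Fin r) := (Fintype.equivFinOfCardEq hcardP).symm
  let f : Fin ℓ → Fin ℓ := fun i => if hi : (i : ℕ) < r ! then h (π ⟨i, hi⟩) else i
  have hf : ∀ (i : Fin ℓ) (hi : (i : ℕ) < r !), f i = h (π ⟨i, hi⟩) := fun i hi => dif_pos hi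
  obtain ⟨τ₀, hτ₀⟩ := exists_equiv_extend_of_card_eq (α := Fin ℓ) (t := (univ : Finset (Fin ℓ)))
    (by simp) (s := {i : Fin ℓ | (i : ℕ) < r !}) (f := f) (subset_univ _) (by
      intro i hi j hj hij
      have hi' : (i : ℕ) < r ! := by simpa using hi
      have hj' : (j : ℕ) < r ! := by simpa using hj
      rw [hf i hi', hf j hj'] at hij
      have := π.injective (h.injective (Subtype.ext hij))
      exact Fin.ext (Fin.mk.inj this))
  let τ : Equiv.Perm (Fin ℓ) := τ₀.trans (Equiv.subtypeUnivEquiv mem_univ)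
  have hτ : ∀ (i : Fin ℓ) (hi : (i : ℕ) < r !), τ i = h (π ⟨i, hi⟩) := fun i hi => by
    rw [← hf i hi]
    exact hτ₀ i (by simpa using hi)
  refine ⟨τ, π, fun i hi => ?_, fun i hi => ?_⟩
  · rw [hτ i hi]
    set p := π ⟨i, hi⟩
    by_cases hp : (h p : Fin ℓ) ∈ I
    · have h1 := hh (σ (h p)) (mem_image_of_mem _ hp)
      rw [hinv _ hp] at h1
      have h2 : σ (h p) = p := h.injective (Subtype.ext h1)
      have h3 := hσ (h p)
      rwa [h2] at h3
    · exact fun s t _ => (hI _ hp _ _).le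
  · refine hI _ fun hiI => ?_
    let p := h.symm ⟨τ i, hIt hiI⟩
    let j : Fin ℓ := ⟨π.symm p, (π.symm p).2.trans_le hℓ⟩
    have h1 : τ j = τ i := by
      rw [hτ j (π.symm p).2]
      simp [j, p]
    have h2 := congrArg Fin.val (τ.injective h1)
    have h3 : (j : ℕ) < r ! := (π.symm p).2
    omega

/-- A graph with the required densities and a proper `(k - 1)`-colouring is one of Pfender's graphs. -/
theorem IsDenseMultipartite.isoToPfenderFamily {k m ℓ : ℕ} {G : SimpleGraph V} {part : V → Fin ℓ}
    (hD : IsDenseMultipartite G (k - 1) m part) (hk : 3 ≤ k) (hm : 0 < m) (hℓ : (k - 1)! ≤ ℓ)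
    {g : V → Fin (k - 1)} (hg : ∀ u v, G.Adj u v → g u ≠ g v) : IsoToPfenderFamily k ℓ G := by
  classical
  obtain ⟨τ, π, hsorted, hconst⟩ := exists_renumbering hℓ (colorCount part g)
    fun i j hij h => hD.const_or_const hg hij h
  have hsum : ∀ i, ∑ s, colorCount part g i s = m := fun i =>
    (sum_colorCount part g i).trans (hD.card_part i)
  -- the vertices are numbered within each pair of a part and a colour
  let E : V ≃ PfenderVertex k ℓ fun i => colorCount part g (τ i) :=
    (Equiv.sigmaFiberEquiv fun v => τ.symm (part v)).symm.trans
      (Equiv.sigmaCongrRight fun i =>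
        (Equiv.sigmaFiberEquiv fun v : {v // τ.symm (part v) = i} => g v).symm.trans
          (Equiv.sigmaCongrRight fun s => Fintype.equivFinOfCardEq (by
            change _ = #{v | part v = τ i ∧ g v = s}
            rw [← Fintype.card_subtype]
            refine Fintype.card_congr ((Equiv.subtypeSubtypeEquivSubtypeInter
              (fun v => τ.symm (part v) = i) (fun v => g v = s)).trans
              (Equiv.subtypeEquivRight fun v => ?_))
            rw [Equiv.symm_apply_eq])))
  have hE1 : ∀ v, (E v).1 = τ.symm (part v) := fun v => rfl
  have hE2 : ∀ v, (E v).2.1 = g v := fun v => rfl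
  refine ⟨fun i => colorCount part g (τ i), ⟨hk, hℓ, ⟨π, fun i hi s s' hs => hsorted i hi hs⟩,
    fun i hi s s' => ⟨hconst i hi s s', ?_⟩, fun i => by rw [hsum]; exact hm⟩,
    G.comap E.symm, ⟨?_, ?_⟩, ⟨⟨E, by simp⟩⟩⟩
  · refine Nat.pos_of_ne_zero fun h0 => ?_
    have := hsum (τ i)
    rw [sum_congr rfl fun t _ => (hconst i hi t s).trans h0] at this
    simp at this
    omega
  · intro x y hxy
    obtain ⟨u, rfl⟩ := E.surjective x
    obtain ⟨v, rfl⟩ := E.surjective y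
    have huv : G.Adj u v := by simpa using hxy
    refine ⟨?_, ?_⟩
    · rw [hE1, hE1]
      exact fun h => hD.part_ne u v huv (τ.symm.injective h)
    · rw [hE2, hE2]
      exact hg u v huv
  · intro x y hxy hnot
    obtain ⟨u, rfl⟩ := E.surjective x
    obtain ⟨v, rfl⟩ := E.surjective y
    have huv : ¬ G.Adj u v := by simpa using hnot
    have h1 : part u ≠ part v := fun h => hxy.1 (by rw [hE1, hE1, h])
    have h2 : g u ≠ g v := by
      have := hxy.2
      rwa [hE2, hE2] at this
    have hc : ∀ w, ¬ ((E w).1 : ℕ) < (k - 1)! →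
        ∀ s t, colorCount part g (part w) s = colorCount part g (part w) t := by
      intro w hw
      have := hconst (E w).1 (not_lt.1 hw)
      rwa [hE1, Equiv.apply_symm_apply] at this
    refine ⟨?_, ?_⟩
    · by_contra h
      exact huv (hD.adj_of_const hg h1 h2 (hc u h))
    · by_contra h
      exact huv (hD.adj_of_const hg h1.symm h2.symm (hc v h)).symm

end Pfender

/-! ### Colourability -/

section Proper

open Finset

variable {V : Type*} [Fintype V]

/-- The density condition as a lower bound for the sum of the degrees. -/
theorem IsDenseMultipartite.le_sum_degIn {G : SimpleGraph V} {r m ℓ : ℕ} {part : V → Fin ℓ}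
    (hD : IsDenseMultipartite G r m part) (hr : 0 < r) (hV : Fintype.card V = ℓ * m) :
    (1 - 1 / (r : ℝ)) * ((Fintype.card V : ℝ) ^ 2 - Fintype.card V * m) ≤
      ∑ x, (degIn G univ x : ℝ) := by
  classical
  have hr0 : (0 : ℝ) < r := by exact_mod_cast hr
  have h1 : ∀ i, ((1 - 1 / (r : ℝ)) * m ^ 2) * (ℓ - 1) ≤
      ∑ u with part u = i, (degIn G univ u : ℝ) := by
    intro i
    have h2 : ∑ j ∈ univ.erase i, pairCount part G.Adj i j ≤
        ∑ u with part u = i, degIn G univ u := by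
      rw [sum_pairCount]
      refine sum_le_sum fun u _ => card_le_card fun w hw => ?_
      exact mem_filter.2 ⟨mem_univ _, (mem_filter.1 hw).2.2⟩
    have h3 : ((1 - 1 / (r : ℝ)) * m ^ 2) * (ℓ - 1) ≤
        ∑ j ∈ univ.erase i, (pairCount part G.Adj i j : ℝ) := by
      have hℓ : ((#(univ.erase i) : ℕ) : ℝ) = ℓ - 1 := by
        rw [card_erase_of_mem (mem_univ i), card_univ, Fintype.card_fin,
          Nat.cast_sub (Nat.one_le_of_lt i.pos), Nat.cast_one]
      rw [← hℓ, mul_comm, ← nsmul_eq_mul]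
      refine card_nsmul_le_sum _ _ _ fun j hj => ?_
      have := hD.dense i j (ne_of_mem_erase hj).symm
      refine le_of_mul_le_mul_left ?_ hr0
      calc (r : ℝ) * ((1 - 1 / r) * m ^ 2) = (r - 1) * m ^ 2 := by field_simp
        _ ≤ _ := this
    exact h3.trans (by exact_mod_cast h2)
  calc (1 - 1 / (r : ℝ)) * ((Fintype.card V : ℝ) ^ 2 - Fintype.card V * m)
      = ∑ _i : Fin ℓ, ((1 - 1 / (r : ℝ)) * m ^ 2) * (ℓ - 1) := by
        rw [sum_const, card_univ, Fintype.card_fin, nsmul_eq_mul, hV]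
        push_cast
        ring
    _ ≤ ∑ i, ∑ u with part u = i, (degIn G univ u : ℝ) := sum_le_sum fun i _ => h1 i
    _ = _ := sum_fiberwise univ part fun u => (degIn G univ u : ℝ)

/-- A joint-free graph attaining the densities is `r`-colourable if it has sufficiently many
parts. -/
theorem JointFree.exists_proper_of_dense {G : SimpleGraph V} {r H N m ℓ : ℕ} {part : V → Fin ℓ}
    (hG : JointFree G r H N) (hD : IsDenseMultipartite G r m part) (hr : 2 ≤ r)
    (hV : Fintype.card V = ℓ * m) (hm : 0 < m) (hN0 : 0 < N)
    (hHr : 4 * (2 * r + 1) * r ^ (r + 2) ≤ H) (hHr' : 16 * r ^ 4 ≤ H)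
    (hHr2 : (2 * r + 1) * 2 ^ r ≤ H) (hHr3 : r ! * (16 * r ^ 2) ≤ H)
    (hℓ : H ^ 5 ≤ ℓ) (hN : N * (4 * H ^ 2) ≤ Fintype.card V) :
    ∃ g : V → Fin r, ∀ u v, G.Adj u v → g u ≠ g v := by
  classical
  have hr3 : 32 * r ≤ H := by
    calc 32 * r ≤ 16 * r ^ 4 := by
          have : 2 ^ 3 ≤ r ^ 3 := Nat.pow_le_pow_left hr 3
          calc 32 * r ≤ 16 * (2 ^ 3 * r) := by omega
            _ ≤ 16 * (r ^ 3 * r) := by gcongr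
            _ = 16 * r ^ 4 := by ring
      _ ≤ H := hHr'
  have hrH : r ^ 3 ≤ H := by
    calc r ^ 3 ≤ r ^ 4 := Nat.pow_le_pow_right (by omega) (by omega)
      _ ≤ H := by omega
  have hH : 64 ≤ H := by omega
  have hH' : (64 : ℝ) ≤ H := by exact_mod_cast hH
  have hH0 : (0 : ℝ) < H := by linarith
  have hmV : H ^ 5 * m ≤ Fintype.card V := by
    rw [hV]
    exact Nat.mul_le_mul_right m hℓ
  have hmVR : (H : ℝ) ^ 5 * m ≤ Fintype.card V := by exact_mod_cast hmV
  have hNR : (N : ℝ) * (4 * H ^ 2) ≤ Fintype.card V := by exact_mod_cast hN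
  have hVR : (Fintype.card V : ℝ) = ℓ * m := by exact_mod_cast hV
  have hm0 : (1 : ℝ) ≤ m := by exact_mod_cast hm
  have hN1 : (1 : ℝ) ≤ N := by exact_mod_cast hN0
  set B : ℝ := Fintype.card V / H with hB
  have hBV : B * H = Fintype.card V := div_mul_cancel₀ _ hH0.ne'
  obtain ⟨S, χ, hS, hmiss, hin⟩ := hG.exists_coloring_univ hr hHr hHr' hHr2 hN0 (by
    calc 4 * r ^ 3 * H * N ≤ 4 * H * H * N := by gcongr
      _ = N * (4 * H ^ 2) := by ring
      _ ≤ _ := hN) hmV hm (hD.le_sum_degIn (by omega) hV)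
  have hNB : 4 * (N : ℝ) ≤ B := by
    rw [hB, le_div_iff₀ hH0]
    calc 4 * (N : ℝ) * H ≤ 4 * N * (H * H) := by
          gcongr
          nlinarith
      _ = N * (4 * H ^ 2) := by ring
      _ ≤ _ := hNR
  have hHm : (H : ℝ) ^ 4 * m ≤ B := by
    rw [hB, le_div_iff₀ hH0]
    calc (H : ℝ) ^ 4 * m * H = H ^ 5 * m := by ring
      _ ≤ _ := hmVR
  have hHm1 : (H : ℝ) * m ≤ B := by
    refine le_trans ?_ hHm
    gcongr
    exact le_self_pow₀ (by linarith) (by norm_num)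
  have hmB : 2 * (m : ℝ) ≤ B := by nlinarith
  have hmiss' : 8 * r * ∑ x ∈ S, (missing G χ S x : ℝ) ≤ (B / 2) ^ 2 := by
    refine hmiss.trans_eq ?_
    rw [hB]
    congr 1
    field_simp
  obtain ⟨J, hJ, hexact, hconst⟩ := hG.exists_balanced_family hD hr hHr2 hN0 B hNB hmB S χ
    (le_trans (by exact_mod_cast hS) hHm1) hmiss' hin (by
      rw [← hVR, ← hBV]
      have h3 : (r ! : ℝ) * (16 * r ^ 2) ≤ H := by exact_mod_cast hHr3
      have hB0 : 0 ≤ B := by linarith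
      calc (r ! : ℝ) * (16 * r ^ 2 * B) = B * (r ! * (16 * r ^ 2)) := by ring
        _ ≤ B * H := by gcongr)
  refine hG.exists_proper hD hr hHr2 hN0 B hNB hmB ?_ χ J hJ hexact hconst
  have hB0 : 0 ≤ B := by linarith
  have h32 : 32 * (r : ℝ) ≤ H := by exact_mod_cast hr3
  calc 8 * r * (Fintype.card V * m : ℝ) = B * (32 * r * H * m) / 4 := by
        rw [← hBV]
        ring
    _ ≤ B * (H * H * m) / 4 := by gcongr
    _ ≤ B * (H ^ 4 * m) / 4 := by
        have : (H : ℝ) * H ≤ H ^ 4 := by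
          rw [← sq]
          exact pow_le_pow_right₀ (by linarith) (by norm_num)
        gcongr
    _ ≤ B * B / 4 := by gcongr
    _ = (B / 2) ^ 2 := by ring

end Proper

/-! ### Numerical estimates -/

section Numerics

open Finset

/-- The sizes of the sets in the search for `K_r^+(a, …, a, b)` are at most `n / (4 H²)`: with
`c H ^ k ≤ 1 / 2`, the power `2 ^ (a H ^ (k - 1))` is at most `n ^ (1 / (2 H))`, and
`b * 2 ^ (H a)` is at most `n ^ (1 - √c)`, while `n ^ √c` exceeds `4 H³`. -/
theorem bounds_of_exp_le {k n H : ℕ} {c : ℝ} (hk : 3 ≤ k) (hc0 : 0 < c) (hH : 2 ≤ H)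
    (hc : c * H ^ k ≤ 1 / 2) (hn : Real.exp (2 / c) ≤ n) :
    0 < ⌊c * Real.log n⌋₊ ∧
    ⌊c * Real.log n⌋₊ * H ^ (k - 1) * (H * 2 ^ (⌊c * Real.log n⌋₊ * H ^ (k - 1))) * (4 * H ^ 2) ≤
      n ∧
    ⌊(n : ℝ) ^ (1 - 2 * Real.sqrt c)⌋₊ * (H * 2 ^ (H * ⌊c * Real.log n⌋₊)) * (4 * H ^ 2) ≤ n := by
  have hn0 : (0 : ℝ) < n := (Real.exp_pos _).trans_le hn
  set L := Real.log n with hL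
  have hnL : (n : ℝ) = Real.exp L := (Real.exp_log hn0).symm
  have hLc : 2 / c ≤ L := (Real.le_log_iff_exp_le hn0).2 hn
  have hL0 : 0 < L := lt_of_lt_of_le (by positivity) hLc
  have hcL : 2 ≤ c * L := by
    rw [div_le_iff₀ hc0] at hLc
    linarith
  have ha : (⌊c * L⌋₊ : ℝ) ≤ c * L := Nat.floor_le (by linarith)
  have hH2 : (2 : ℝ) ≤ H := by exact_mod_cast hH
  have hH3 : (H : ℝ) ^ 3 ≤ H ^ k := pow_le_pow_right₀ (by linarith) hk
  have hcH3 : c * H ^ 3 ≤ 1 / 2 := le_trans (by gcongr) hc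
  set q := Real.sqrt c with hq
  have hq0 : 0 < q := Real.sqrt_pos.2 hc0
  have hqq : q * q = c := Real.mul_self_sqrt hc0.le
  have hqH : q * H ≤ 1 / 2 := by
    refine abs_le_of_sq_le_sq' ?_ (by norm_num) |>.2
    calc (q * H) ^ 2 = c * H ^ 2 := by rw [← hqq]; ring
      _ ≤ c * H ^ 3 / 2 := by nlinarith [mul_pos hc0 (pow_pos (by linarith : (0 : ℝ) < H) 2)]
      _ ≤ (1 / 2) ^ 2 := by linarith
  have hq2 : q ≤ 1 / 2 := by nlinarith
  -- the main lower bound: `4 H³ ≤ 2 / c ≤ n ^ √c`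
  have hmain : 4 * (H : ℝ) ^ 3 ≤ Real.exp (q * L) := by
    have h1 : 2 / q ≤ q * L := by
      rw [div_le_iff₀ hq0]
      nlinarith
    have h2 : 4 * (H : ℝ) ^ 3 ≤ 2 / c := by
      rw [le_div_iff₀ hc0]
      linarith
    calc 4 * (H : ℝ) ^ 3 ≤ 2 / c := h2
      _ = (2 / q) ^ 2 / 2 := by
        rw [← hqq]
        field_simp
      _ ≤ Real.exp (2 / q) := by
        have := Real.quadratic_le_exp_of_nonneg (x := 2 / q) (by positivity)
        have h3 : 0 < 2 / q := by positivity
        linarith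
      _ ≤ _ := Real.exp_le_exp.2 h1
  have htwo : ∀ e : ℕ, (2 : ℝ) ^ e ≤ Real.exp e := fun e => by
    rw [← Real.exp_one_pow]
    gcongr
    linarith [Real.add_one_le_exp (1 : ℝ)]
  refine ⟨Nat.floor_pos.2 (by linarith), ?_, ?_⟩
  · set B := ⌊c * L⌋₊ * H ^ (k - 1) with hB
    have hBL : 2 * (B : ℝ) ≤ L / 2 := by
      have h1 : (B : ℝ) ≤ c * L * H ^ (k - 1) := by
        rw [hB]
        push_cast
        gcongr
      have h2 : c * L * H ^ (k - 1) * H = c * H ^ k * L := by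
        rw [mul_assoc, ← pow_succ, Nat.sub_add_cancel (by omega)]
        ring
      have h3 : (B : ℝ) * H ≤ L / 2 := by
        calc (B : ℝ) * H ≤ c * L * H ^ (k - 1) * H := by gcongr
          _ = c * H ^ k * L := h2
          _ ≤ 1 / 2 * L := by gcongr
          _ = L / 2 := by ring
      nlinarith [(Nat.cast_nonneg B : (0 : ℝ) ≤ B)]
    have h1 : (B : ℝ) ≤ 2 ^ B := by exact_mod_cast Nat.lt_two_pow_self.le
    have hR : (B : ℝ) * (H * 2 ^ B) * (4 * H ^ 2) ≤ n := by
      calc (B : ℝ) * (H * 2 ^ B) * (4 * H ^ 2)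
          ≤ (2 : ℝ) ^ B * (H * 2 ^ B) * (4 * H ^ 2) := by gcongr
        _ = 4 * (H : ℝ) ^ 3 * (2 ^ B * 2 ^ B) := by ring
        _ ≤ Real.exp (q * L) * (Real.exp B * Real.exp B) := by
          gcongr <;> exact htwo B
        _ = Real.exp (q * L + (B + B)) := by rw [Real.exp_add, Real.exp_add]
        _ ≤ Real.exp L := Real.exp_le_exp.2 (by nlinarith)
        _ = n := hnL.symm
    exact_mod_cast hR
  · have hb : (⌊(n : ℝ) ^ (1 - 2 * q)⌋₊ : ℝ) ≤ Real.exp (L * (1 - 2 * q)) :=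
      (Nat.floor_le (by positivity)).trans_eq (Real.rpow_def_of_pos hn0 _)
    have hp : (2 : ℝ) ^ (H * ⌊c * L⌋₊) ≤ Real.exp (H * (c * L)) := by
      refine (htwo _).trans (Real.exp_le_exp.2 ?_)
      push_cast
      gcongr
    have hR : (⌊(n : ℝ) ^ (1 - 2 * q)⌋₊ : ℝ) * (H * 2 ^ (H * ⌊c * L⌋₊)) * (4 * H ^ 2) ≤ n := by
      calc (⌊(n : ℝ) ^ (1 - 2 * q)⌋₊ : ℝ) * (H * 2 ^ (H * ⌊c * L⌋₊)) * (4 * H ^ 2)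
          ≤ Real.exp (L * (1 - 2 * q)) * (H * Real.exp (H * (c * L))) * (4 * H ^ 2) := by gcongr
        _ = 4 * H ^ 3 * (Real.exp (L * (1 - 2 * q)) * Real.exp (H * (c * L))) := by ring
        _ ≤ Real.exp (q * L) * (Real.exp (L * (1 - 2 * q)) * Real.exp (H * (c * L))) := by gcongr
        _ = Real.exp (q * L + (L * (1 - 2 * q) + H * (c * L))) := by
          rw [Real.exp_add, Real.exp_add]
        _ ≤ Real.exp L := by
          refine Real.exp_le_exp.2 ?_
          have : H * (c * L) = q * H * (q * L) := by rw [← hqq]; ring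
          rw [this]
          nlinarith [mul_pos hq0 hL0]
        _ = n := hnL.symm
    exact_mod_cast hR

/-- The number `H = k ^ (k + 6)` is as large as the colouring lemmas with `r = k - 1` require. -/
theorem factorial_bounds {k : ℕ} (hk : 3 ≤ k) :
    4 * (2 * (k - 1) + 1) * (k - 1) ^ (k - 1 + 2) ≤ k ^ (k + 6) ∧ 16 * (k - 1) ^ 4 ≤ k ^ (k + 6) ∧
      (2 * (k - 1) + 1) * 2 ^ (k - 1) ≤ k ^ (k + 6) ∧
      (k - 1)! * (16 * (k - 1) ^ 2) ≤ k ^ (k + 6) := by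
  have h3 : 3 ^ 4 ≤ k ^ 4 := Nat.pow_le_pow_left hk 4
  have hk1 : k - 1 ≤ k := Nat.sub_le _ _
  have h2 : 2 * (k - 1) + 1 ≤ 2 * k := by omega
  refine ⟨?_, ?_, ?_, ?_⟩
  · calc 4 * (2 * (k - 1) + 1) * (k - 1) ^ (k - 1 + 2) ≤ 4 * (2 * k) * k ^ (k - 1 + 2) := by gcongr
      _ = 8 * k * k ^ (k + 1) := by rw [show k - 1 + 2 = k + 1 by omega]; ring
      _ ≤ k ^ 4 * k * k ^ (k + 1) := by gcongr; omega
      _ = k ^ (k + 6) := by ring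
  · calc 16 * (k - 1) ^ 4 ≤ k ^ 4 * k ^ 4 := by gcongr; omega
      _ = k ^ 8 := by ring
      _ ≤ k ^ (k + 6) := Nat.pow_le_pow_right (by omega) (by omega)
  · calc (2 * (k - 1) + 1) * 2 ^ (k - 1) ≤ 2 * k * k ^ k := by
          exact Nat.mul_le_mul h2
            ((Nat.pow_le_pow_left (by omega) _).trans (Nat.pow_le_pow_right (by omega) hk1))
      _ ≤ k ^ 5 * k * k ^ k := by
          gcongr
          calc 2 ≤ k ^ 4 := by omega
            _ ≤ k ^ 5 := Nat.pow_le_pow_right (by omega) (by omega)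
      _ = k ^ (k + 6) := by ring
  · calc (k - 1)! * (16 * (k - 1) ^ 2) ≤ k ^ k * (k ^ 4 * k ^ 2) := by
          gcongr
          · exact (Nat.factorial_le hk1).trans (Nat.factorial_le_pow k)
          · omega
      _ = k ^ (k + 6) := by ring

end Numerics

/-! ### Balanced multipartite graphs -/

section Balanced

open Finset

variable {V : Type*} [Fintype V]

theorem IsBalancedMultipartite.isDenseMultipartite {k ℓ : ℕ} (hk : 3 ≤ k) {G : SimpleGraph V}
    [DecidableRel G.Adj] {P : Fin ℓ → Finset V} (hP : IsBalancedMultipartite G P)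
    (hd : ∀ i j, i ≠ j → ((k : ℚ) - 2) / ((k : ℚ) - 1) ≤ G.edgeDensity (P i) (P j))
    (i₀ : Fin ℓ) :
    ∃ (m : ℕ) (part : V → Fin ℓ), 0 < m ∧ IsDenseMultipartite G (k - 1) m part := by
  classical
  choose part hpart using hP.cover
  have hmem : ∀ v i, v ∈ P i ↔ part v = i := by
    refine fun v i => ⟨fun h => ?_, fun h => h ▸ hpart v⟩
    by_contra hne
    exact disjoint_left.1 (hP.disjoint _ _ hne) (hpart v) h
  have hm : 0 < #(P i₀) := (hP.nonempty i₀).card_pos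
  refine ⟨#(P i₀), part, hm, ⟨fun i => ?_, fun u v h huv => ?_, fun i j hij => ?_⟩⟩
  · rw [← hP.card_eq i i₀]
    congr 1
    ext v
    simp [hmem]
  · exact hP.independent _ u (hpart u) v ((hmem v _).2 huv.symm) h
  · have h1 : #(G.interedges (P i) (P j)) = pairCount part G.Adj i j := by
      rw [pairCount]
      congr 1
      ext x
      simp [SimpleGraph.mem_interedges_iff, hmem]
    have h2 := hd i j hij
    have hk1 : (0 : ℚ) < (k : ℚ) - 1 := by
      have : (3 : ℚ) ≤ k := by exact_mod_cast hk
      linarith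
    have hm' : (0 : ℚ) < #(P i₀) := by exact_mod_cast hm
    rw [SimpleGraph.edgeDensity_def, h1, hP.card_eq i i₀, hP.card_eq j i₀,
      div_le_div_iff₀ hk1 (by positivity)] at h2
    have hcast : ((k - 1 : ℕ) : ℝ) = k - 1 := by
      rw [Nat.cast_sub (by omega), Nat.cast_one]
    have h3 : ((k : ℝ) - 2) * (#(P i₀) * #(P i₀)) ≤ pairCount part G.Adj i j * (k - 1) := by
      exact_mod_cast h2
    rw [hcast]
    linarith

end Balanced

theorem mainTheorem3 (k ℓ : ℕ) (c : ℝ) (hk : 3 ≤ k) (hc0 : 0 < c)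
    (hc : c ≤ ((k : ℝ) ^ ((k + 6) * k))⁻¹ / 2) (hℓ : Real.exp (2 / c) ≤ (ℓ : ℝ))
    {V : Type*} [Fintype V] (G : SimpleGraph V) [DecidableRel G.Adj]
    (P : Fin ℓ → Finset V) (hP : IsBalancedMultipartite G P)
    (n : ℕ) (hn : Fintype.card V = n)
    (hd : ∀ i j, i ≠ j → ((k : ℚ) - 2) / ((k : ℚ) - 1) ≤ G.edgeDensity (P i) (P j)) :
    (completePlus (lastSize (k - 1) ⌊c * Real.log n⌋₊
        ⌊(n : ℝ) ^ (1 - 2 * Real.sqrt c)⌋₊)).IsContained G ∨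
      IsoToPfenderFamily k ℓ G := by
  refine or_iff_not_imp_left.2 fun hnot => ?_
  have hℓ0 : 0 < ℓ := by exact_mod_cast (Real.exp_pos _).trans_le hℓ
  obtain ⟨m, part, hm, hD⟩ := hP.isDenseMultipartite hk hd ⟨0, hℓ0⟩
  have hV : Fintype.card V = ℓ * m := by
    have := card_eq_mul_card part hD.card_part Finset.univ
    simpa using this
  set H := k ^ (k + 6) with hH
  obtain ⟨hH1, hH2, hH3, hH4⟩ := factorial_bounds hk
  have hHR : (k : ℝ) ^ ((k + 6) * k) = (H : ℝ) ^ k := by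
    rw [hH, pow_mul]
    push_cast
    rfl
  have hH2le : 2 ≤ H := by
    calc 2 ≤ 16 * 1 ^ 4 := by norm_num
      _ ≤ 16 * (k - 1) ^ 4 := by gcongr; omega
      _ ≤ H := hH2
  have hH0 : (1 : ℝ) ≤ H := by exact_mod_cast (by omega : 1 ≤ H)
  have hcH : c * H ^ k ≤ 1 / 2 := by
    have h0 : (0 : ℝ) < (H : ℝ) ^ k := by positivity
    rw [hHR] at hc
    calc c * H ^ k ≤ ((H : ℝ) ^ k)⁻¹ / 2 * H ^ k := by gcongr
      _ = 1 / 2 := by field_simp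
  have hℓH : H ^ 5 ≤ ℓ := by
    have h1 : 4 * (H : ℝ) ^ k ≤ 2 / c := by
      rw [le_div_iff₀ hc0]
      linarith
    have h2 : (H : ℝ) ^ 3 ≤ H ^ k := pow_le_pow_right₀ hH0 hk
    have h3 : (H : ℝ) ^ 5 ≤ ℓ := by
      calc (H : ℝ) ^ 5 ≤ H ^ 6 := pow_le_pow_right₀ hH0 (by norm_num)
        _ = H ^ 3 * H ^ 3 := by ring
        _ ≤ (2 / c) * (2 / c) / 2 := by
          have : 0 ≤ (H : ℝ) ^ 3 := by positivity
          nlinarith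
        _ ≤ Real.exp (2 / c) := by
          have := Real.quadratic_le_exp_of_nonneg (x := 2 / c) (by positivity)
          have h3 : 0 < 2 / c := by positivity
          nlinarith
        _ ≤ ℓ := hℓ
    exact_mod_cast h3
  have hnℓ : Real.exp (2 / c) ≤ n := by
    refine hℓ.trans ?_
    rw [← hn, hV]
    exact_mod_cast Nat.le_mul_of_pos_right ℓ hm
  obtain ⟨ha, hB, hb⟩ := bounds_of_exp_le hk hc0 hH2le hcH hnℓ
  have hHpos : 0 < 4 * H ^ 2 := by positivity
  have hJF := jointFree_of_not_isContained (by omega) ha (by omega) le_rfl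
    ((Nat.le_div_iff_mul_le hHpos).2 hB) ((Nat.le_div_iff_mul_le hHpos).2 hb) hnot
  have hN0 : 0 < n / (4 * H ^ 2) := by
    refine lt_of_lt_of_le ?_ ((Nat.le_div_iff_mul_le hHpos).2 hB)
    positivity
  obtain ⟨g, hg⟩ := hJF.exists_proper_of_dense hD (by omega) hV hm hN0 hH1 hH2 hH3 hH4 hℓH
    (by rw [hn]; exact Nat.div_mul_le_self _ _)
  refine hD.isoToPfenderFamily hk hm ?_ hg
  calc (k - 1)! ≤ (k - 1)! * (16 * (k - 1) ^ 2) := Nat.le_mul_of_pos_right _ (by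
        have : 0 < k - 1 := by omega
        positivity)
    _ ≤ H := hH4
    _ ≤ H ^ 5 := Nat.le_self_pow (by norm_num) H
    _ ≤ ℓ := hℓH
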